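/- Let $n\ge 2$ and $m\ge 1$. Let $\mathbf C=(M,\theta,\vec{\mathbf C})$ be a nonzero $n$-dimensional integer multiplicity rectifiable current in $\mathbb R^{n+m}$, i.e. $\mathbf C(\omega)=\int_M\langle\omega,\vec{\mathbf C}\rangle\,\theta\,d\mathcal H^n$ for smooth compactly supported $n$-forms $\omega$, where $M$ is $\mathcal H^n$-measurable and countably $n$-rectifiable, $\theta:M\to\{1,2,\dots\}$ is locally $\mathcal H^n$-integrable, and $\vec{\mathbf C}(X)$ is an $\mathcal H^n$-measurable unit simple $n$-vector orienting the approximate tangent plane $\operatorname{Tan}(M,X)$ for $\mathcal H^n$-a.e. $X\in M$. Put $\|\mathbf C\|=\theta\,\mathcal H^n\llcorner M$, and let $|\mathbf C|$ be the associated integral varifold, $\int\varphi(X,S)\,d|\mathbf C|(X,S)=\int_M\varphi(X,\operatorname{Tan}(M,X))\,\theta(X)\,d\mathcal H^n(X)$. Assume that - $\partial\mathbf C=0$; - $\mathbf C$ is locally area-minimizing in $\mathbb R^{n+m}$: $\|\mathbf C\|(W)\le\|S\|(W)$ for every open set $W$ with compact closure and every $n$-dimensional integer multiplicity rectifiable current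 $S$ in $\mathbb R^{n+m}$ with $\partial S=\partial\mathbf C$ and $\operatorname{spt}(S-\mathbf C)\subset W$; - $\mathbf C$ is a cone with vertex $0$: $\eta_{0,\lambda\#}\mathbf C=\mathbf C$ for all $\lambda>0$, where $\eta_{0,\lambda}(X)=X/\lambda$. Let $P$ be an $n$-dimensional linear subspace of $\mathbb R^{n+m}$ such that $\operatorname{spt}\mathbf C\cap P^\perp=\{0\}$ and $\operatorname{spt}\mathbf C\ne P$. Let $r(X)=|\pi_P(X)|$, where $\pi_S$ denotes the orthogonal projection onto a subspace $S$; let $\nabla^S r=\pi_S(\nabla r)$, let $\|\cdot\|$ be the Frobenius norm of linear maps, let $\mathbf C_\rho(0,P)=\{X: r(X)<\rho\}$, and let $\phi(s)=1$ for $0\le s<\frac12$, $\phi(s)=2-2s$ for $\frac12\le s<1$, $\phi(s)=0$ for $s\ge1$. For $\rho>0$ set $$H_{\mathbf C,P,0}(\rho)=2\rho^{1-n}\int_{\{(X,S)\,:\,X\in\mathbf C_\rho(0,P)\setminus\overline{\mathbf C_{\rho/2}(0,P)}\}}\operatorname{dist}^2(X,P)\,|\nabla^S r|^2\,\frac1r\,d|\mathbf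 C|(X,S),$$ $$D_{\mathbf C,P,0}(\rho)=\frac12\,\rho^{2-n}\int\|\pi_S-\pi_P\|^2\,\phi(r/\rho)\,d|\mathbf C|(X,S).$$ Then $\sup\{\operatorname{dist}(X,P): X\in\operatorname{spt}\mathbf C\cap\mathbf C_{\rho_0}(0,P)\}<\infty$ for every $\rho_0>0$, and for every $\rho>0$ the integrals defining $H_{\mathbf C,P,0}(\rho)$ and $D_{\mathbf C,P,0}(\rho)$ converge, $H_{\mathbf C,P,0}(\rho)>0$ (so that the planar frequency $N_{\mathbf C,P,0}(\rho)=D_{\mathbf C,P,0}(\rho)/H_{\mathbf C,P,0}(\rho)$ is defined), and $$N_{\mathbf C,P,0}(\rho)\le 1 .$$ -/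

import Mathlib

open MeasureTheory Filter Topology Set
open scoped ENNReal

noncomputable section

namespace PlanarFrequency

/-- The Euclidean space `ℝ^N`. -/
abbrev Euc (N : ℕ) : Type := EuclideanSpace ℝ (Fin N)

/-- A smooth differential `k`-form with compact support in `ℝ^N`. -/
structure TestForm (N k : ℕ) where
  /-- the underlying differential form -/
  form : Euc N → Euc N [⋀^Fin k]→L[ℝ] ℝ
  smooth : ContDiff ℝ ((⊤ : ℕ∞) : WithTop ℕ∞) form
  compact : HasCompactSupport form

/-- The exterior derivative `dα` of a test form. -/
def TestForm.d {N k : ℕ} (α : TestForm N k) : TestForm N (k + 1) where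
  form := extDeriv α.form
  smooth := by
    have h : ContDiff ℝ ((⊤ : ℕ∞) : WithTop ℕ∞) (fderiv ℝ α.form) := α.smooth.fderiv_right (by simp)
    exact (ContinuousAlternatingMap.alternatizeUncurryFinCLM ℝ (Euc N) ℝ).contDiff.comp h
  compact :=
    (α.compact.fderiv (𝕜 := ℝ)).comp_left
      (g := ContinuousAlternatingMap.alternatizeUncurryFinCLM ℝ (Euc N) ℝ) (map_zero _)

/-- The pull-back `η^* α` of a test form by the dilation `η(X) = X / t`, where `t ≠ 0`. -/
def TestForm.pullbackDilation {N k : ℕ} (t : ℝ) (ht : t ≠ 0) (α : TestForm N k) :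
    TestForm N k where
  form := fun X =>
    (α.form (t⁻¹ • X)).compContinuousLinearMap (t⁻¹ • ContinuousLinearMap.id ℝ (Euc N))
  smooth := by
    have h : ContDiff ℝ ((⊤ : ℕ∞) : WithTop ℕ∞) (fun X : Euc N => α.form (t⁻¹ • X)) :=
      α.smooth.comp (contDiff_const_smul _)
    exact (ContinuousAlternatingMap.compContinuousLinearMapCLM
      (t⁻¹ • ContinuousLinearMap.id ℝ (Euc N))).contDiff.comp h
  compact := by
    have h : HasCompactSupport (fun X : Euc N => α.form (t⁻¹ • X)) :=
      α.compact.comp_homeomorph (Homeomorph.smulOfNeZero t⁻¹ (inv_ne_zero ht))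
    exact h.comp_left (g := ContinuousAlternatingMap.compContinuousLinearMapCLM
      (t⁻¹ • ContinuousLinearMap.id ℝ (Euc N))) (map_zero _)

/-- A real-valued functional on test `k`-forms. The functionals that occur below are the
`k`-dimensional currents given by integration over rectifiable sets, and their boundaries,
push-forwards and differences. -/
abbrev FormFunctional (N k : ℕ) : Type := TestForm N k → ℝ

namespace FormFunctional

/-- The boundary, `(∂T)(α) = T(dα)`; a `0`-dimensional current has no boundary. -/
def boundary {N : ℕ} : {k : ℕ} → FormFunctional N k → FormFunctional N (k - 1)
  | 0, _ => 0
  | _ + 1, T => fun α => T α.d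

/-- The push-forward `η_# T` under the dilation `η(X) = X / t`: `(η_# T)(α) = T(η^* α)`. -/
def pushDilation {N k : ℕ} (t : ℝ) (ht : t ≠ 0) (T : FormFunctional N k) : FormFunctional N k :=
  fun α => T (α.pullbackDilation t ht)

/-- The support: `X ∈ spt T` iff `T` does not vanish identically on the forms supported in `V`,
for every open neighbourhood `V` of `X`. -/
def spt {N k : ℕ} (T : FormFunctional N k) : Set (Euc N) :=
  {X | ∀ V : Set (Euc N), IsOpen V → X ∈ V → ∃ α : TestForm N k, tsupport α.form ⊆ V ∧ T α ≠ 0}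

end FormFunctional

/-- `M` is countably `n`-rectifiable: up to an `ℋⁿ`-null set, it is covered by countably many
Lipschitz images of `ℝⁿ`. (`μHE[n]` is the Hausdorff measure `ℋⁿ`, normalized to agree with
Lebesgue measure on `ℝⁿ`.) -/
def CountablyRectifiable {N : ℕ} (n : ℕ) (M : Set (Euc N)) : Prop :=
  ∃ F : ℕ → Euc n → Euc N, (∀ j, ∃ K, LipschitzWith K (F j)) ∧
    (μHE[n] : Measure (Euc N)) (M \ ⋃ j, range (F j)) = 0

/-- `η_{Y,t}(X) = (X - Y) / t`. -/
def eta {N : ℕ} (Y : Euc N) (t : ℝ) (X : Euc N) : Euc N := t⁻¹ • (X - Y)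

/-- `S` is the (`n`-dimensional) approximate tangent plane to `M` at `X`: the rescalings
`ℋⁿ ⌞ η_{X,t}(M)` converge to `ℋⁿ ⌞ S` as Radon measures as `t → 0⁺`. -/
def IsApproxTangentPlane {N : ℕ} (n : ℕ) (M : Set (Euc N)) (X : Euc N)
    (S : Submodule ℝ (Euc N)) : Prop :=
  Module.finrank ℝ S = n ∧
  ∀ f : Euc N → ℝ, Continuous f → HasCompactSupport f →
    Tendsto (fun t : ℝ => ∫ Y in eta X t '' M, f Y ∂μHE[n]) (𝓝[>] 0)
      (𝓝 (∫ Y in (S : Set (Euc N)), f Y ∂μHE[n]))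

/-- The data `(M, θ, T⃗)` of an `n`-dimensional integer multiplicity rectifiable current of `ℝ^N`.
The orientation `T⃗(X) = τ₁(X) ∧ ⋯ ∧ τₙ(X)` is recorded by an orthonormal frame `τ(X)` of the
approximate tangent plane; a measurable field of unit simple `n`-vectors always has a measurable
such frame. -/
structure RectifiableCurrent (N n : ℕ) where
  /-- the carrying rectifiable set `M` -/
  carrier : Set (Euc N)
  /-- the multiplicity `θ` -/
  mult : Euc N → ℕ
  /-- the orthonormal frame `τ` representing the orientation -/
  frame : Euc N → Fin n → Euc N
  carrier_meas : NullMeasurableSet carrier μHE[n]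
  carrier_rect : CountablyRectifiable n carrier
  mult_meas : AEMeasurable mult (μHE[n].restrict carrier)
  mult_pos : ∀ X ∈ carrier, 0 < mult X
  mult_locInt : ∀ K : Set (Euc N), IsCompact K →
    ∫⁻ X in carrier ∩ K, (mult X : ℝ≥0∞) ∂μHE[n] < ⊤
  frame_meas : AEMeasurable frame (μHE[n].restrict carrier)
  frame_tangent : ∀ᵐ X ∂(μHE[n].restrict carrier), Orthonormal ℝ (frame X) ∧
    IsApproxTangentPlane n carrier X (Submodule.span ℝ (range (frame X)))

namespace RectifiableCurrent

variable {N n : ℕ}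

/-- The current as a functional: `T(α) = ∫_M ⟨α, T⃗⟩ θ dℋⁿ`. -/
def toFunctional (T : RectifiableCurrent N n) : FormFunctional N n :=
  fun α => ∫ X in T.carrier, α.form X (T.frame X) * (T.mult X : ℝ) ∂μHE[n]

/-- The total variation measure `‖T‖ = θ dℋⁿ ⌞ M`. -/
def mass (T : RectifiableCurrent N n) : Measure (Euc N) :=
  (μHE[n].restrict T.carrier).withDensity (fun X => (T.mult X : ℝ≥0∞))

/-- The support of the current `T`. -/
def spt (T : RectifiableCurrent N n) : Set (Euc N) := T.toFunctional.spt

/-- The approximate tangent plane `Tan(M, X)`, for `ℋⁿ`-a.e. `X ∈ M`. -/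
def tangent (T : RectifiableCurrent N n) (X : Euc N) : Submodule ℝ (Euc N) :=
  Submodule.span ℝ (range (T.frame X))

/-- Integrability of `φ(X, S)` with respect to the varifold `|T|`. -/
def VarifoldIntegrable (T : RectifiableCurrent N n) (φ : Euc N → Submodule ℝ (Euc N) → ℝ) : Prop :=
  Integrable (fun X => φ X (T.tangent X)) T.mass

/-- The integral `∫ φ(X, S) d|T|(X, S) = ∫_M φ(X, Tan(M, X)) θ(X) dℋⁿ(X)` with respect to the
integral varifold `|T| = v(M, θ)`. -/
def varifoldIntegral (T : RectifiableCurrent N n) (φ : Euc N → Submodule ℝ (Euc N) → ℝ) : ℝ :=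
  ∫ X, φ X (T.tangent X) ∂T.mass

/-- `T` is locally area-minimizing in `ℝ^N`. -/
def LocallyAreaMinimizing (T : RectifiableCurrent N n) : Prop :=
  ∀ W : Set (Euc N), IsOpen W → IsCompact (closure W) →
    ∀ S : RectifiableCurrent N n,
      S.toFunctional.boundary = T.toFunctional.boundary →
      (S.toFunctional - T.toFunctional).spt ⊆ W →
      T.mass W ≤ S.mass W

/-- `T` is a cone with vertex `0`: `η_{0,t#} T = T` for all `t > 0`. -/
def IsCone (T : RectifiableCurrent N n) : Prop :=
  ∀ (t : ℝ) (ht : 0 < t), T.toFunctional.pushDilation t ht.ne' = T.toFunctional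

end RectifiableCurrent

variable {N : ℕ}

/-- The affine plane `Z + P`. -/
def affinePlane (Z : Euc N) (P : Submodule ℝ (Euc N)) : Set (Euc N) := (fun Y => Z + Y) '' P

/-- The function `r(X) = |π_P(X - Z)|`. -/
def radius (P : Submodule ℝ (Euc N)) (Z X : Euc N) : ℝ := ‖P.starProjection (X - Z)‖

/-- The open cylinder `𝐂_ρ(Z, P)`. -/
def cylinder (ρ : ℝ) (Z : Euc N) (P : Submodule ℝ (Euc N)) : Set (Euc N) := {X | radius P Z X < ρ}

/-- The gradient of `f` at `X` with respect to the plane `S`, i.e. `π_S (∇ f(X))`. -/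
def planeGradient (S : Submodule ℝ (Euc N)) (f : Euc N → ℝ) (X : Euc N) : Euc N :=
  S.starProjection (gradient f X)

/-- The Frobenius norm of a linear map. -/
def frobeniusNorm (A : Euc N →L[ℝ] Euc N) : ℝ :=
  Real.sqrt (∑ i : Fin N, ‖A (EuclideanSpace.single i 1)‖ ^ 2)

/-- The cut-off function `φ`. -/
def cutoff (s : ℝ) : ℝ := if s < 1 / 2 then 1 else if s < 1 then 2 - 2 * s else 0

/-- The integrand of `H_{T,P,Z}(ρ)`, extended by zero outside
`𝐂_ρ(Z, P) ∖ closure 𝐂_{ρ/2}(Z, P)`. -/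
def heightIntegrand (P : Submodule ℝ (Euc N)) (Z : Euc N) (ρ : ℝ) (X : Euc N)
    (S : Submodule ℝ (Euc N)) : ℝ :=
  (cylinder ρ Z P \ closure (cylinder (ρ / 2) Z P)).indicator
    (fun X => Metric.infDist X (affinePlane Z P) ^ 2 *
      ‖planeGradient S (radius P Z) X‖ ^ 2 * (1 / radius P Z X)) X

/-- The integrand of `D_{T,P,Z}(ρ)`. -/
def tiltIntegrand (P : Submodule ℝ (Euc N)) (Z : Euc N) (ρ : ℝ) (X : Euc N)
    (S : Submodule ℝ (Euc N)) : ℝ :=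
  frobeniusNorm (S.starProjection - P.starProjection) ^ 2 * cutoff (radius P Z X / ρ)

/-- `H_{T,P,Z}(ρ)`. -/
def heightH {n : ℕ} (T : RectifiableCurrent N n) (P : Submodule ℝ (Euc N)) (Z : Euc N) (ρ : ℝ) :
    ℝ :=
  2 * ρ ^ (1 - (n : ℤ)) * T.varifoldIntegral (heightIntegrand P Z ρ)

/-- `D_{T,P,Z}(ρ)`. -/
def tiltD {n : ℕ} (T : RectifiableCurrent N n) (P : Submodule ℝ (Euc N)) (Z : Euc N) (ρ : ℝ) : ℝ :=
  1 / 2 * ρ ^ (2 - (n : ℤ)) * T.varifoldIntegral (tiltIntegrand P Z ρ)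

/-- The planar frequency `N_{T,P,Z}(ρ) = D_{T,P,Z}(ρ) / H_{T,P,Z}(ρ)`, meaningful when
`H_{T,P,Z}(ρ) > 0`. -/
def planarFrequency {n : ℕ} (T : RectifiableCurrent N n) (P : Submodule ℝ (Euc N)) (Z : Euc N)
    (ρ : ℝ) : ℝ :=
  tiltD T P Z ρ / heightH T P Z ρ

end PlanarFrequency

end

noncomputable section

namespace PlanarFrequency

open scoped NNReal
open Module

/-! ### Distortion of Hausdorff measure under nearly linear maps -/

section

/-! Let p and q be the projections of X to P and to Pᗮ, let r = |p|, let S be the tangent plane at X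
with orthonormal frame τ, and let w = π_S p. The theorem is a first variation inequality tested with
one vector field, combined with one use of Cauchy-Schwarz.

A minimizing current without boundary satisfies ∫ div_S Y d‖C‖ ≥ 0 for all smooth compactly
supported Y (`integral_tangentDiv_nonneg`). Take Y = -Θ(r) q, where Θ is a smooth substitute for
φ(r/ρ) with Θ' = -(2/ρ)ψ and 0 ≤ ψ ≤ 1 supported in ρ/2 < r < ρ. Then ∫ Θ Σ|π_{Pᗮ} τᵢ|² ≤ (2/ρ) ∫ ψ
r⁻¹⟨w, q⟩. Since ‖π_S - π_P‖² = 2 Σ|π_{Pᗮ} τᵢ|², the left side is, up to an arbitrarily small error,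
at least half the tilt integral. The tangent planes of a cone contain the position vector
(`IsCone.mem_of_isApproxTangentPlane`), so ⟨w, X⟩ = |p|² and ⟨w, q⟩ = |p|² - |w|²; Cauchy-Schwarz
for ⟨w, X⟩ then gives r²⟨w, q⟩ ≤ |q|²|w|². As |∇^S r| = |w|/r, the right side is at most 2/ρ times
the height integral (`integral_tiltIntegrand_le`), and multiplication by ρ^(2-n) gives D ≤ H.

Integrability and the height bound come from compactness: the link of the cone misses Pᗮ, so |X| ≤ c
r on the support (`IsCone.exists_norm_le`), and the support is bounded in each cylinder. For H > 0,
suppose that the height integral is not positive. Then the tilt vanishes, almost every tangent plane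
in the cylinder lies in P, and X ∈ S ⊆ P puts the whole cone into P. A constancy argument using ∂C =
0 makes the support invariant under translations of P (`add_mem_spt`); since it contains 0, it
equals P, which is excluded.

Most of the work is to show that the deformed current is an admissible competitor, namely a
rectifiable current with measurable frame and genuine approximate tangent planes
(`RectifiableCurrent.pushforward`). This rests on the area formula, on the identification of
approximate tangent planes with ranges of chart derivatives, and on a Lebesgue point argument for
images of tangent planes. -/

theorem euclideanHausdorffMeasure_image_le_of_lipschitzOnWith {X Y : Type*} [MetricSpace X]
    [MeasurableSpace X] [BorelSpace X] [MetricSpace Y] [MeasurableSpace Y] [BorelSpace Y]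
    (n : ℕ) {f : X → Y} {s : Set X} {K : ℝ≥0} (h : LipschitzOnWith K f s) :
    (μHE[n] : Measure Y) (f '' s) ≤ (K : ℝ≥0∞) ^ n * (μHE[n] : Measure X) s := by
  have := h.hausdorffMeasure_image_le (d := n) (by positivity)
  simp_rw [Measure.euclideanHausdorffMeasure_def, Measure.smul_apply]
  rw [ENNReal.rpow_natCast] at this
  simp only [ENNReal.smul_def, smul_eq_mul]
  rw [mul_left_comm]
  gcongr

/-- The hypothesis makes f a K-Lipschitz function of g on s, so that f factors through g. Both
comparisons with a linear model below are instances, one with the nonlinear map as f and one with it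
as g. -/
theorem euclideanHausdorffMeasure_image_le_of_dist_le {α X Y : Type*} [MetricSpace X]
    [MeasurableSpace X] [BorelSpace X] [MetricSpace Y] [MeasurableSpace Y] [BorelSpace Y]
    (n : ℕ) {f : α → X} {g : α → Y} {s : Set α} {K : ℝ≥0}
    (h : ∀ x ∈ s, ∀ y ∈ s, dist (f x) (f y) ≤ K * dist (g x) (g y)) :
    (μHE[n] : Measure X) (f '' s) ≤ (K : ℝ≥0∞) ^ n * (μHE[n] : Measure Y) (g '' s) := by
  rcases s.eq_empty_or_nonempty with rfl | ⟨x₀, hx₀⟩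
  · simp
  have : Nonempty α := ⟨x₀⟩
  have hinv : ∀ x ∈ s, f (Function.invFunOn g s (g x)) = f x := fun x hx => by
    have hy : ∃ x' ∈ s, g x' = g x := ⟨x, hx, rfl⟩
    have := h _ (Function.invFunOn_mem hy) _ hx
    rw [Function.invFunOn_eq hy, dist_self, mul_zero] at this
    exact dist_le_zero.1 this
  have hL : LipschitzOnWith K (f ∘ Function.invFunOn g s) (g '' s) := by
    refine LipschitzOnWith.of_dist_le_mul ?_
    rintro _ ⟨x, hx, rfl⟩ _ ⟨y, hy, rfl⟩
    simp only [Function.comp, hinv x hx, hinv y hy]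
    exact h x hx y hy
  have him : f '' s = (f ∘ Function.invFunOn g s) '' (g '' s) := by
    rw [image_image]
    exact image_congr fun x hx => (hinv x hx).symm
  rw [him]
  exact euclideanHausdorffMeasure_image_le_of_lipschitzOnWith n hL

section normDet

variable {n : ℕ} {F : Type*} [NormedAddCommGroup F] [InnerProductSpace ℝ F]

theorem normDet_eq_sqrt_det_gram (A : Euc n →ₗ[ℝ] F) :
    A.normDet = Real.sqrt (Matrix.gram ℝ fun i => A (EuclideanSpace.single i 1)).det := by
  have h := A.normDet_sq_eq_det_gram (EuclideanSpace.basisFun (Fin n) ℝ)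
  simp only [EuclideanSpace.basisFun_apply] at h
  rw [← h]
  exact (Real.sqrt_sq A.normDet_nonneg).symm

theorem continuous_normDet : Continuous fun A : Euc n →L[ℝ] F => (A : Euc n →ₗ[ℝ] F).normDet := by
  simp_rw [normDet_eq_sqrt_det_gram]
  refine Real.continuous_sqrt.comp (Continuous.matrix_det ?_)
  refine continuous_matrix fun i j => ?_
  simp only [Matrix.gram_apply, ContinuousLinearMap.coe_coe]
  fun_prop

theorem euclideanHausdorffMeasure_linear_image {V : Type*} [NormedAddCommGroup V]
    [InnerProductSpace ℝ V] [MeasurableSpace V] [BorelSpace V] (A : Euc n →ₗ[ℝ] V) (s : Set (Euc n)) :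
    (μHE[n] : Measure V) (A '' s) = ENNReal.ofReal A.normDet * volume s := by
  have := A.euclideanHausdorffMeasure_image_eq_normDet_mul_volume s
  rwa [finrank_euclideanSpace_fin] at this

end normDet

variable {n N : ℕ}

/-- The linear map `v ↦ (A v, η v)`. -/
def graphPerturbation (A : Euc n →L[ℝ] Euc N) (η : ℝ) : Euc n →L[ℝ] WithLp 2 (Euc N × Euc n) :=
  ((WithLp.prodContinuousLinearEquiv 2 ℝ (Euc N) (Euc n)).symm : _ →L[ℝ] _) ∘L
    (A.prod (η • ContinuousLinearMap.id ℝ (Euc n)))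

theorem norm_graphPerturbation_sq (A : Euc n →L[ℝ] Euc N) (η : ℝ) (v : Euc n) :
    ‖graphPerturbation A η v‖ ^ 2 = ‖A v‖ ^ 2 + ‖η • v‖ ^ 2 := by
  rw [WithLp.prod_norm_sq_eq_of_L2]
  rfl

theorem tendsto_normDet_graphPerturbation (A : Euc n →L[ℝ] Euc N) :
    Tendsto (fun η : ℝ => (graphPerturbation A η).toLinearMap.normDet) (𝓝 0)
      (𝓝 A.toLinearMap.normDet) := by
  have h0 : (graphPerturbation A 0).toLinearMap.normDet = A.toLinearMap.normDet := by
    rw [normDet_eq_sqrt_det_gram, normDet_eq_sqrt_det_gram]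
    congr 2
    ext i j
    simp [Matrix.gram_apply, WithLp.prod_inner_apply, graphPerturbation]
  rw [← h0]
  have hc : Continuous fun η : ℝ => (graphPerturbation A η).toLinearMap.normDet := by
    simp_rw [normDet_eq_sqrt_det_gram]
    refine Real.continuous_sqrt.comp (Continuous.matrix_det (continuous_matrix fun i j => ?_))
    simp only [Matrix.gram_apply, WithLp.prod_inner_apply]
    have : ∀ (η : ℝ) (v : Euc n), ((graphPerturbation A η).toLinearMap v).ofLp = (A v, η • v) :=
      fun _ _ => rfl
    simp only [this]
    fun_prop
  exact hc.tendsto 0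

/-- A may have a kernel, so f cannot be compared with A itself. The norm of v ↦ (A v, η v) dominates
both |A v| and η|v|, so the error δ|x - y| is absorbed into a factor 1 + δ/η. First η is fixed so
that the volume factor grows by less than ε, and then δ is taken small. -/
theorem exists_forall_euclideanHausdorffMeasure_image_le (A : Euc n →L[ℝ] Euc N) {ε : ℝ}
    (hε : 0 < ε) :
    ∀ᶠ δ : ℝ in 𝓝[>] 0, ∀ (s : Set (Euc n)) (f : Euc n → Euc N),
      ApproximatesLinearOn f A s δ.toNNReal →
      (μHE[n] : Measure (Euc N)) (f '' s) ≤
        ENNReal.ofReal (A.toLinearMap.normDet + ε) * volume s := by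
  obtain ⟨η, hη, hηpos⟩ : ∃ η : ℝ, (graphPerturbation A η).toLinearMap.normDet <
      A.toLinearMap.normDet + ε ∧ 0 < η := by
    have h1 := (tendsto_normDet_graphPerturbation A).eventually_lt_const
      (show _ < A.toLinearMap.normDet + ε by linarith)
    have h2 : ∀ᶠ η : ℝ in 𝓝[>] 0, 0 < η := self_mem_nhdsWithin
    exact ((h1.filter_mono nhdsWithin_le_nhds).and h2).exists
  have hlim : Tendsto (fun δ : ℝ => (1 + δ / η) ^ n *
      (graphPerturbation A η).toLinearMap.normDet) (𝓝 0)
      (𝓝 ((graphPerturbation A η).toLinearMap.normDet)) := by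
    have : Continuous (fun δ : ℝ => (1 + δ / η) ^ n *
      (graphPerturbation A η).toLinearMap.normDet) := by fun_prop
    simpa using this.tendsto 0
  filter_upwards [(hlim.eventually_lt_const hη).filter_mono nhdsWithin_le_nhds,
    self_mem_nhdsWithin] with δ hδ hδ0 s f hf
  have hδ0 : (0 : ℝ) < δ := hδ0
  have hK : 0 ≤ 1 + δ / η := by positivity
  have := euclideanHausdorffMeasure_image_le_of_dist_le n (f := f) (g := graphPerturbation A η)
    (s := s) (K := (1 + δ / η).toNNReal) (fun x hx y hy => by
      have h1 : ‖f x - f y - A (x - y)‖ ≤ δ * ‖x - y‖ := by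
        simpa [Real.coe_toNNReal _ hδ0.le] using hf x hx y hy
      have h2 := norm_graphPerturbation_sq A η (x - y)
      have h3 : ‖A (x - y)‖ ≤ ‖graphPerturbation A η (x - y)‖ := by
        apply le_of_sq_le_sq _ (norm_nonneg _)
        nlinarith [sq_nonneg ‖η • (x - y)‖]
      have h4 : η * ‖x - y‖ ≤ ‖graphPerturbation A η (x - y)‖ := by
        apply le_of_sq_le_sq _ (norm_nonneg _)
        rw [norm_smul, Real.norm_of_nonneg hηpos.le] at h2
        nlinarith [sq_nonneg ‖A (x - y)‖]
      rw [dist_eq_norm, dist_eq_norm, ← map_sub]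
      have h5 : ‖f x - f y‖ ≤ ‖A (x - y)‖ + δ * ‖x - y‖ := by
        calc ‖f x - f y‖ = ‖A (x - y) + (f x - f y - A (x - y))‖ := by congr 1; abel
          _ ≤ _ := (norm_add_le _ _).trans (by gcongr)
      have h6 : δ * ‖x - y‖ ≤ δ / η * ‖graphPerturbation A η (x - y)‖ := by
        rw [div_mul_eq_mul_div, le_div_iff₀ hηpos]
        nlinarith
      rw [Real.coe_toNNReal _ hK]
      linarith)
  refine this.trans ?_
  have h7 := euclideanHausdorffMeasure_linear_image (graphPerturbation A η).toLinearMap s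
  simp only [ContinuousLinearMap.coe_coe] at h7
  rw [h7, ← mul_assoc]
  gcongr
  change ENNReal.ofReal (1 + δ / η) ^ n * _ ≤ _
  rw [← ENNReal.ofReal_pow hK, ← ENNReal.ofReal_mul (by positivity)]
  exact ENNReal.ofReal_le_ofReal hδ.le

/-- For degenerate A the left side is zero. Otherwise A has a Lipschitz inverse with some constant
K, hence |A(x - y)| ≤ (1 - δK)⁻¹ |f x - f y|, and A is a Lipschitz function of f on s. -/
theorem exists_forall_le_euclideanHausdorffMeasure_image (A : Euc n →L[ℝ] Euc N) {ε : ℝ}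
    (hε : 0 < ε) :
    ∀ᶠ δ : ℝ in 𝓝[>] 0, ∀ (s : Set (Euc n)) (f : Euc n → Euc N),
      ApproximatesLinearOn f A s δ.toNNReal →
      ENNReal.ofReal (A.toLinearMap.normDet - ε) * volume s ≤
        (μHE[n] : Measure (Euc N)) (f '' s) := by
  by_cases hA : A.toLinearMap.normDet = 0
  · refine Eventually.of_forall fun δ s f _ => ?_
    rw [hA, ENNReal.ofReal_of_nonpos (by linarith)]
    simp
  have hker : A.toLinearMap.ker = ⊥ := by
    by_contra h
    exact hA (LinearMap.normDet_eq_zero_iff_ker_ne_bot.2 h)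
  obtain ⟨K, hK, hKA⟩ := LinearMap.exists_antilipschitzWith _ hker
  have hlim : Tendsto (fun δ : ℝ => (1 - δ * K) ^ n *
      A.toLinearMap.normDet) (𝓝 0)
      (𝓝 (A.toLinearMap.normDet)) := by
    have : Continuous (fun δ : ℝ => (1 - δ * K) ^ n *
      A.toLinearMap.normDet) := by fun_prop
    simpa using this.tendsto 0
  have hlim2 : Tendsto (fun δ : ℝ => (1 - δ * K)) (𝓝 0) (𝓝 1) := by
    have : Continuous (fun δ : ℝ => (1 - δ * K)) := by fun_prop
    simpa using this.tendsto 0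
  filter_upwards [(hlim.eventually_const_lt (show A.toLinearMap.normDet - ε < _ by
      linarith)).filter_mono nhdsWithin_le_nhds,
    (hlim2.eventually_const_lt (show (0 : ℝ) < 1 by norm_num)).filter_mono nhdsWithin_le_nhds,
    self_mem_nhdsWithin] with δ hδ hδ1 hδ0 s f hf
  have hδ0 : (0 : ℝ) < δ := hδ0
  have hK' : 0 ≤ (1 - δ * K)⁻¹ := by positivity
  have := euclideanHausdorffMeasure_image_le_of_dist_le n (f := A) (g := f)
    (s := s) (K := ((1 - δ * K)⁻¹).toNNReal) (fun x hx y hy => by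
      have h1 : ‖f x - f y - A (x - y)‖ ≤ δ * ‖x - y‖ := by
        simpa [Real.coe_toNNReal _ hδ0.le] using hf x hx y hy
      have h2 : ‖x - y‖ ≤ K * ‖A (x - y)‖ := by
        have := hKA.le_mul_dist x y
        simpa [dist_eq_norm, ← map_sub] using this
      rw [dist_eq_norm, dist_eq_norm, ← map_sub]
      have h5 : ‖A (x - y)‖ ≤ ‖f x - f y‖ + δ * ‖x - y‖ := by
        calc ‖A (x - y)‖ = ‖(f x - f y) - (f x - f y - A (x - y))‖ := by congr 1; abel
          _ ≤ _ := (norm_sub_le _ _).trans (by gcongr)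
      rw [Real.coe_toNNReal _ hK', inv_mul_eq_div, le_div_iff₀ hδ1]
      nlinarith [mul_le_mul_of_nonneg_left h2 hδ0.le])
  have h7 := euclideanHausdorffMeasure_linear_image A.toLinearMap s
  simp only [ContinuousLinearMap.coe_coe] at h7
  rw [h7] at this
  change _ ≤ ENNReal.ofReal ((1 - δ * K)⁻¹) ^ n * _ at this
  calc ENNReal.ofReal (A.toLinearMap.normDet - ε) * volume s
      ≤ ENNReal.ofReal ((1 - δ * K) ^ n * A.toLinearMap.normDet) * volume s := by
        gcongr
    _ = ENNReal.ofReal ((1 - δ * K) ^ n) *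
        (ENNReal.ofReal A.toLinearMap.normDet * volume s) := by
        rw [ENNReal.ofReal_mul (by positivity), mul_assoc]
    _ ≤ ENNReal.ofReal ((1 - δ * K) ^ n) * (ENNReal.ofReal ((1 - δ * K)⁻¹) ^ n *
        (μHE[n] : Measure (Euc N)) (f '' s)) := by gcongr
    _ = (μHE[n] : Measure (Euc N)) (f '' s) := by
        rw [← mul_assoc, ← ENNReal.ofReal_pow hK', ← ENNReal.ofReal_mul (by positivity),
          ← mul_pow, mul_inv_cancel₀ hδ1.ne']
        simp

end

/-! ### The area formula for differentiable maps -/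

section

variable {n N : ℕ}

/-- The space of linear maps is separable, so countably many balls of radius δ(A)/2 cover it.
Sorting points by the ball that contains the derivative fixes the model map A before the linear
approximation is made. The two estimates on a piece therefore refer to the same A and the same
tolerance. -/
theorem exists_partition_normDet_near (f : Euc n → Euc N) {s : Set (Euc n)} (hs : MeasurableSet s)
    (hf : ∀ x ∈ s, DifferentiableAt ℝ f x) (δ : (Euc n →L[ℝ] Euc N) → ℝ) (hδ : ∀ A, 0 < δ A) :
    ∃ (t : ℕ × ℕ → Set (Euc n)) (A : ℕ × ℕ → Euc n →L[ℝ] Euc N), Pairwise (Function.onFun Disjoint t) ∧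
      (∀ k, MeasurableSet (t k)) ∧ (∀ k, t k ⊆ s) ∧ ⋃ k, t k = s ∧
      (∀ k, ∀ x ∈ t k, ‖fderiv ℝ f x - A k‖ < δ (A k)) ∧
      ∀ k, ApproximatesLinearOn f (A k) (t k) (δ (A k)).toNNReal := by
  obtain ⟨c, hc, hcU⟩ := TopologicalSpace.countable_cover_nhds
    (f := fun A : Euc n →L[ℝ] Euc N => Metric.ball A (δ A / 2))
    (fun A => Metric.ball_mem_nhds A (half_pos (hδ A)))
  have hne : c.Nonempty := by
    by_contra h
    rw [not_nonempty_iff_eq_empty] at h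
    have : (0 : Euc n →L[ℝ] Euc N) ∈ (⋃ x ∈ c, Metric.ball x (δ x / 2)) := hcU ▸ mem_univ _
    simp [h] at this
  obtain ⟨B, rfl⟩ := hc.exists_eq_range hne
  set U : ℕ → Set (Euc n) := fun k => s ∩ fderiv ℝ f ⁻¹' Metric.ball (B k) (δ (B k) / 2)
  have hU : ∀ k, MeasurableSet (U k) := fun k =>
    hs.inter (measurable_fderiv ℝ f Metric.isOpen_ball.measurableSet)
  have hUs : ⋃ k, U k = s := by
    refine subset_antisymm (iUnion_subset fun k => inter_subset_left) fun x hx => ?_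
    have : fderiv ℝ f x ∈ (⋃ x ∈ range B, Metric.ball x (δ x / 2)) := hcU ▸ mem_univ _
    simp only [mem_iUnion, mem_range, exists_prop, exists_exists_eq_and] at this
    obtain ⟨k, hk⟩ := this
    exact mem_iUnion.2 ⟨k, hx, hk⟩
  have hDU : ∀ k, disjointed U k ⊆ U k := fun k => disjointed_subset U k
  have hD : ∀ k, ∃ t : ℕ → Set (Euc n), Pairwise (Function.onFun Disjoint t) ∧
      (∀ j, MeasurableSet (t j)) ∧ disjointed U k ⊆ ⋃ j, t j ∧
      ∀ j, ApproximatesLinearOn f (B k) (disjointed U k ∩ t j) (δ (B k)).toNNReal := by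
    intro k
    obtain ⟨t, A, h1, h2, h3, h4, h5⟩ := exists_partition_approximatesLinearOn_of_hasFDerivWithinAt f
      (disjointed U k) (fderiv ℝ f)
      (fun x hx => (hf x (hDU k hx).1).hasFDerivAt.hasFDerivWithinAt)
      -- The tolerance depends only on the centre `B k`. The other half of δ pays for replacing `A
      -- j`, a derivative at a point of this set, by `B k`.
      (fun _ => (δ (B k) / 2).toNNReal) (fun _ => by simpa using hδ (B k))
    refine ⟨t, h1, h2, h3, fun j => ?_⟩
    rcases (disjointed U k).eq_empty_or_nonempty with he | hne
    · rw [he, empty_inter]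
      intro x hx
      exact absurd hx (notMem_empty _)
    · obtain ⟨y, hy, hAy⟩ := h5 hne j
      intro x hx z hz
      have h6 := h4 j x hx z hz
      have h7 : ‖A j - B k‖ < δ (B k) / 2 := by
        rw [hAy, ← dist_eq_norm]
        exact (hDU k hy).2
      rw [Real.coe_toNNReal _ (half_pos (hδ _)).le] at h6
      rw [Real.coe_toNNReal _ (hδ _).le]
      calc ‖f x - f z - B k (x - z)‖ = ‖(f x - f z - A j (x - z)) + (A j - B k) (x - z)‖ := by
            congr 1; simp
        _ ≤ δ (B k) / 2 * ‖x - z‖ + δ (B k) / 2 * ‖x - z‖ := by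
            refine (norm_add_le _ _).trans (add_le_add h6 ?_)
            exact ((A j - B k).le_opNorm _).trans (by gcongr)
        _ = _ := by ring
  choose t h1 h2 h3 h4 using hD
  refine ⟨fun p => disjointed U p.1 ∩ t p.1 p.2, fun p => B p.1, ?_, fun p => ?_, fun p => ?_, ?_,
    fun p x hx => ?_, fun p => h4 _ _⟩
  · rintro ⟨i, j⟩ ⟨i', j'⟩ hne
    by_cases hi : i = i'
    · subst hi
      have hj : j ≠ j' := fun h => hne (by rw [h])
      exact (h1 i hj).mono inter_subset_right inter_subset_right
    · exact (disjoint_disjointed U hi).mono inter_subset_left inter_subset_left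
  · exact (MeasurableSet.disjointed hU _).inter (h2 _ _)
  · exact inter_subset_left.trans ((hDU _).trans inter_subset_left)
  · refine Eq.trans ?_ ((iUnion_disjointed (f := U)).trans hUs)
    refine subset_antisymm (iUnion_subset fun p => inter_subset_left.trans (subset_iUnion (disjointed U) p.1))
      (iUnion_subset fun k x hx => ?_)
    obtain ⟨j, hj⟩ := mem_iUnion.1 (h3 k hx)
    exact mem_iUnion.2 ⟨(k, j), hx, hj⟩
  · have := (hDU _ hx.1).2
    rw [mem_preimage, mem_ball_iff_norm] at this
    linarith [hδ (B p.1)]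

theorem exists_normDet_radius (A : Euc n →L[ℝ] Euc N) {ε : ℝ} (hε : 0 < ε) :
    ∃ δ : ℝ, 0 < δ ∧
      (∀ B : Euc n →L[ℝ] Euc N, ‖B - A‖ < δ → |B.toLinearMap.normDet - A.toLinearMap.normDet| < ε) ∧
      ∀ (s : Set (Euc n)) (f : Euc n → Euc N), ApproximatesLinearOn f A s δ.toNNReal →
        (μHE[n] : Measure (Euc N)) (f '' s) ≤
          ENNReal.ofReal (A.toLinearMap.normDet + ε) * volume s ∧
        ENNReal.ofReal (A.toLinearMap.normDet - ε) * volume s ≤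
          (μHE[n] : Measure (Euc N)) (f '' s) := by
  have h1 := Metric.continuous_iff.1 (continuous_normDet (n := n) (F := Euc N)) A ε hε
  obtain ⟨δ₀, hδ₀, h1⟩ := h1
  have h2 : ∀ᶠ δ : ℝ in 𝓝[>] 0, δ < δ₀ :=
    (eventually_lt_nhds hδ₀).filter_mono nhdsWithin_le_nhds
  have h3 : ∀ᶠ δ : ℝ in 𝓝[>] 0, 0 < δ := self_mem_nhdsWithin
  obtain ⟨δ, h⟩ := (((exists_forall_euclideanHausdorffMeasure_image_le A hε).and
    (exists_forall_le_euclideanHausdorffMeasure_image A hε)).and (h2.and h3)).exists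
  refine ⟨δ, h.2.2, fun B hB => ?_, fun s f hf => ⟨h.1.1 s f hf, h.1.2 s f hf⟩⟩
  have := h1 B (by rw [dist_eq_norm]; exact hB.trans h.2.1)
  rwa [Real.dist_eq] at this

theorem measurable_ofReal_normDet_fderiv (f : Euc n → Euc N) :
    Measurable fun x => ENNReal.ofReal (fderiv ℝ f x).toLinearMap.normDet :=
  ENNReal.measurable_ofReal.comp (continuous_normDet.measurable.comp (measurable_fderiv ℝ f))

/-- On each piece the measure of the image and the integral of the Jacobian both differ from
normDet(A) times the volume by at most ε times the volume; the two errors add up to 2ε. Injectivity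
matters only for the lower bound, where the images of the pieces must be disjoint. -/
theorem euclideanHausdorffMeasure_image_near (f : Euc n → Euc N) {s : Set (Euc n)}
    (hs : MeasurableSet s) (hf : ∀ x ∈ s, DifferentiableAt ℝ f x) {ε : ℝ} (hε : 0 < ε) :
    (μHE[n] : Measure (Euc N)) (f '' s) ≤
      (∫⁻ x in s, ENNReal.ofReal (fderiv ℝ f x).toLinearMap.normDet) +
        ENNReal.ofReal (2 * ε) * volume s ∧
    (InjOn f s → (∫⁻ x in s, ENNReal.ofReal (fderiv ℝ f x).toLinearMap.normDet) ≤
      (μHE[n] : Measure (Euc N)) (f '' s) + ENNReal.ofReal (2 * ε) * volume s) := by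
  choose δ hδ0 hδ1 hδ2 using fun A : Euc n →L[ℝ] Euc N => exists_normDet_radius A hε
  obtain ⟨t, A, hd, ht, hts, htU, h1, h2⟩ := exists_partition_normDet_near f hs hf δ hδ0
  have hvol : volume s = ∑' k, volume (t k) := by
    rw [← htU, measure_iUnion hd ht]
  have hint : (∫⁻ x in s, ENNReal.ofReal (fderiv ℝ f x).toLinearMap.normDet) =
      ∑' k, ∫⁻ x in t k, ENNReal.ofReal (fderiv ℝ f x).toLinearMap.normDet := by
    rw [← htU, lintegral_iUnion ht hd]
  have hJ := measurable_ofReal_normDet_fderiv f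
  constructor
  · have : f '' s = ⋃ k, f '' t k := by rw [← image_iUnion, htU]
    rw [this, hint, hvol, ← ENNReal.tsum_mul_left, ← ENNReal.tsum_add]
    refine (measure_iUnion_le _).trans (ENNReal.tsum_le_tsum fun k => ?_)
    refine ((hδ2 _ _ _ (h2 k)).1).trans ?_
    rw [← setLIntegral_const, ← setLIntegral_const, ← lintegral_add_left hJ]
    refine setLIntegral_mono (hJ.add measurable_const) fun x hx => ?_
    rw [← ENNReal.ofReal_add (LinearMap.normDet_nonneg _) (by positivity)]
    refine ENNReal.ofReal_le_ofReal ?_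
    have := hδ1 _ _ (h1 k x hx)
    rw [abs_lt] at this
    linarith
  · intro hinj
    have hm : ∀ k, MeasurableSet (f '' t k) := fun k =>
      (ht k).image_of_continuousOn_injOn
        (fun x hx => (hf x (hts k hx)).continuousAt.continuousWithinAt) (hinj.mono (hts k))
    have : (μHE[n] : Measure (Euc N)) (f '' s) = ∑' k, (μHE[n] : Measure (Euc N)) (f '' t k) := by
      have : f '' s = ⋃ k, f '' t k := by rw [← image_iUnion, htU]
      rw [this, measure_iUnion _ hm]
      intro i j hij
      exact disjoint_image_image fun x hx y hy hxy =>
        (hd hij).ne_of_mem hx hy (hinj (hts i hx) (hts j hy) hxy)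
    rw [this, hint, hvol, ← ENNReal.tsum_mul_left, ← ENNReal.tsum_add]
    refine ENNReal.tsum_le_tsum fun k => ?_
    refine le_trans ?_ (add_le_add_left (hδ2 _ _ _ (h2 k)).2 _)
    rw [← setLIntegral_const, ← setLIntegral_const, ← lintegral_add_left measurable_const]
    refine setLIntegral_mono measurable_const fun x hx => ?_
    have := hδ1 _ _ (h1 k x hx)
    rw [abs_lt] at this
    refine le_trans (ENNReal.ofReal_le_ofReal ?_) ENNReal.ofReal_add_le
    linarith

/-- Finite volume makes the error term tend to zero with ε; the general case follows by cutting s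
into countably many pieces of finite volume. -/
theorem euclideanHausdorffMeasure_image_of_volume_lt_top (f : Euc n → Euc N) {s : Set (Euc n)}
    (hs : MeasurableSet s) (hf : ∀ x ∈ s, DifferentiableAt ℝ f x) (hfin : volume s < ⊤) :
    (μHE[n] : Measure (Euc N)) (f '' s) ≤
      (∫⁻ x in s, ENNReal.ofReal (fderiv ℝ f x).toLinearMap.normDet) ∧
    (InjOn f s → (∫⁻ x in s, ENNReal.ofReal (fderiv ℝ f x).toLinearMap.normDet) ≤
      (μHE[n] : Measure (Euc N)) (f '' s)) := by
  have hlim : ∀ a : ℝ≥0∞, Tendsto (fun ε : ℝ => a + ENNReal.ofReal (2 * ε) * volume s) (𝓝[>] 0)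
      (𝓝 a) := by
    intro a
    have h1 : Tendsto (fun ε : ℝ => ENNReal.ofReal (2 * ε)) (𝓝[>] 0) (𝓝 0) := by
      have : Continuous fun ε : ℝ => ENNReal.ofReal (2 * ε) :=
        ENNReal.continuous_ofReal.comp (continuous_const.mul continuous_id)
      simpa using (this.tendsto 0).mono_left nhdsWithin_le_nhds
    have h2 := ENNReal.Tendsto.mul_const (b := volume s) h1 (Or.inr hfin.ne)
    simpa using tendsto_const_nhds.add h2
  constructor
  · refine ge_of_tendsto (hlim _) ?_
    filter_upwards [self_mem_nhdsWithin] with ε hε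
    exact (euclideanHausdorffMeasure_image_near f hs hf hε).1
  · intro hinj
    refine ge_of_tendsto (hlim _) ?_
    filter_upwards [self_mem_nhdsWithin] with ε hε
    exact (euclideanHausdorffMeasure_image_near f hs hf hε).2 hinj

theorem exists_volume_partition (s : Set (Euc n)) (hs : MeasurableSet s) :
    ∃ t : ℕ → Set (Euc n), Pairwise (Function.onFun Disjoint t) ∧ (∀ k, MeasurableSet (t k)) ∧
      (∀ k, t k ⊆ s) ∧ ⋃ k, t k = s ∧ ∀ k, volume (t k) < ⊤ := by
  set u := disjointed (spanningSets (volume : Measure (Euc n)))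
  refine ⟨fun k => s ∩ u k, fun i j hij =>
    (disjoint_disjointed _ hij).mono inter_subset_right inter_subset_right, fun k => hs.inter
    (MeasurableSet.disjointed (measurableSet_spanningSets volume) _), fun k => inter_subset_left, ?_,
    fun k => ?_⟩
  · rw [← inter_iUnion, iUnion_disjointed, iUnion_spanningSets, inter_univ]
  · exact (measure_mono (inter_subset_right.trans (disjointed_subset _ _))).trans_lt
      (measure_spanningSets_lt_top volume k)

/-- The area inequality for a map which need not be injective. -/
theorem euclideanHausdorffMeasure_image_le_lintegral (f : Euc n → Euc N) {s : Set (Euc n)}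
    (hs : MeasurableSet s) (hf : ∀ x ∈ s, DifferentiableAt ℝ f x) :
    (μHE[n] : Measure (Euc N)) (f '' s) ≤
      ∫⁻ x in s, ENNReal.ofReal (fderiv ℝ f x).toLinearMap.normDet := by
  obtain ⟨t, hd, ht, hts, htU, hfin⟩ := exists_volume_partition s hs
  have : f '' s = ⋃ k, f '' t k := by rw [← image_iUnion, htU]
  rw [this, ← htU, lintegral_iUnion ht hd]
  exact (measure_iUnion_le _).trans (ENNReal.tsum_le_tsum fun k =>
    (euclideanHausdorffMeasure_image_of_volume_lt_top f (ht k) (fun x hx => hf x (hts k hx))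
      (hfin k)).1)

/-- The area formula. -/
theorem euclideanHausdorffMeasure_image_eq_lintegral (f : Euc n → Euc N) {s : Set (Euc n)}
    (hs : MeasurableSet s) (hf : ∀ x ∈ s, DifferentiableAt ℝ f x) (hinj : InjOn f s) :
    (μHE[n] : Measure (Euc N)) (f '' s) =
      ∫⁻ x in s, ENNReal.ofReal (fderiv ℝ f x).toLinearMap.normDet := by
  refine le_antisymm (euclideanHausdorffMeasure_image_le_lintegral f hs hf) ?_
  obtain ⟨t, hd, ht, hts, htU, hfin⟩ := exists_volume_partition s hs
  have hm : ∀ k, MeasurableSet (f '' t k) := fun k =>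
    (ht k).image_of_continuousOn_injOn
      (fun x hx => (hf x (hts k hx)).continuousAt.continuousWithinAt) (hinj.mono (hts k))
  have h1 : (μHE[n] : Measure (Euc N)) (f '' s) = ∑' k, (μHE[n] : Measure (Euc N)) (f '' t k) := by
    have : f '' s = ⋃ k, f '' t k := by rw [← image_iUnion, htU]
    rw [this, measure_iUnion _ hm]
    intro i j hij
    exact disjoint_image_image fun x hx y hy hxy =>
      (hd hij).ne_of_mem hx hy (hinj (hts i hx) (hts j hy) hxy)
  rw [h1]
  conv_lhs => rw [← htU, lintegral_iUnion ht hd]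
  exact ENNReal.tsum_le_tsum fun k =>
    (euclideanHausdorffMeasure_image_of_volume_lt_top f (ht k) (fun x hx => hf x (hts k hx))
      (hfin k)).2 (hinj.mono (hts k))

theorem restrict_image_eq_map_withDensity {f : Euc n → Euc N} (hfm : Measurable f)
    {s : Set (Euc n)} (hs : MeasurableSet s) (hf : ∀ x ∈ s, DifferentiableAt ℝ f x)
    (hinj : InjOn f s) :
    (μHE[n] : Measure (Euc N)).restrict (f '' s) =
      ((volume.restrict s).withDensity
        fun x => ENNReal.ofReal (fderiv ℝ f x).toLinearMap.normDet).map f := by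
  ext B hB
  rw [Measure.map_apply hfm hB, Measure.restrict_apply hB, withDensity_apply _ (hfm hB),
    Measure.restrict_restrict (hfm hB), inter_comm B, ← image_inter_preimage, inter_comm _ s]
  exact euclideanHausdorffMeasure_image_eq_lintegral f (hs.inter (hfm hB)) (fun x hx => hf x hx.1)
    (hinj.mono inter_subset_left)

end

/-! ### Regular charts, and approximate tangent planes as blow-up limits -/

section

variable {n N : ℕ}

/-- A chart of a rectifiable set: a continuous map, differentiable on a Borel set `E` with injective
derivative, whose restriction to `E` has a Lipschitz inverse. -/
structure IsRegularChart (G : Euc n → Euc N) (E : Set (Euc n)) : Prop where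
  continuous : Continuous G
  measurableSet : MeasurableSet E
  differentiableAt : ∀ x ∈ E, DifferentiableAt ℝ G x
  normDet_ne_zero : ∀ x ∈ E, (fderiv ℝ G x).toLinearMap.normDet ≠ 0
  exists_dist_le : ∃ K : ℝ≥0, ∀ x ∈ E, ∀ y ∈ E, dist x y ≤ K * dist (G x) (G y)

theorem IsRegularChart.injOn {G : Euc n → Euc N} {E : Set (Euc n)} (h : IsRegularChart G E) :
    InjOn G E := by
  obtain ⟨K, hK⟩ := h.exists_dist_le
  intro x hx y hy hxy
  have := hK x hx y hy
  rw [hxy, dist_self, mul_zero] at this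
  exact dist_le_zero.1 this

theorem IsRegularChart.measurableSet_image {G : Euc n → Euc N} {E : Set (Euc n)}
    (h : IsRegularChart G E) : MeasurableSet (G '' E) :=
  h.measurableSet.image_of_continuousOn_injOn h.continuous.continuousOn h.injOn

theorem IsRegularChart.mono {G : Euc n → Euc N} {E E' : Set (Euc n)} (h : IsRegularChart G E)
    (hE' : MeasurableSet E') (hsub : E' ⊆ E) : IsRegularChart G E' where
  continuous := h.continuous
  measurableSet := hE'
  differentiableAt x hx := h.differentiableAt x (hsub hx)
  normDet_ne_zero x hx := h.normDet_ne_zero x (hsub hx)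
  exists_dist_le := by
    obtain ⟨K, hK⟩ := h.exists_dist_le
    exact ⟨K, fun x hx y hy => hK x (hsub hx) y (hsub hy)⟩

/-- Two parts of the domain have null image: the points of non-differentiability, by Rademacher and
the Lipschitz bound, and the critical points, by the area inequality with zero Jacobian. What
remains is cut into pieces on which F is close to one fixed injective linear map. -/
theorem LipschitzWith.exists_regular_charts {F : Euc n → Euc N} {K : ℝ≥0} (hF : LipschitzWith K F) :
    ∃ E : ℕ → Set (Euc n), (∀ k, IsRegularChart F (E k)) ∧
      (μHE[n] : Measure (Euc N)) (range F \ ⋃ k, F '' E k) = 0 := by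
  set D := {x | DifferentiableAt ℝ F x} with hD
  have hDm : MeasurableSet D := measurableSet_of_differentiableAt ℝ F
  have hJm : Measurable fun x => (fderiv ℝ F x).toLinearMap.normDet :=
    continuous_normDet.measurable.comp (measurable_fderiv ℝ F)
  set Z := {x | (fderiv ℝ F x).toLinearMap.normDet = 0} with hZ
  have hZm : MeasurableSet Z := hJm (measurableSet_singleton 0)
  have hanti : ∀ A : Euc n →L[ℝ] Euc N, ∃ c : ℝ≥0, 0 < c ∧
      (A.toLinearMap.normDet ≠ 0 → AntilipschitzWith c A) := by
    intro A
    by_cases hA : A.toLinearMap.normDet = 0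
    · exact ⟨1, one_pos, fun h => absurd hA h⟩
    · have hker : A.toLinearMap.ker = ⊥ := by
        by_contra h
        exact hA (LinearMap.normDet_eq_zero_iff_ker_ne_bot.2 h)
      obtain ⟨c, hc, h⟩ := LinearMap.exists_antilipschitzWith _ hker
      exact ⟨c, hc, fun _ => h⟩
  choose c hc hcA using hanti
  obtain ⟨t, A, -, ht, htU, htA, hA⟩ := exists_partition_approximatesLinearOn_of_hasFDerivWithinAt F
    (D \ Z) (fderiv ℝ F) (fun x hx => (DifferentiableAt.hasFDerivAt hx.1).hasFDerivWithinAt)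
    (fun A => (2 * c A)⁻¹) (fun A => by have := hc A; positivity)
  refine ⟨fun k => (D \ Z) ∩ t k, fun k => ⟨hF.continuous, (hDm.diff hZm).inter (ht k),
    fun x hx => hx.1.1, fun x hx => hx.1.2, 2 * c (A k), fun x hx y hy => ?_⟩, ?_⟩
  · obtain ⟨z, hz, hAz⟩ := hA ⟨x, hx.1⟩ k
    have h1 := (hcA (A k) (by rw [hAz]; exact hz.2)).le_mul_dist x y
    have h2 := htA k x hx y hy
    rw [dist_eq_norm, dist_eq_norm, ← map_sub] at h1
    rw [dist_eq_norm, dist_eq_norm]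
    have h3 : ‖A k (x - y)‖ ≤ ‖F x - F y‖ + ‖F x - F y - A k (x - y)‖ := by
      calc ‖A k (x - y)‖ = ‖(F x - F y) - (F x - F y - A k (x - y))‖ := by congr 1; abel
        _ ≤ _ := norm_sub_le _ _
    have hcp : (0 : ℝ) < c (A k) := hc _
    push_cast at h2 ⊢
    have h4 : (c (A k) : ℝ) * ((2 * (c (A k) : ℝ))⁻¹ * ‖x - y‖) = ‖x - y‖ / 2 := by field_simp
    have h5 : (c (A k) : ℝ) * ‖A k (x - y)‖ ≤ c (A k) * ‖F x - F y‖ + ‖x - y‖ / 2 := by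
      rw [← h4, ← mul_add]
      gcongr
      linarith
    linarith
  · have hsub : range F \ ⋃ k, F '' (D \ Z ∩ t k) ⊆ F '' Dᶜ ∪ F '' (D ∩ Z) := by
      rintro _ ⟨⟨x, rfl⟩, hx⟩
      by_cases hxD : x ∈ D
      · by_cases hxZ : x ∈ Z
        · exact Or.inr ⟨x, ⟨hxD, hxZ⟩, rfl⟩
        · obtain ⟨k, hk⟩ := mem_iUnion.1 (htU ⟨hxD, hxZ⟩)
          have hxk : x ∈ D \ Z ∩ t k := ⟨⟨hxD, hxZ⟩, hk⟩
          exact absurd (mem_iUnion.2 ⟨k, mem_image_of_mem F hxk⟩) hx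
      · exact Or.inl ⟨x, hxD, rfl⟩
    refine measure_mono_null hsub (measure_union_null ?_ ?_)
    · have h1 : volume Dᶜ = 0 := hF.ae_differentiableAt
      have h2 := euclideanHausdorffMeasure_image_le_of_lipschitzOnWith n (hF.lipschitzOnWith (s := Dᶜ))
      rw [EuclideanSpace.euclideanHausdorffMeasure_eq_volume, h1, mul_zero] at h2
      exact le_antisymm h2 zero_le
    · refine le_antisymm ((euclideanHausdorffMeasure_image_le_lintegral F (hDm.inter hZm)
        (fun x hx => hx.1)).trans ?_) zero_le
      rw [setLIntegral_congr_fun (g := fun _ => 0) (hDm.inter hZm) (fun x hx => by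
        simp only; rw [show (fderiv ℝ F x).toLinearMap.normDet = 0 from hx.2]; simp)]
      simp

theorem CountablyRectifiable.exists_regular_charts {M : Set (Euc N)}
    (hM : CountablyRectifiable n M) :
    ∃ (G : ℕ × ℕ → Euc n → Euc N) (E : ℕ × ℕ → Set (Euc n)), (∀ i, IsRegularChart (G i) (E i)) ∧
      (μHE[n] : Measure (Euc N)) (M \ ⋃ i, G i '' E i) = 0 := by
  obtain ⟨F, hF, hFM⟩ := hM
  choose K hK using hF
  choose E hE hEF using fun j => LipschitzWith.exists_regular_charts (hK j)
  refine ⟨fun i => F i.1, fun i => E i.1 i.2, fun i => hE _ _, ?_⟩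
  refine measure_mono_null (t := (M \ ⋃ j, range (F j)) ∪ ⋃ j, (range (F j) \ ⋃ k, F j '' E j k))
    ?_ (measure_union_null hFM (measure_iUnion_null hEF))
  rintro x ⟨hxM, hx⟩
  by_cases h : x ∈ ⋃ j, range (F j)
  · obtain ⟨j, hj⟩ := mem_iUnion.1 h
    refine Or.inr (mem_iUnion.2 ⟨j, hj, fun h' => hx ?_⟩)
    obtain ⟨k, hk⟩ := mem_iUnion.1 h'
    exact mem_iUnion.2 ⟨(j, k), hk⟩
  · exact Or.inl ⟨hxM, h⟩

/-- `η_{X,t}` as a homeomorphism. -/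
def etaHomeomorph (X : Euc N) {t : ℝ} (ht : t ≠ 0) : Euc N ≃ₜ Euc N :=
  (Homeomorph.subRight X).trans (Homeomorph.smulOfNeZero t⁻¹ (inv_ne_zero ht))

theorem etaHomeomorph_apply (X : Euc N) {t : ℝ} (ht : t ≠ 0) (Y : Euc N) :
    etaHomeomorph X ht Y = t⁻¹ • (Y - X) := rfl

open scoped Pointwise in
theorem map_etaHomeomorph (X : Euc N) {t : ℝ} (ht : 0 < t) :
    (μHE[n] : Measure (Euc N)).map (etaHomeomorph X ht.ne') = ENNReal.ofReal (t ^ n) • μHE[n] := by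
  ext B hB
  rw [Measure.map_apply (etaHomeomorph X ht.ne').measurable hB]
  have : etaHomeomorph X ht.ne' ⁻¹' B = (fun Z => X + Z) '' (t • B) := by
    ext Y
    simp only [mem_preimage, etaHomeomorph_apply, mem_image, Set.mem_smul_set]
    constructor
    · intro h
      exact ⟨t • (t⁻¹ • (Y - X)), ⟨_, h, rfl⟩, by rw [smul_inv_smul₀ ht.ne']; abel⟩
    · rintro ⟨_, ⟨Z, hZ, rfl⟩, rfl⟩
      simpa [inv_smul_smul₀ ht.ne'] using hZ
  have h1 : (μHE[n] : Measure (Euc N)) ((fun Z => X + Z) '' (t • B)) = μHE[n] (t • B) :=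
    (IsometryEquiv.addLeft X).isometry.euclideanHausdorffMeasure_image (d := n) (t • B)
  rw [this, h1, Measure.euclideanHausdorffMeasure_smul₀ n ht.ne' B]
  simp only [Measure.smul_apply, smul_eq_mul, ENNReal.smul_def]
  congr 1
  rw [ENNReal.ofReal_pow ht.le, ENNReal.coe_pow, ← enorm_eq_nnnorm, Real.enorm_of_nonneg ht.le]

theorem setIntegral_eta_image (M : Set (Euc N)) (X : Euc N) {t : ℝ} (ht : 0 < t)
    (f : Euc N → ℝ) :
    ∫ Y in eta X t '' M, f Y ∂μHE[n] =
      (t ^ n)⁻¹ * ∫ Y in M, f (t⁻¹ • (Y - X)) ∂(μHE[n] : Measure (Euc N)) := by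
  set e := (etaHomeomorph X ht.ne').toMeasurableEquiv
  have h1 := e.restrict_map (μHE[n] : Measure (Euc N)) (e '' M)
  rw [e.preimage_image] at h1
  have h2 : (μHE[n] : Measure (Euc N)).map e = ENNReal.ofReal (t ^ n) • μHE[n] :=
    map_etaHomeomorph X ht
  rw [h2, Measure.restrict_smul] at h1
  have h3 := e.measurableEmbedding.integral_map (μ := (μHE[n] : Measure (Euc N)).restrict M) f
  rw [← h1, integral_smul_measure, ENNReal.toReal_ofReal (by positivity), smul_eq_mul] at h3
  rw [eq_inv_mul_iff_mul_eq₀ (by positivity)]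
  exact h3

/-- The rescaling is moved from the set to the test function, so that all blow-up integrals are
taken over the fixed set M. -/
theorem isApproxTangentPlane_iff {M : Set (Euc N)} {X : Euc N} {S : Submodule ℝ (Euc N)} :
    IsApproxTangentPlane n M X S ↔ finrank ℝ S = n ∧
      ∀ f : Euc N → ℝ, Continuous f → HasCompactSupport f →
      Tendsto (fun t : ℝ => (t ^ n)⁻¹ * ∫ Y in M, f (t⁻¹ • (Y - X)) ∂(μHE[n] : Measure (Euc N)))
        (𝓝[>] 0) (𝓝 (∫ Y in (S : Set (Euc N)), f Y ∂μHE[n])) := by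
  refine and_congr Iff.rfl (forall_congr' fun f => imp_congr Iff.rfl (imp_congr Iff.rfl ?_))
  refine tendsto_congr' ?_
  filter_upwards [self_mem_nhdsWithin] with t ht
  exact setIntegral_eta_image M X ht f

theorem restrict_range_linear (L : Euc n →L[ℝ] Euc N) :
    (μHE[n] : Measure (Euc N)).restrict (range L) =
      ENNReal.ofReal L.toLinearMap.normDet • volume.map L := by
  ext B hB
  rw [Measure.restrict_apply hB, Measure.smul_apply, Measure.map_apply L.measurable hB,
    ← image_preimage_eq_inter_range]
  exact euclideanHausdorffMeasure_linear_image L.toLinearMap _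

theorem setIntegral_range_linear (L : Euc n →L[ℝ] Euc N) (hL : Function.Injective L)
    (f : Euc N → ℝ) :
    ∫ Y in range L, f Y ∂μHE[n] = L.toLinearMap.normDet * ∫ y, f (L y) := by
  have he : MeasurableEmbedding L := (LinearMap.isClosedEmbedding_of_injective
    (f := L.toLinearMap) (LinearMap.ker_eq_bot.2 hL)).measurableEmbedding
  rw [restrict_range_linear, integral_smul_measure, he.integral_map,
    ENNReal.toReal_ofReal (LinearMap.normDet_nonneg _), smul_eq_mul]

theorem exists_linearIsometry_range_eq {S : Submodule ℝ (Euc N)} (hS : finrank ℝ S = n) :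
    ∃ ι : Euc n →ₗᵢ[ℝ] Euc N, LinearMap.range ι.toLinearMap = S := by
  let b : OrthonormalBasis (Fin n) ℝ S := (stdOrthonormalBasis ℝ S).reindex (finCongr hS)
  refine ⟨S.subtypeₗᵢ.comp b.repr.symm.toLinearIsometry, ?_⟩
  ext x
  constructor
  · rintro ⟨y, rfl⟩
    exact (b.repr.symm y).2
  · intro hx
    exact ⟨b.repr ⟨x, hx⟩, by simp⟩

/-- Bump functions detect membership in a plane: this is how properties of blow-up integrals are
turned into statements about tangent planes. -/
theorem setIntegral_subspace_pos {S : Submodule ℝ (Euc N)} (hS : finrank ℝ S = n)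
    {f : Euc N → ℝ} (hf : Continuous f) (hc : HasCompactSupport f) (h0 : ∀ x, 0 ≤ f x) {v : Euc N}
    (hv : v ∈ S) (hfv : f v ≠ 0) : 0 < ∫ Y in (S : Set (Euc N)), f Y ∂μHE[n] := by
  obtain ⟨ι, hι⟩ := exists_linearIsometry_range_eq hS
  have hr : (S : Set (Euc N)) = range ι.toContinuousLinearMap := by
    rw [← hι]; rfl
  rw [hr, setIntegral_range_linear _ ι.injective]
  have h1 : ι.toContinuousLinearMap.toLinearMap.normDet = 1 := ι.normDet_eq_one
  rw [h1, one_mul]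
  have hce : IsClosedEmbedding ι := LinearMap.isClosedEmbedding_of_injective
    (f := ι.toLinearMap) (LinearMap.ker_eq_bot.2 ι.injective)
  obtain ⟨y, hy⟩ : v ∈ range ι.toContinuousLinearMap := by rw [← hr]; exact hv
  have hy' : ι y = v := hy
  exact Continuous.integral_pos_of_hasCompactSupport_nonneg_nonzero (f := fun y => f (ι y))
    (hf.comp ι.continuous) (hc.comp_isClosedEmbedding hce) (fun y => h0 _) (x := y)
    (by simpa [hy'] using hfv)

end

/-! ### Tangent planes of a rectifiable set through its charts -/

section

variable {n N : ℕ}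

theorem hasCompactSupport_comp_eta {f : Euc N → ℝ} (hf : HasCompactSupport f) (X : Euc N) {t : ℝ}
    (ht : t ≠ 0) : HasCompactSupport fun Y => f (t⁻¹ • (Y - X)) :=
  hf.comp_homeomorph (etaHomeomorph X ht)

/-- The indicator of the ball of radius R is dominated by a continuous compactly supported function,
and the blow-up integrals of that function converge. This finite upper density bounds every error
term in the later blow-ups. -/
theorem IsApproxTangentPlane.exists_measureReal_le {M : Set (Euc N)} {X : Euc N}
    {S : Submodule ℝ (Euc N)} [IsLocallyFiniteMeasure ((μHE[n] : Measure (Euc N)).restrict M)]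
    (h : IsApproxTangentPlane n M X S) (R : ℝ) :
    ∃ C : ℝ, 0 ≤ C ∧ ∀ᶠ t : ℝ in 𝓝[>] 0,
      ((μHE[n] : Measure (Euc N)).restrict M).real (Metric.closedBall X (R * t)) ≤ C * t ^ n := by
  set f : Euc N → ℝ := fun Z => max 0 (min 1 (R + 1 - ‖Z‖)) with hf
  have hfc : Continuous f := by fun_prop
  have hfs : HasCompactSupport f := by
    refine HasCompactSupport.intro (isCompact_closedBall (0 : Euc N) (R + 1)) fun Z hZ => ?_
    rw [Metric.mem_closedBall, dist_zero_right, not_le] at hZ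
    simp only [hf]
    rw [min_eq_right (by linarith), max_eq_left (by linarith)]
  have hf0 : ∀ Z, 0 ≤ f Z := fun Z => le_max_left _ _
  have hlim := (isApproxTangentPlane_iff.1 h).2 f hfc hfs
  set L := ∫ Y in (S : Set (Euc N)), f Y ∂μHE[n] with hL
  have hL0 : 0 ≤ L := integral_nonneg hf0
  refine ⟨L + 1, by linarith, ?_⟩
  filter_upwards [hlim.eventually_lt_const (show L < L + 1 by linarith), self_mem_nhdsWithin] with t ht ht0
  have ht0 : (0 : ℝ) < t := ht0
  rw [inv_mul_lt_iff₀ (by positivity), mul_comm] at ht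
  refine le_trans ?_ ht.le
  rw [← integral_indicator_one Metric.isClosed_closedBall.measurableSet]
  have hint : Integrable (fun Y => f (t⁻¹ • (Y - X))) ((μHE[n] : Measure (Euc N)).restrict M) :=
    (show Continuous fun Y => f (t⁻¹ • (Y - X)) by fun_prop).integrable_of_hasCompactSupport
      (hasCompactSupport_comp_eta hfs X ht0.ne')
  refine integral_mono_of_nonneg (Eventually.of_forall fun Y => indicator_nonneg (by simp) _) hint
    (Eventually.of_forall fun Y => ?_)
  by_cases hY : Y ∈ Metric.closedBall X (R * t)
  · simp only [indicator_of_mem hY, Pi.one_apply, hf]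
    rw [Metric.mem_closedBall, dist_eq_norm] at hY
    have h1 : ‖t⁻¹ • (Y - X)‖ ≤ R := by
      rw [norm_smul, norm_inv, Real.norm_of_nonneg ht0.le, inv_mul_le_iff₀ ht0]
      linarith
    rw [min_eq_left (by linarith), max_eq_right zero_le_one]
  · simp only [indicator_of_notMem hY]
    exact hf0 _

/-- Suppose v ∈ S lies at distance d > 0 from T, and take a bump of radius d/2 about v. After
rescaling it vanishes on A, whose points near X lie in thin cones about T. Only Aᶜ contributes, with
measure o(tⁿ) by density zero and the finite upper density; so the limit is at most zero, against
its positivity over S. -/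
theorem IsApproxTangentPlane.le_of_cone {M : Set (Euc N)} {X : Euc N}
    {S T : Submodule ℝ (Euc N)} [IsLocallyFiniteMeasure ((μHE[n] : Measure (Euc N)).restrict M)]
    (h : IsApproxTangentPlane n M X S) {A : Set (Euc N)} (hA : MeasurableSet A)
    (hAX : Tendsto (fun r => (μHE[n] : Measure (Euc N)).restrict M (Aᶜ ∩ Metric.closedBall X r) /
      (μHE[n] : Measure (Euc N)).restrict M (Metric.closedBall X r)) (𝓝[>] 0) (𝓝 0))
    (hT : ∀ ε : ℝ, 0 < ε → ∃ r : ℝ, 0 < r ∧ ∀ Y ∈ A, dist Y X < r →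
      Metric.infDist (Y - X) T ≤ ε * ‖Y - X‖) : S ≤ T := by
  set μ := (μHE[n] : Measure (Euc N)).restrict M with hμ
  intro v hvS
  by_contra hvT
  have hTc : IsClosed (T : Set (Euc N)) := T.closed_of_finiteDimensional
  have hd : 0 < Metric.infDist v T := (hTc.notMem_iff_infDist_pos T.nonempty).1 hvT
  set d := Metric.infDist v T with hd'
  set R := ‖v‖ + d / 2 with hR
  have hR0 : 0 < R := by positivity
  set f : Euc N → ℝ := fun Z => max 0 (1 - ‖Z - v‖ / (d / 2)) with hf
  have hfc : Continuous f := by fun_prop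
  have hf0 : ∀ Z, 0 ≤ f Z := fun Z => le_max_left _ _
  have hf1 : ∀ Z, f Z ≤ 1 := fun Z => max_le zero_le_one (by
    have : 0 ≤ ‖Z - v‖ / (d / 2) := by positivity
    linarith)
  have hfz : ∀ Z, d / 2 ≤ ‖Z - v‖ → f Z = 0 := fun Z hZ => by
    refine max_eq_left ?_
    have := (one_le_div (half_pos hd)).2 hZ
    linarith
  have hfR : ∀ Z, R < ‖Z‖ → f Z = 0 := fun Z hZ => hfz Z (by
    have := norm_sub_norm_le Z v
    linarith)
  have hfs : HasCompactSupport f := by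
    refine HasCompactSupport.intro (isCompact_closedBall (0 : Euc N) R) fun Z hZ => ?_
    rw [Metric.mem_closedBall, dist_zero_right, not_le] at hZ
    exact hfR Z hZ
  have hpos := setIntegral_subspace_pos h.1 hfc hfs hf0 hvS (by simp [hf])
  have hlim := (isApproxTangentPlane_iff.1 h).2 f hfc hfs
  obtain ⟨C, hC0, hC⟩ := h.exists_measureReal_le R
  -- The bump is supported in the ball of radius R. With this aperture a point of A within R t of X
  -- has distance at most d t / 4 < d t / 2 from X + T.
  obtain ⟨r, hr, hrA⟩ := hT (d / (4 * R)) (by positivity)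
  refine absurd (le_of_tendsto_of_tendsto hlim (g := fun t : ℝ =>
    (μ (Aᶜ ∩ Metric.closedBall X (R * t)) / μ (Metric.closedBall X (R * t))).toReal * C)
    (a₂ := 0) ?_ ?_) (not_le.2 hpos)
  · have h1 : Tendsto (fun t : ℝ => R * t) (𝓝[>] 0) (𝓝[>] 0) := by
      refine tendsto_nhdsWithin_iff.2 ⟨?_, ?_⟩
      · have : Tendsto (fun t : ℝ => R * t) (𝓝 0) (𝓝 (R * 0)) :=
          (continuous_const.mul continuous_id).tendsto 0
        rw [mul_zero] at this
        exact this.mono_left nhdsWithin_le_nhds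
      · filter_upwards [self_mem_nhdsWithin] with t ht using mul_pos hR0 ht
    have h2 := ((ENNReal.tendsto_toReal ENNReal.zero_ne_top).comp (hAX.comp h1)).mul_const C
    simpa using h2
  · have hsmall : ∀ᶠ t : ℝ in 𝓝[>] 0, t < r / R :=
      (eventually_lt_nhds (div_pos hr hR0)).filter_mono nhdsWithin_le_nhds
    filter_upwards [hC, hsmall, self_mem_nhdsWithin] with t htC htr ht0
    have ht0 : (0 : ℝ) < t := ht0
    rw [lt_div_iff₀ hR0] at htr
    have hzero : ∀ Y, Y ∉ Aᶜ ∩ Metric.closedBall X (R * t) → f (t⁻¹ • (Y - X)) = 0 := by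
      intro Y hY
      by_cases hYR : R < ‖t⁻¹ • (Y - X)‖
      · exact hfR _ hYR
      rw [not_lt, norm_smul, norm_inv, Real.norm_of_nonneg ht0.le, inv_mul_le_iff₀ ht0] at hYR
      have hYA : Y ∈ A := by
        by_contra hYA
        exact hY ⟨hYA, by rw [Metric.mem_closedBall, dist_eq_norm]; linarith⟩
      refine hfz _ ?_
      by_contra hlt
      rw [not_le] at hlt
      have h1 := hrA Y hYA (by rw [dist_eq_norm]; linarith)
      have h2 : d / (4 * R) * ‖Y - X‖ ≤ d / 4 * t := by
        calc d / (4 * R) * ‖Y - X‖ ≤ d / (4 * R) * (t * R) := by gcongr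
          _ = d / 4 * t := by field_simp
      obtain ⟨w, hw, hwd⟩ := (Metric.infDist_lt_iff T.nonempty (x := Y - X) (r := d / 2 * t)).1
        (by nlinarith [mul_pos hd ht0])
      have h3 : dist v (t⁻¹ • w) < d := by
        have h4 : dist (t⁻¹ • (Y - X)) (t⁻¹ • w) < d / 2 := by
          rw [dist_smul₀, norm_inv, Real.norm_of_nonneg ht0.le, inv_mul_lt_iff₀ ht0]
          linarith
        have h5 := dist_triangle v (t⁻¹ • (Y - X)) (t⁻¹ • w)
        rw [dist_comm v (t⁻¹ • (Y - X)), dist_eq_norm (t⁻¹ • (Y - X)) v] at h5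
        linarith
      exact absurd (Metric.infDist_le_dist_of_mem (T.smul_mem t⁻¹ hw)) (not_le.2 h3)
    have hm : MeasurableSet (Aᶜ ∩ Metric.closedBall X (R * t)) :=
      hA.compl.inter Metric.isClosed_closedBall.measurableSet
    have hfinB : μ (Metric.closedBall X (R * t)) ≠ ⊤ := (isCompact_closedBall _ _).measure_lt_top.ne
    have hfinA : μ (Aᶜ ∩ Metric.closedBall X (R * t)) ≠ ⊤ :=
      measure_ne_top_of_subset inter_subset_right hfinB
    have h1 : ∫ Y, f (t⁻¹ • (Y - X)) ∂μ ≤ μ.real (Aᶜ ∩ Metric.closedBall X (R * t)) := by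
      rw [← integral_indicator_one hm]
      refine integral_mono_of_nonneg (Eventually.of_forall fun Y => hf0 _) ?_
        (Eventually.of_forall fun Y => ?_)
      · exact (integrable_indicator_iff hm).2 (integrableOn_const hfinA)
      · by_cases hY : Y ∈ Aᶜ ∩ Metric.closedBall X (R * t)
        · simp only [indicator_of_mem hY]
          exact hf1 _
        · simp only [indicator_of_notMem hY]
          exact (hzero Y hY).le
    have h2 : μ.real (Aᶜ ∩ Metric.closedBall X (R * t)) =
        (μ (Aᶜ ∩ Metric.closedBall X (R * t)) / μ (Metric.closedBall X (R * t))).toReal *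
        μ.real (Metric.closedBall X (R * t)) := by
      rw [Measure.real, Measure.real, ← ENNReal.toReal_mul]
      by_cases h0 : μ (Metric.closedBall X (R * t)) = 0
      · rw [measure_mono_null inter_subset_right h0, h0]
        simp
      · rw [ENNReal.div_mul_cancel h0 hfinB]
    rw [inv_mul_le_iff₀ (by positivity)]
    calc _ ≤ _ := h1
      _ = _ := h2
      _ ≤ (μ (Aᶜ ∩ Metric.closedBall X (R * t)) / μ (Metric.closedBall X (R * t))).toReal *
          (C * t ^ n) := by gcongr
      _ = _ := by ring

/-- The Lipschitz inverse gives |y - x| ≤ K |G y - G x|, so the differentiability remainder o(|y -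
x|) is also o(|G y - G x|). Using K + 1 in place of K avoids a zero denominator. -/
theorem IsRegularChart.infDist_range_le {G : Euc n → Euc N} {E : Set (Euc n)}
    (h : IsRegularChart G E) {x : Euc n} (hx : x ∈ E) {ε : ℝ} (hε : 0 < ε) :
    ∃ r : ℝ, 0 < r ∧ ∀ Y ∈ G '' E, dist Y (G x) < r →
      Metric.infDist (Y - G x) (LinearMap.range (fderiv ℝ G x).toLinearMap : Submodule ℝ (Euc N)) ≤
        ε * ‖Y - G x‖ := by
  obtain ⟨K, hK⟩ := h.exists_dist_le
  have hd := (h.differentiableAt x hx).hasFDerivAt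
  rw [hasFDerivAt_iff_isLittleO] at hd
  have hb := hd.def (c := ε / (K + 1)) (by positivity)
  obtain ⟨δ, hδ, hb⟩ := Metric.eventually_nhds_iff.1 hb
  refine ⟨δ / (K + 1), by positivity, ?_⟩
  rintro _ ⟨y, hy, rfl⟩ hY
  have h1 := hK y hy x hx
  rw [lt_div_iff₀ (by positivity)] at hY
  have h0 : (0 : ℝ) ≤ dist (G y) (G x) := dist_nonneg
  have h2 := hb (y := y) (by nlinarith)
  have hmem : fderiv ℝ G x (y - x) ∈
      ((LinearMap.range (fderiv ℝ G x).toLinearMap : Submodule ℝ (Euc N)) : Set (Euc N)) := ⟨y - x, rfl⟩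
  refine (Metric.infDist_le_dist_of_mem hmem).trans ?_
  rw [dist_eq_norm]
  refine h2.trans ?_
  rw [← dist_eq_norm y x, ← dist_eq_norm (G y)]
  rw [div_mul_eq_mul_div, div_le_iff₀ (by positivity)]
  nlinarith [mul_nonneg hε.le h0]

theorem finrank_range_fderiv {A : Euc n →L[ℝ] Euc N} (h : A.toLinearMap.normDet ≠ 0) :
    finrank ℝ (LinearMap.range A.toLinearMap) = n := by
  have : finrank ℝ (LinearMap.range A.toLinearMap) = finrank ℝ (Euc n) := by
    by_contra h'
    exact h (LinearMap.normDet_eq_zero_iff_rank_range_ne.2 h')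
  rw [this, finrank_euclideanSpace_fin]

/-- At almost every point of a chart of a rectifiable set, the approximate tangent plane is the
range of the derivative of the chart. -/
theorem IsRegularChart.ae_tangent_eq {G : Euc n → Euc N} {E : Set (Euc n)}
    (h : IsRegularChart G E) (M : Set (Euc N))
    [IsLocallyFiniteMeasure ((μHE[n] : Measure (Euc N)).restrict M)] :
    ∀ᵐ X ∂((μHE[n] : Measure (Euc N)).restrict M), ∀ x ∈ E, G x = X → ∀ S,
      IsApproxTangentPlane n M X S → S = LinearMap.range (fderiv ℝ G x).toLinearMap := by
  have hA := h.measurableSet_image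
  -- By the density theorem the complement of the chart has density zero at almost every point of M
  -- inside the chart. The tangent plane is then contained in the range of the derivative, and the
  -- dimensions agree.
  filter_upwards [Besicovitch.ae_tendsto_measure_inter_div_of_measurableSet
    ((μHE[n] : Measure (Euc N)).restrict M) hA.compl] with X hX x hx hGx S hS
  subst hGx
  have hxA : G x ∉ (G '' E)ᶜ := not_not_intro (mem_image_of_mem G hx)
  rw [indicator_of_notMem hxA] at hX
  have hle := hS.le_of_cone hA hX fun ε hε => h.infDist_range_le hx hε
  refine Submodule.eq_of_le_of_finrank_eq hle ?_
  rw [hS.1, finrank_range_fderiv (h.normDet_ne_zero x hx)]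

end

/-! ### The area formula for a diffeomorphism restricted to a rectifiable set -/

section

variable {n N : ℕ}

/-- The linear map `ℝⁿ → ℝ^N` sending the standard basis to the frame `v`. -/
def frameMap (v : Fin n → Euc N) : Euc n →L[ℝ] Euc N :=
  ∑ i, (EuclideanSpace.proj i : Euc n →L[ℝ] ℝ).smulRight (v i)

theorem frameMap_apply (v : Fin n → Euc N) (y : Euc n) : frameMap v y = ∑ i, y i • v i := by
  simp [frameMap]

theorem frameMap_single (v : Fin n → Euc N) (i : Fin n) :
    frameMap v (EuclideanSpace.single i 1) = v i := by
  rw [frameMap_apply, Finset.sum_eq_single i]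
  · simp
  · intro j _ hj
    simp [hj]
  · simp

theorem range_frameMap (v : Fin n → Euc N) :
    LinearMap.range (frameMap v).toLinearMap = Submodule.span ℝ (range v) := by
  apply le_antisymm
  · rintro _ ⟨y, rfl⟩
    change frameMap v y ∈ _
    rw [frameMap_apply]
    exact Submodule.sum_mem _ fun i _ => Submodule.smul_mem _ _ (Submodule.subset_span ⟨i, rfl⟩)
  · rw [Submodule.span_le]
    rintro _ ⟨i, rfl⟩
    exact ⟨EuclideanSpace.single i 1, frameMap_single v i⟩

theorem normDet_comp_frameMap (A : Euc N →L[ℝ] Euc N) (v : Fin n → Euc N) :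
    (A ∘L frameMap v).toLinearMap.normDet =
      Real.sqrt (Matrix.gram ℝ fun i => A (v i)).det := by
  rw [normDet_eq_sqrt_det_gram]
  congr 3
  ext i
  simp [frameMap_single]

theorem normDet_frameMap {v : Fin n → Euc N} (hv : Orthonormal ℝ v) :
    (frameMap v).toLinearMap.normDet = 1 := by
  have h := normDet_comp_frameMap (ContinuousLinearMap.id ℝ (Euc N)) v
  rw [ContinuousLinearMap.id_comp] at h
  rw [h, Real.sqrt_eq_one]
  have : (Matrix.gram ℝ fun i => (ContinuousLinearMap.id ℝ (Euc N)) (v i)) = 1 := by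
    ext i j
    simp [Matrix.gram_apply, orthonormal_iff_ite.1 hv, Matrix.one_apply]
  rw [this, Matrix.det_one]

/-- The Jacobian of `Φ` along the planes spanned by the frames `τ`. -/
def frameJacobian (Φ : Euc N → Euc N) (τ : Euc N → Fin n → Euc N) (X : Euc N) : ℝ :=
  (fderiv ℝ Φ X ∘L frameMap (τ X)).toLinearMap.normDet

theorem frameJacobian_nonneg (Φ : Euc N → Euc N) (τ : Euc N → Fin n → Euc N) (X : Euc N) :
    0 ≤ frameJacobian Φ τ X := LinearMap.normDet_nonneg _

theorem measurable_frameJacobian (Φ : Euc N → Euc N) {τ : Euc N → Fin n → Euc N}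
    (hτ : Measurable τ) : Measurable (frameJacobian Φ τ) := by
  have h2 : ∀ i, Measurable fun X => fderiv ℝ Φ X (τ X i) := fun i => by
    have hτi : Measurable fun X => τ X i := (measurable_pi_apply i).comp hτ
    have hc : Continuous fun p : (Euc N →L[ℝ] Euc N) × Euc N => p.1 p.2 := by fun_prop
    exact hc.measurable.comp ((measurable_fderiv ℝ Φ).prodMk hτi)
  have : frameJacobian Φ τ = fun X => Real.sqrt (Matrix.gram ℝ fun i => fderiv ℝ Φ X (τ X i)).det :=
    funext fun X => normDet_comp_frameMap _ _
  rw [this]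
  have h3 : Measurable fun X => (fun i => fderiv ℝ Φ X (τ X i)) := measurable_pi_iff.2 h2
  have h4 : Continuous fun v : Fin n → Euc N => Real.sqrt (Matrix.gram ℝ v).det := by
    refine Real.continuous_sqrt.comp (Continuous.matrix_det (continuous_matrix fun i j => ?_))
    simp only [Matrix.gram_apply]
    fun_prop
  exact h4.measurable.comp h3

/-- A differentiable bi-Lipschitz homeomorphism. -/
structure IsBilipschitzDiffeo (K : ℝ≥0) (Φ : Euc N ≃ₜ Euc N) : Prop where
  differentiable : Differentiable ℝ Φ
  lipschitz : LipschitzWith K Φ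
  antilipschitz : AntilipschitzWith K Φ
  norm_le : ∀ X v, ‖v‖ ≤ K * ‖fderiv ℝ Φ X v‖

theorem IsBilipschitzDiffeo.injective_fderiv {K : ℝ≥0} {Φ : Euc N ≃ₜ Euc N}
    (h : IsBilipschitzDiffeo K Φ) (X : Euc N) : Function.Injective (fderiv ℝ Φ X) := by
  refine (injective_iff_map_eq_zero _).2 fun v hv => ?_
  have := h.norm_le X v
  rw [hv, norm_zero, mul_zero] at this
  exact norm_le_zero_iff.1 this

/-- A field of frames of the approximate tangent planes of a rectifiable set. -/
structure IsTangentFrame (M : Set (Euc N)) (τ : Euc N → Fin n → Euc N) : Prop where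
  nullMeasurableSet : NullMeasurableSet M (μHE[n] : Measure (Euc N))
  rectifiable : CountablyRectifiable n M
  locallyFinite : IsLocallyFiniteMeasure ((μHE[n] : Measure (Euc N)).restrict M)
  measurable : Measurable τ
  tangent : ∀ᵐ X ∂((μHE[n] : Measure (Euc N)).restrict M), Orthonormal ℝ (τ X) ∧
    IsApproxTangentPlane n M X (Submodule.span ℝ (range (τ X)))

/-- The volume factor of h after f depends on f only through its range and its own volume factor.
With f the derivative of a chart and g an orthonormal frame of the same plane, this splits off the
Jacobian along the frame. -/
theorem normDet_comp_eq_of_range_eq {U V W : Type*} [NormedAddCommGroup U] [InnerProductSpace ℝ U]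
    [FiniteDimensional ℝ U] [NormedAddCommGroup V] [InnerProductSpace ℝ V] [FiniteDimensional ℝ V]
    [NormedAddCommGroup W] [InnerProductSpace ℝ W] (f g : U →ₗ[ℝ] V) (h : V →ₗ[ℝ] W)
    (hfg : LinearMap.range f = LinearMap.range g) (hg : g.normDet = 1) :
    (h ∘ₗ f).normDet = (h ∘ₗ g).normDet * f.normDet := by
  have key : ∀ S T : Submodule ℝ V, S = T → (h.domRestrict S).normDet = (h.domRestrict T).normDet := by
    rintro S _ rfl; rfl
  rw [LinearMap.normDet_comp f h, LinearMap.normDet_comp g h, hg, mul_one, key _ _ hfg]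

variable {M : Set (Euc N)} {τ : Euc N → Fin n → Euc N} {K : ℝ≥0} {Φ : Euc N ≃ₜ Euc N}

/-- The area formula is applied to Φ ∘ G and to G. By the chain rule the Jacobians differ by the
factor `frameJacobian`, because the frame almost everywhere spans the range of the derivative of G.
-/
theorem IsRegularChart.hausdorffMeasure_image_image {G : Euc n → Euc N} {E : Set (Euc n)}
    (hG : IsRegularChart G E) (hM : IsTangentFrame M τ) (hΦ : IsBilipschitzDiffeo K Φ)
    (hE : G '' E ⊆ M) :
    (μHE[n] : Measure (Euc N)) (Φ '' (G '' E)) =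
      ∫⁻ X in G '' E, ENNReal.ofReal (frameJacobian Φ τ X) ∂μHE[n] := by
  have := hM.locallyFinite
  have hJG := measurable_ofReal_normDet_fderiv G
  have hJ := ENNReal.measurable_ofReal.comp (measurable_frameJacobian Φ hM.measurable)
  have hres := restrict_image_eq_map_withDensity hG.continuous.measurable hG.measurableSet
    hG.differentiableAt hG.injOn
  have hd : ∀ x ∈ E, DifferentiableAt ℝ (Φ ∘ G) x := fun x hx =>
    (hΦ.differentiable _).comp x (hG.differentiableAt x hx)
  rw [← image_comp, euclideanHausdorffMeasure_image_eq_lintegral _ hG.measurableSet hd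
    (Φ.injective.comp_injOn hG.injOn), hres]
  change _ = ∫⁻ X, (ENNReal.ofReal ∘ frameJacobian Φ τ) X ∂_
  rw [lintegral_map hJ hG.continuous.measurable,
    lintegral_withDensity_eq_lintegral_mul _ hJG (g := fun a => (ENNReal.ofReal ∘ frameJacobian Φ τ) (G a))
      (hJ.comp hG.continuous.measurable)]
  have hae : ∀ᵐ X ∂((μHE[n] : Measure (Euc N)).restrict (G '' E)), Orthonormal ℝ (τ X) ∧
      ∀ x ∈ E, G x = X → Submodule.span ℝ (range (τ X)) =
        LinearMap.range (fderiv ℝ G x).toLinearMap := by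
    refine ae_mono (Measure.restrict_mono hE le_rfl) ?_
    filter_upwards [hM.tangent, hG.ae_tangent_eq M] with X h1 h2
    exact ⟨h1.1, fun x hx hGx => h2 x hx hGx _ h1.2⟩
  rw [hres] at hae
  -- Pulled back to the chart domain, the almost everywhere statement is known only where the
  -- Jacobian of G is nonzero; on a regular chart that is everywhere.
  have hae2 := (ae_withDensity_iff hJG).1
    (ae_of_ae_map hG.continuous.measurable.aemeasurable hae)
  refine lintegral_congr_ae ?_
  filter_upwards [hae2, ae_restrict_mem hG.measurableSet] with x hx hxE
  have hpos : ENNReal.ofReal (fderiv ℝ G x).toLinearMap.normDet ≠ 0 := by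
    rw [Ne, ENNReal.ofReal_eq_zero, not_le]
    exact lt_of_le_of_ne (LinearMap.normDet_nonneg _) (hG.normDet_ne_zero x hxE).symm
  obtain ⟨ho, ht⟩ := hx hpos
  have hr := ht x hxE rfl
  rw [← range_frameMap] at hr
  simp only [Pi.mul_apply, Function.comp]
  rw [← ENNReal.ofReal_mul (LinearMap.normDet_nonneg _)]
  congr 1
  have hchain := ((hΦ.differentiable (G x)).hasFDerivAt.comp x
    (hG.differentiableAt x hxE).hasFDerivAt).fderiv
  change (fderiv ℝ (Φ ∘ G) x).toLinearMap.normDet = _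
  rw [hchain, mul_comm]
  exact normDet_comp_eq_of_range_eq (fderiv ℝ G x).toLinearMap (frameMap (τ (G x))).toLinearMap
    (fderiv ℝ Φ (G x)).toLinearMap hr.symm (normDet_frameMap ho)

/-- The area formula for a diffeomorphism on a rectifiable set. -/
theorem IsTangentFrame.restrict_comap (hM : IsTangentFrame M τ) (hΦ : IsBilipschitzDiffeo K Φ) :
    ((μHE[n] : Measure (Euc N)).comap Φ).restrict M =
      ((μHE[n] : Measure (Euc N)).restrict M).withDensity
        fun X => ENNReal.ofReal (frameJacobian Φ τ X) := by
  have hJ : Measurable fun X => ENNReal.ofReal (frameJacobian Φ τ X) :=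
    ENNReal.measurable_ofReal.comp (measurable_frameJacobian Φ hM.measurable)
  have hcomap : ∀ B, (μHE[n] : Measure (Euc N)).comap Φ B = μHE[n] (Φ '' B) := fun B =>
    Φ.measurableEmbedding.comap_apply _ _
  obtain ⟨G, E, hGE, hcov⟩ := hM.rectifiable.exists_regular_charts
  -- M is only null measurable. Cutting the chart domains to the preimage of a Borel core keeps them
  -- Borel and puts the images inside M.
  obtain ⟨M₀, hM₀s, hM₀m, hM₀⟩ := hM.nullMeasurableSet.exists_measurable_subset_ae_eq
  set E' : ℕ × ℕ → Set (Euc n) := fun i => E i ∩ G i ⁻¹' M₀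
  have hE' : ∀ i, IsRegularChart (G i) (E' i) := fun i => (hGE i).mono
    ((hGE i).measurableSet.inter ((hGE i).continuous.measurable hM₀m)) inter_subset_left
  have himg : ∀ i, G i '' E' i = G i '' E i ∩ M₀ := fun i => image_inter_preimage _ _ _
  have hdiff : (μHE[n] : Measure (Euc N)) (M \ ⋃ i, G i '' E' i) = 0 := by
    refine measure_mono_null (t := (M \ M₀) ∪ (M \ ⋃ i, G i '' E i)) ?_
      (measure_union_null (ae_le_set.1 hM₀.symm.le) hcov)
    rintro x ⟨hx, hx'⟩
    by_cases h0 : x ∈ M₀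
    · refine Or.inr ⟨hx, fun h => hx' ?_⟩
      obtain ⟨i, hi⟩ := mem_iUnion.1 h
      exact mem_iUnion.2 ⟨i, by rw [himg]; exact ⟨hi, h0⟩⟩
    · exact Or.inl ⟨hx, h0⟩
  have hsub : ⋃ i, G i '' E' i ⊆ M := iUnion_subset fun i => by
    rw [himg]; exact inter_subset_right.trans hM₀s
  have hUM : (⋃ i, G i '' E' i : Set (Euc N)) =ᵐ[(μHE[n] : Measure (Euc N))] M :=
    hsub.eventuallyLE.antisymm (ae_le_set.2 hdiff)
  have hUM' : (⋃ i, G i '' E' i : Set (Euc N)) =ᵐ[(μHE[n] : Measure (Euc N)).comap Φ] M := by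
    refine hsub.eventuallyLE.antisymm (ae_le_set.2 ?_)
    rw [hcomap]
    have := euclideanHausdorffMeasure_image_le_of_lipschitzOnWith n
      (hΦ.lipschitz.lipschitzOnWith (s := M \ ⋃ i, G i '' E' i))
    rw [hdiff, mul_zero] at this
    exact le_antisymm this zero_le
  have hnm : NullMeasurableSet M (μHE[n] : Measure (Euc N)) := hM.nullMeasurableSet
  rw [← Measure.restrict_congr_set hUM', ← Measure.restrict_congr_set hUM,
    ← restrict_withDensity (MeasurableSet.iUnion fun i => (hE' i).measurableSet_image)]
  -- Two measures agree on a countable union once they agree on each member, so the charts need not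
  -- be disjoint.
  rw [Measure.restrict_iUnion_congr]
  intro i
  ext B hB
  rw [Measure.restrict_apply hB, Measure.restrict_apply hB, hcomap,
    withDensity_apply _ (hB.inter (hE' i).measurableSet_image), inter_comm, ← image_inter_preimage]
  refine ((hE' i).mono ((hE' i).measurableSet.inter ((hE' i).continuous.measurable hB))
    inter_subset_left).hausdorffMeasure_image_image hM hΦ ?_
  exact (image_mono inter_subset_left).trans ((subset_iUnion (fun i => G i '' E' i) i).trans hsub)

theorem IsTangentFrame.restrict_image (hM : IsTangentFrame M τ) (hΦ : IsBilipschitzDiffeo K Φ) :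
    (μHE[n] : Measure (Euc N)).restrict (Φ '' M) =
      (((μHE[n] : Measure (Euc N)).restrict M).withDensity
        fun X => ENNReal.ofReal (frameJacobian Φ τ X)).map Φ := by
  rw [← hM.restrict_comap hΦ]
  ext B hB
  rw [Measure.map_apply Φ.measurable hB, Measure.restrict_apply hB,
    Measure.restrict_apply (Φ.measurable hB), Φ.measurableEmbedding.comap_apply, image_preimage_inter]

end

/-! ### Approximate tangent planes of a diffeomorphic image -/

section

variable {n N : ℕ} {M : Set (Euc N)} {τ : Euc N → Fin n → Euc N} {K : ℝ≥0} {Φ : Euc N ≃ₜ Euc N}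

theorem IsTangentFrame.setIntegral_image (hM : IsTangentFrame M τ) (hΦ : IsBilipschitzDiffeo K Φ)
    (f : Euc N → ℝ) :
    ∫ Z in Φ '' M, f Z ∂μHE[n] =
      ∫ Y in M, frameJacobian Φ τ Y * f (Φ Y) ∂(μHE[n] : Measure (Euc N)) := by
  have hJ : Measurable fun X => ENNReal.ofReal (frameJacobian Φ τ X) :=
    ENNReal.measurable_ofReal.comp (measurable_frameJacobian Φ hM.measurable)
  rw [hM.restrict_image hΦ, Φ.measurableEmbedding.integral_map,
    integral_withDensity_eq_integral_toReal_smul hJ (Eventually.of_forall fun _ =>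
      ENNReal.ofReal_lt_top)]
  simp only [ENNReal.toReal_ofReal (frameJacobian_nonneg _ _ _), smul_eq_mul]

theorem IsTangentFrame.locallyIntegrable_frameJacobian (hM : IsTangentFrame M τ)
    (hΦ : IsBilipschitzDiffeo K Φ) :
    LocallyIntegrable (frameJacobian Φ τ) ((μHE[n] : Measure (Euc N)).restrict M) := by
  have := hM.locallyFinite
  have hJ := measurable_frameJacobian Φ hM.measurable
  refine locallyIntegrable_iff.2 fun k hk => ⟨hJ.aestronglyMeasurable, ?_⟩
  rw [hasFiniteIntegral_iff_ofReal (Eventually.of_forall fun _ => frameJacobian_nonneg _ _ _)]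
  have h1 := congrArg (fun μ : Measure (Euc N) => μ k) (hM.restrict_comap hΦ)
  simp only at h1
  rw [withDensity_apply _ hk.measurableSet, Measure.restrict_apply hk.measurableSet,
    Φ.measurableEmbedding.comap_apply] at h1
  rw [← h1]
  refine (euclideanHausdorffMeasure_image_le_of_lipschitzOnWith n
    (hΦ.lipschitz.lipschitzOnWith (s := k ∩ M))).trans_lt ?_
  refine ENNReal.mul_lt_top (by simp) ?_
  rw [← Measure.restrict_apply hk.measurableSet]
  exact hk.measure_lt_top

/-- The area formula rewrites the blow-up of Φ(M) as an integral over M of J(Y) f((Φ Y - Φ X)/t). At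
a Lebesgue point J(Y) may be replaced by J(X), and by differentiability together with uniform
continuity of f the increment of Φ may be replaced by its linear part L. The limit is J(X) times the
integral of f ∘ L over the tangent plane, which is the integral of f over its image. -/
theorem IsApproxTangentPlane.image [IsLocallyFiniteMeasure ((μHE[n] : Measure (Euc N)).restrict M)]
    (hM : IsTangentFrame M τ) (hΦ : IsBilipschitzDiffeo K Φ) {X : Euc N}
    (ho : Orthonormal ℝ (τ X))
    (hX : IsApproxTangentPlane n M X (Submodule.span ℝ (range (τ X))))
    (hL : Tendsto (fun r => ⨍ Y in Metric.closedBall X r, ‖frameJacobian Φ τ Y - frameJacobian Φ τ X‖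
      ∂((μHE[n] : Measure (Euc N)).restrict M)) (𝓝[>] 0) (𝓝 0)) :
    IsApproxTangentPlane n (Φ '' M) (Φ X)
      (LinearMap.range (fderiv ℝ Φ X ∘L frameMap (τ X)).toLinearMap) := by
  set μ := (μHE[n] : Measure (Euc N)).restrict M with hμ
  set J := frameJacobian Φ τ with hJ
  set L := fderiv ℝ Φ X with hLdef
  have hLinj : Function.Injective L := hΦ.injective_fderiv X
  have hιn := normDet_frameMap ho
  have hιinj : Function.Injective (frameMap (τ X)) :=
    ((frameMap (τ X)).toLinearMap.normDet_ne_zero_tfae.out 0 4).1 (by rw [hιn]; exact one_ne_zero)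
  have hJX : (L ∘L frameMap (τ X)).toLinearMap.normDet = J X := rfl
  have hcompinj : Function.Injective (L ∘L frameMap (τ X)) := hLinj.comp hιinj
  have hJ0 : 0 ≤ J X := frameJacobian_nonneg _ _ _
  rw [isApproxTangentPlane_iff]
  refine ⟨finrank_range_fderiv
    (((L ∘L frameMap (τ X)).toLinearMap.normDet_ne_zero_tfae.out 0 4).2 hcompinj), ?_⟩
  intro f hf hfs
  have hLce : IsClosedEmbedding L := LinearMap.isClosedEmbedding_of_injective
    (f := L.toLinearMap) (LinearMap.ker_eq_bot.2 hLinj)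
  have hlim := (isApproxTangentPlane_iff.1 hX).2 (fun Z => f (L Z)) (hf.comp L.continuous)
    (hfs.comp_isClosedEmbedding hLce)
  have hval : ∫ Z in (LinearMap.range (L ∘L frameMap (τ X)).toLinearMap : Set (Euc N)), f Z ∂μHE[n] =
      J X * ∫ Z in (Submodule.span ℝ (range (τ X)) : Set (Euc N)), f (L Z) ∂μHE[n] := by
    rw [← range_frameMap]
    have h1 := setIntegral_range_linear (L ∘L frameMap (τ X)) hcompinj f
    have h2 := setIntegral_range_linear (frameMap (τ X)) hιinj (fun Z => f (L Z))
    rw [hιn, one_mul] at h2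
    rw [hJX] at h1
    exact h1.trans (congrArg (J X * ·) h2.symm)
  rw [hval]
  refine Tendsto.congr' (f₁ := fun t : ℝ => (t ^ n)⁻¹ * ∫ Y, J Y * f (t⁻¹ • (Φ Y - Φ X)) ∂μ) ?_ ?_
  · refine Eventually.of_forall fun t => ?_
    simp only
    rw [hM.setIntegral_image hΦ]
  have hlim2 := hlim.const_mul (J X)
  refine (tendsto_iff_of_dist ?_).2 hlim2
  -- the two rescaled integrals are asymptotically equal
  obtain ⟨R₀, hR₀⟩ := hfs.isCompact.isBounded.subset_closedBall (0 : Euc N)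
  obtain ⟨B, hB⟩ := hfs.exists_bound_of_continuous hf
  have hB0 : 0 ≤ B := (norm_nonneg _).trans (hB 0)
  -- Both Φ and its derivative shrink lengths by at most the factor K. Hence both rescaled
  -- integrands vanish outside the ball of radius (R + 1) t.
  set R := K * (|R₀| + 1) with hR
  have hR0 : 0 ≤ R := by positivity
  obtain ⟨C, hC0, hC⟩ := hX.exists_measureReal_le (R + 1)
  have hfz : ∀ Z, |R₀| + 1 < ‖Z‖ → f Z = 0 := fun Z hZ => by
    by_contra h
    have := hR₀ (subset_tsupport f h)
    rw [Metric.mem_closedBall, dist_zero_right] at this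
    linarith [le_abs_self R₀]
  have hJli : LocallyIntegrable J μ := hM.locallyIntegrable_frameJacobian hΦ
  rw [Metric.tendsto_nhds]
  intro ε hε
  -- The ball has measure at most C tⁿ. This tolerance, and the one chosen below for the mean
  -- oscillation of J, make each of the two errors at most ε/4 after division by tⁿ.
  obtain ⟨δ, hδ, hfδ⟩ := Metric.uniformContinuous_iff.1 (hfs.uniformContinuous_of_continuous hf)
    (ε / (4 * (J X + 1) * (C + 1))) (by positivity)
  have hscale : Tendsto (fun t : ℝ => (R + 1) * t) (𝓝[>] 0) (𝓝[>] 0) := by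
    refine tendsto_nhdsWithin_iff.2 ⟨?_, ?_⟩
    · have : Tendsto (fun t : ℝ => (R + 1) * t) (𝓝 0) (𝓝 ((R + 1) * 0)) :=
        (continuous_const.mul continuous_id).tendsto 0
      rw [mul_zero] at this
      exact this.mono_left nhdsWithin_le_nhds
    · filter_upwards [self_mem_nhdsWithin] with t ht
      exact mul_pos (by linarith) (show (0 : ℝ) < t from ht)
  have hLt := (hL.comp hscale).eventually_lt_const
    (show (0 : ℝ) < ε / (4 * (B + 1) * (C + 1)) by positivity)
  have hd := (hΦ.differentiable X).hasFDerivAt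
  rw [hasFDerivAt_iff_isLittleO] at hd
  obtain ⟨ρ, hρ, hdρ⟩ := Metric.eventually_nhds_iff.1
    (hd.def (c := δ / (2 * (R + 1))) (by positivity))
  have hsmall : ∀ᶠ t : ℝ in 𝓝[>] 0, (R + 1) * t < ρ := by
    have : ∀ᶠ t : ℝ in 𝓝[>] 0, t < ρ / (R + 1) :=
      (eventually_lt_nhds (div_pos hρ (by linarith))).filter_mono nhdsWithin_le_nhds
    filter_upwards [this] with t ht
    rwa [lt_div_iff₀ (by linarith), mul_comm] at ht
  filter_upwards [hC, hLt, hsmall, self_mem_nhdsWithin] with t htC htL htρ ht0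
  have ht0 : (0 : ℝ) < t := ht0
  set W := Metric.closedBall X ((R + 1) * t) with hW
  have hWm : MeasurableSet W := Metric.isClosed_closedBall.measurableSet
  have hWfin : μ W ≠ ⊤ := (isCompact_closedBall _ _).measure_lt_top.ne
  -- the integrands vanish off `W`
  have hv1 : ∀ Y, Y ∉ W → f (t⁻¹ • (Φ Y - Φ X)) = 0 := fun Y hY => hfz _ (by
    rw [hW, Metric.mem_closedBall, not_le] at hY
    have h1 := hΦ.antilipschitz.le_mul_dist Y X
    rw [dist_eq_norm (Φ Y)] at h1
    rw [norm_smul, norm_inv, Real.norm_of_nonneg ht0.le, lt_inv_mul_iff₀ ht0]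
    by_contra hcon
    rw [not_lt] at hcon
    have h2 : (K : ℝ) * ‖Φ Y - Φ X‖ ≤ K * (t * (|R₀| + 1)) := by gcongr
    nlinarith)
  have hv2 : ∀ Y, Y ∉ W → f (L (t⁻¹ • (Y - X))) = 0 := fun Y hY => hfz _ (by
    rw [hW, Metric.mem_closedBall, not_le, dist_eq_norm] at hY
    have h1 := hΦ.norm_le X (Y - X)
    rw [map_smul, norm_smul, norm_inv, Real.norm_of_nonneg ht0.le, lt_inv_mul_iff₀ ht0]
    by_contra hcon
    rw [not_lt] at hcon
    have h2 : (K : ℝ) * ‖L (Y - X)‖ ≤ K * (t * (|R₀| + 1)) := by gcongr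
    nlinarith)
  have hi1 : Integrable (fun Y => J Y * f (t⁻¹ • (Φ Y - Φ X))) μ := by
    have hcs : HasCompactSupport fun Y => f (t⁻¹ • (Φ Y - Φ X)) :=
      HasCompactSupport.intro (isCompact_closedBall X ((R + 1) * t)) hv1
    have hcc : Continuous fun Y => f (t⁻¹ • (Φ Y - Φ X)) :=
      hf.comp ((Φ.continuous.sub (continuous_const (y := Φ X))).const_smul t⁻¹)
    simpa [mul_comm] using hJli.integrable_smul_left_of_hasCompactSupport hcc hcs
  have hi2 : Integrable (fun Y => J X * f (L (t⁻¹ • (Y - X)))) μ := by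
    have hcs : HasCompactSupport fun Y => f (L (t⁻¹ • (Y - X))) :=
      HasCompactSupport.intro (isCompact_closedBall X ((R + 1) * t)) hv2
    have hcc : Continuous fun Y => f (L (t⁻¹ • (Y - X))) :=
      hf.comp (L.continuous.comp ((continuous_id.sub (continuous_const (y := X))).const_smul t⁻¹))
    exact (hcc.integrable_of_hasCompactSupport hcs).const_mul _
  have hJW : IntegrableOn (fun Y => ‖J Y - J X‖) W μ :=
    ((hJli.integrableOn_isCompact (isCompact_closedBall _ _)).sub
      (integrableOn_const hWfin)).norm
  have hbound : ∀ Y, ‖J Y * f (t⁻¹ • (Φ Y - Φ X)) - J X * f (L (t⁻¹ • (Y - X)))‖ ≤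
      W.indicator (fun Y => B * ‖J Y - J X‖ + J X * (ε / (4 * (J X + 1) * (C + 1)))) Y := by
    intro Y
    by_cases hY : Y ∈ W
    · rw [indicator_of_mem hY]
      have hYn : ‖Y - X‖ ≤ (R + 1) * t := by
        rwa [hW, Metric.mem_closedBall, dist_eq_norm] at hY
      have h1 : dist (f (t⁻¹ • (Φ Y - Φ X))) (f (L (t⁻¹ • (Y - X)))) <
          ε / (4 * (J X + 1) * (C + 1)) := by
        refine hfδ ?_
        rw [dist_eq_norm, map_smul, ← smul_sub, norm_smul, norm_inv, Real.norm_of_nonneg ht0.le,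
          inv_mul_lt_iff₀ ht0]
        have h2 := hdρ (y := Y) (by rw [dist_eq_norm]; linarith)
        calc _ ≤ _ := h2
          _ ≤ δ / (2 * (R + 1)) * ((R + 1) * t) := by gcongr
          _ = δ / 2 * t := by field_simp
          _ < t * δ := by nlinarith [mul_pos hδ ht0]
      rw [dist_eq_norm] at h1
      calc ‖J Y * f (t⁻¹ • (Φ Y - Φ X)) - J X * f (L (t⁻¹ • (Y - X)))‖
          = ‖(J Y - J X) * f (t⁻¹ • (Φ Y - Φ X)) +
              J X * (f (t⁻¹ • (Φ Y - Φ X)) - f (L (t⁻¹ • (Y - X))))‖ := by congr 1; ring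
        _ ≤ ‖J Y - J X‖ * ‖f (t⁻¹ • (Φ Y - Φ X))‖ +
              J X * ‖f (t⁻¹ • (Φ Y - Φ X)) - f (L (t⁻¹ • (Y - X)))‖ := by
            refine (norm_add_le _ _).trans_eq ?_
            rw [norm_mul, norm_mul, Real.norm_of_nonneg hJ0]
        _ ≤ ‖J Y - J X‖ * B + J X * (ε / (4 * (J X + 1) * (C + 1))) := by
            gcongr
            exact hB _
        _ = _ := by ring
    · rw [indicator_of_notMem hY, hv1 Y hY, hv2 Y hY]
      simp
  have hfin : ‖∫ Y, J Y * f (t⁻¹ • (Φ Y - Φ X)) ∂μ - ∫ Y, J X * f (L (t⁻¹ • (Y - X))) ∂μ‖ ≤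
      B * ∫ Y in W, ‖J Y - J X‖ ∂μ + J X * (ε / (4 * (J X + 1) * (C + 1))) * μ.real W := by
    rw [← integral_sub hi1 hi2]
    refine (norm_integral_le_of_norm_le ((integrable_indicator_iff hWm).2
      ((hJW.const_mul B).add (integrableOn_const hWfin))) (Eventually.of_forall hbound)).trans_eq ?_
    rw [integral_indicator hWm]
    simp only [Pi.add_apply]
    rw [integral_add (hJW.const_mul B) (integrableOn_const hWfin),
      integral_const_mul, setIntegral_const, smul_eq_mul, mul_comm (μ.real W)]
  have havg : ∫ Y in W, ‖J Y - J X‖ ∂μ = μ.real W * ⨍ Y in W, ‖J Y - J X‖ ∂μ := by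
    rw [← smul_eq_mul, measure_smul_setAverage _ hWfin]
  have havg0 : 0 ≤ ⨍ Y in W, ‖J Y - J X‖ ∂μ := by
    rw [setAverage_eq]
    exact smul_nonneg (by positivity) (integral_nonneg fun _ => norm_nonneg _)
  rw [dist_eq_norm]
  have hfac : (t ^ n)⁻¹ * ∫ Y, J Y * f (t⁻¹ • (Φ Y - Φ X)) ∂μ -
      J X * ((t ^ n)⁻¹ * ∫ Y, f (L (t⁻¹ • (Y - X))) ∂μ) = (t ^ n)⁻¹ *
      (∫ Y, J Y * f (t⁻¹ • (Φ Y - Φ X)) ∂μ - ∫ Y, J X * f (L (t⁻¹ • (Y - X))) ∂μ) := by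
    rw [integral_const_mul]; ring
  have htn : (0 : ℝ) < t ^ n := by positivity
  have htL' : ⨍ Y in W, ‖J Y - J X‖ ∂μ < ε / (4 * (B + 1) * (C + 1)) := htL
  rw [dist_eq_norm, sub_zero, norm_norm]
  change ‖(t ^ n)⁻¹ * ∫ Y, J Y * f (t⁻¹ • (Φ Y - Φ X)) ∂μ -
      J X * ((t ^ n)⁻¹ * ∫ Y, f (L (t⁻¹ • (Y - X))) ∂μ)‖ < ε
  rw [hfac, norm_mul, norm_inv, Real.norm_of_nonneg htn.le, inv_mul_lt_iff₀ htn]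
  refine hfin.trans_lt ?_
  rw [havg]
  set a := ⨍ Y in W, ‖J Y - J X‖ ∂μ with ha
  have hμ0 : 0 ≤ μ.real W := measureReal_nonneg
  have e1 : B * (μ.real W * a) ≤ t ^ n * (ε / 4) := by
    calc B * (μ.real W * a) ≤ (B + 1) * ((C * t ^ n) * (ε / (4 * (B + 1) * (C + 1)))) := by
          gcongr
          linarith
      _ = t ^ n * (ε / 4) * (C / (C + 1)) := by field_simp
      _ ≤ t ^ n * (ε / 4) * 1 := by
          gcongr
          rw [div_le_one (by linarith)]
          linarith
      _ = _ := mul_one _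
  have e2 : J X * (ε / (4 * (J X + 1) * (C + 1))) * μ.real W ≤ t ^ n * (ε / 4) := by
    calc J X * (ε / (4 * (J X + 1) * (C + 1))) * μ.real W
        ≤ (J X + 1) * (ε / (4 * (J X + 1) * (C + 1))) * (C * t ^ n) := by
          gcongr
          linarith
      _ = t ^ n * (ε / 4) * (C / (C + 1)) := by field_simp
      _ ≤ t ^ n * (ε / 4) * 1 := by
          gcongr
          rw [div_le_one (by linarith)]
          linarith
      _ = _ := mul_one _
  nlinarith [mul_pos htn hε]

/-- The image of a rectifiable set under a diffeomorphism has approximate tangent planes, spanned by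
the images of the frames. -/
theorem IsTangentFrame.ae_isApproxTangentPlane_image (hM : IsTangentFrame M τ)
    (hΦ : IsBilipschitzDiffeo K Φ) :
    ∀ᵐ X ∂((μHE[n] : Measure (Euc N)).restrict M), Orthonormal ℝ (τ X) ∧
      IsApproxTangentPlane n (Φ '' M) (Φ X)
        (LinearMap.range (fderiv ℝ Φ X ∘L frameMap (τ X)).toLinearMap) := by
  have := hM.locallyFinite
  filter_upwards [hM.tangent, (Besicovitch.vitaliFamily
    ((μHE[n] : Measure (Euc N)).restrict M)).ae_tendsto_average_norm_sub
    (hM.locallyIntegrable_frameJacobian hΦ)] with X h1 h2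
  exact ⟨h1.1, IsApproxTangentPlane.image hM hΦ h1.1 h1.2
    (h2.comp (Besicovitch.tendsto_filterAt _ X))⟩

end

/-! ### Push-forward of a rectifiable current -/

section

variable {n N : ℕ} {K : ℝ≥0} {Φ : Euc N ≃ₜ Euc N}

/-- Each Gram-Schmidt vector is a measurable expression in the earlier ones, whence strong induction
on the index. This yields a measurable orthonormal frame for the pushed-forward orientation. -/
theorem measurable_gramSchmidtNormed :
    Measurable fun v : Fin n → Euc N => InnerProductSpace.gramSchmidtNormed ℝ v := by
  have h : ∀ (k : ℕ) (i : Fin n), i.val = k →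
      Measurable fun v : Fin n → Euc N => InnerProductSpace.gramSchmidt ℝ v i := by
    intro k
    induction k using Nat.strong_induction_on with
    | _ k ih =>
      intro i hi
      have heq : (fun v : Fin n → Euc N => InnerProductSpace.gramSchmidt ℝ v i) = fun v =>
          v i - ∑ j ∈ Finset.Iio i, (inner ℝ (InnerProductSpace.gramSchmidt ℝ v j) (v i) /
            ((‖InnerProductSpace.gramSchmidt ℝ v j‖ : ℝ) ^ 2)) • InnerProductSpace.gramSchmidt ℝ v j := by
        ext1 v
        rw [InnerProductSpace.gramSchmidt_def]
        simp only [Submodule.starProjection_singleton]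
        rfl
      rw [heq]
      refine (measurable_pi_apply i).sub (Finset.measurable_sum _ fun j hj => ?_)
      have hj' := ih j.val (by rw [← hi]; exact Fin.lt_def.1 (Finset.mem_Iio.1 hj)) j rfl
      exact ((hj'.inner (measurable_pi_apply i)).div ((hj'.norm.pow_const 2))).smul hj'
  refine measurable_pi_iff.2 fun i => ?_
  have := h i.val i rfl
  exact this.norm.inv.smul this

/-- The value of an alternating form on a frame is the volume of the frame times the value on its
Gram-Schmidt orthonormalization. -/
theorem alternatingMap_eq_normDet_mul_gramSchmidtNormed (α : Euc N [⋀^Fin n]→L[ℝ] ℝ)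
    {v : Fin n → Euc N} (hv : LinearIndependent ℝ v) :
    α v = (frameMap v).toLinearMap.normDet * α (InnerProductSpace.gramSchmidtNormed ℝ v) := by
  set e := InnerProductSpace.gramSchmidtNormed ℝ v with he
  have heo : Orthonormal ℝ e := InnerProductSpace.gramSchmidtNormed_orthonormal hv
  set T : Matrix (Fin n) (Fin n) ℝ := Matrix.of fun j i => inner ℝ (e j) (v i) with hT
  have hspan : ∀ i, v i ∈ Submodule.span ℝ (range e) := fun i => by
    rw [he, InnerProductSpace.span_gramSchmidtNormed_range, InnerProductSpace.span_gramSchmidt]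
    exact Submodule.subset_span ⟨i, rfl⟩
  have hvi : ∀ i, v i = ∑ j, T j i • e j := by
    intro i
    obtain ⟨c, hc⟩ := (Submodule.mem_span_range_iff_exists_fun ℝ).1 (hspan i)
    have : ∀ j, T j i = c j := fun j => by
      simp only [hT, Matrix.of_apply]
      rw [← hc, heo.inner_right_fintype]
    simp_rw [this]
    exact hc.symm
  -- The transition matrix is upper triangular with positive diagonal, so its determinant is
  -- positive: orthonormalization preserves orientation. The Gram determinant alone would give the
  -- factor only up to sign.
  have htri : ∀ j i, i < j → T j i = 0 := fun j i hij => by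
    simp only [hT, Matrix.of_apply, he, InnerProductSpace.gramSchmidtNormed, inner_smul_left,
      InnerProductSpace.gramSchmidt_inv_triangular ℝ v hij, mul_zero]
  have hdiag : ∀ i, 0 < T i i := fun i => by
    have hne := InnerProductSpace.gramSchmidt_ne_zero i hv
    have h1 : inner ℝ (InnerProductSpace.gramSchmidt ℝ v i) (v i) =
        ‖InnerProductSpace.gramSchmidt ℝ v i‖ ^ 2 := by
      conv_lhs => rw [InnerProductSpace.gramSchmidt_def' ℝ v i]
      rw [inner_add_right, real_inner_self_eq_norm_sq, inner_sum, Finset.sum_eq_zero, add_zero]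
      intro j hj
      rw [Submodule.starProjection_singleton, inner_smul_right,
        InnerProductSpace.gramSchmidt_orthogonal ℝ v (Finset.mem_Iio.1 hj).ne', mul_zero]
    simp only [hT, Matrix.of_apply, he, InnerProductSpace.gramSchmidtNormed, inner_smul_left, h1]
    have := norm_pos_iff.2 hne
    simp only [conj_trivial, RCLike.ofReal_real_eq_id, id]
    positivity
  have hdet : 0 < T.det := by
    rw [Matrix.det_of_isUpperTriangular (M := T) (fun j i hij => htri j i hij)]
    exact Finset.prod_pos fun i _ => hdiag i
  have hgram : (Matrix.gram ℝ v) = T.transpose * T := by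
    ext i k
    rw [Matrix.gram_apply, Matrix.mul_apply]
    conv_lhs => rw [hvi i, hvi k]
    rw [heo.inner_sum]
    simp
  have hn : (frameMap v).toLinearMap.normDet = T.det := by
    have h := normDet_comp_frameMap (ContinuousLinearMap.id ℝ (Euc N)) v
    rw [ContinuousLinearMap.id_comp] at h
    simp only [ContinuousLinearMap.id_apply] at h
    rw [h, hgram, Matrix.det_mul, Matrix.det_transpose, Real.sqrt_mul_self hdet.le]
  rw [hn]
  have hb := AlternatingMap.eq_smul_basis_det (EuclideanSpace.basisFun (Fin n) ℝ).toBasis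
    (α.toAlternatingMap.compLinearMap (frameMap e).toLinearMap)
  have hb2 := congrArg (fun g : AlternatingMap ℝ (Euc n) ℝ (Fin n) =>
    g fun i => WithLp.toLp 2 fun j => T j i) hb
  simp only [AlternatingMap.compLinearMap_apply, AlternatingMap.smul_apply] at hb2
  have h1 : (fun i => (frameMap e).toLinearMap (WithLp.toLp 2 fun j => T j i)) = v := by
    ext1 i
    simp only [ContinuousLinearMap.coe_coe]
    rw [frameMap_apply, hvi i]
  have h2 : (fun i => (frameMap e).toLinearMap ((EuclideanSpace.basisFun (Fin n) ℝ).toBasis i)) = e := by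
    ext1 i
    simp [frameMap_single]
  rw [h1, h2] at hb2
  have h3 : ((EuclideanSpace.basisFun (Fin n) ℝ).toBasis.det fun i => WithLp.toLp 2 fun j => T j i) =
      T.det := by
    rw [Basis.det_apply]
    congr 1
  rw [h3, smul_eq_mul, mul_comm] at hb2
  exact hb2

/-- The Hausdorff measure of the image of the unit ball is computed from the volume factor and
estimated from the Lipschitz bound. -/
theorem normDet_le_of_norm_le {A : Euc n →L[ℝ] Euc N} (hA : ‖A‖₊ ≤ K) :
    ENNReal.ofReal A.toLinearMap.normDet ≤ (K : ℝ≥0∞) ^ n := by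
  have h1 := euclideanHausdorffMeasure_linear_image A.toLinearMap (Metric.ball 0 1)
  have h2 := euclideanHausdorffMeasure_image_le_of_lipschitzOnWith n
    ((A.lipschitz.weaken hA).lipschitzOnWith (s := Metric.ball 0 1))
  have h3 : (μHE[n] : Measure (Euc N)) (A '' Metric.ball 0 1) = _ := h1
  rw [h3, EuclideanSpace.euclideanHausdorffMeasure_eq_volume] at h2
  exact (ENNReal.mul_le_mul_iff_left (Metric.measure_ball_pos volume 0 one_pos).ne'
    measure_ball_lt_top.ne).1 h2

namespace RectifiableCurrent

variable (C : RectifiableCurrent N n)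

theorem isLocallyFiniteMeasure_restrict_carrier :
    IsLocallyFiniteMeasure ((μHE[n] : Measure (Euc N)).restrict C.carrier) := by
  refine ⟨fun X => ⟨Metric.closedBall X 1, Metric.closedBall_mem_nhds X one_pos, ?_⟩⟩
  rw [Measure.restrict_apply Metric.isClosed_closedBall.measurableSet, inter_comm]
  refine lt_of_le_of_lt ?_ (C.mult_locInt _ (isCompact_closedBall X 1))
  rw [← setLIntegral_one]
  refine lintegral_mono_ae ?_
  filter_upwards [ae_restrict_mem₀ (C.carrier_meas.inter
    Metric.isClosed_closedBall.measurableSet.nullMeasurableSet)] with Y hY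
  exact_mod_cast C.mult_pos Y hY.1

/-- A Borel representative of the orientation of a current. -/
def borelFrame : Euc N → Fin n → Euc N := C.frame_meas.mk _

theorem borelFrame_ae_eq :
    C.frame =ᵐ[(μHE[n] : Measure (Euc N)).restrict C.carrier] C.borelFrame := C.frame_meas.ae_eq_mk

theorem isTangentFrame : IsTangentFrame C.carrier C.borelFrame where
  nullMeasurableSet := C.carrier_meas
  rectifiable := C.carrier_rect
  locallyFinite := C.isLocallyFiniteMeasure_restrict_carrier
  measurable := C.frame_meas.measurable_mk
  tangent := by
    filter_upwards [C.frame_tangent, C.borelFrame_ae_eq] with X h1 h2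
    rwa [← h2]

/-- The orientation of the push-forward of a current. -/
def pushforwardFrame (Φ : Euc N ≃ₜ Euc N) (Z : Euc N) : Fin n → Euc N :=
  InnerProductSpace.gramSchmidtNormed ℝ fun i =>
    fderiv ℝ Φ (Φ.symm Z) (C.borelFrame (Φ.symm Z) i)

theorem lintegral_image (hΦ : IsBilipschitzDiffeo K Φ) {B : Set (Euc N)} (hB : MeasurableSet B)
    (g : Euc N → ℝ≥0∞) :
    ∫⁻ Z in Φ '' C.carrier ∩ B, g Z ∂(μHE[n] : Measure (Euc N)) =
      ∫⁻ X in C.carrier ∩ Φ ⁻¹' B, ENNReal.ofReal (frameJacobian Φ C.borelFrame X) * g (Φ X) ∂μHE[n] := by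
  have hJ : Measurable fun X => ENNReal.ofReal (frameJacobian Φ C.borelFrame X) :=
    ENNReal.measurable_ofReal.comp (measurable_frameJacobian Φ C.isTangentFrame.measurable)
  rw [inter_comm, ← Measure.restrict_restrict hB, C.isTangentFrame.restrict_image hΦ,
    Φ.measurableEmbedding.restrict_map, Φ.measurableEmbedding.lintegral_map,
    setLIntegral_withDensity_eq_setLIntegral_mul_non_measurable _ hJ _ (Φ.measurable hB)
      (Eventually.of_forall fun _ => ENNReal.ofReal_lt_top),
    Measure.restrict_restrict (Φ.measurable hB), inter_comm]
  rfl

theorem ae_image_iff (hΦ : IsBilipschitzDiffeo K Φ) {p : Euc N → Prop}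
    (h : ∀ᵐ X ∂(μHE[n] : Measure (Euc N)).restrict C.carrier, p (Φ X)) :
    ∀ᵐ Z ∂(μHE[n] : Measure (Euc N)).restrict (Φ '' C.carrier), p Z := by
  rw [C.isTangentFrame.restrict_image hΦ, Φ.measurableEmbedding.ae_map_iff]
  exact withDensity_absolutelyContinuous _ _ h

theorem linearIndependent_image (hΦ : IsBilipschitzDiffeo K Φ) {X : Euc N} {v : Fin n → Euc N}
    (hv : Orthonormal ℝ v) : LinearIndependent ℝ fun i => fderiv ℝ Φ X (v i) :=
  hv.linearIndependent.map' (fderiv ℝ Φ X).toLinearMap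
    (LinearMap.ker_eq_bot.2 (hΦ.injective_fderiv X))

theorem span_pushforwardFrame (X : Euc N) :
    Submodule.span ℝ (range (C.pushforwardFrame Φ (Φ X))) =
      LinearMap.range (fderiv ℝ Φ X ∘L frameMap (C.borelFrame X)).toLinearMap := by
  rw [pushforwardFrame, InnerProductSpace.span_gramSchmidtNormed_range,
    InnerProductSpace.span_gramSchmidt, Φ.symm_apply_apply, ContinuousLinearMap.toLinearMap_comp,
    LinearMap.range_comp, range_frameMap, Submodule.map_span, ← range_comp]
  rfl

/-- The push-forward of a rectifiable current by a diffeomorphism. -/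
def pushforward (hΦ : IsBilipschitzDiffeo K Φ) : RectifiableCurrent N n where
  carrier := Φ '' C.carrier
  mult := fun Z => C.mult (Φ.symm Z)
  frame := C.pushforwardFrame Φ
  carrier_meas := by
    obtain ⟨M₀, hM₀s, hM₀m, hM₀⟩ := C.carrier_meas.exists_measurable_subset_ae_eq
    have h1 : MeasurableSet (Φ '' M₀) := Φ.measurableEmbedding.measurableSet_image.2 hM₀m
    refine h1.nullMeasurableSet.congr ?_
    refine (image_mono hM₀s).eventuallyLE.antisymm (ae_le_set.2 ?_)
    rw [← image_sdiff Φ.injective]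
    have := euclideanHausdorffMeasure_image_le_of_lipschitzOnWith n
      (hΦ.lipschitz.lipschitzOnWith (s := C.carrier \ M₀))
    rw [ae_le_set.1 hM₀.symm.le, mul_zero] at this
    exact le_antisymm this zero_le
  carrier_rect := by
    obtain ⟨F, hF, hFM⟩ := C.carrier_rect
    refine ⟨fun j => Φ ∘ F j, fun j => ?_, ?_⟩
    · obtain ⟨K', hK'⟩ := hF j
      exact ⟨_, hΦ.lipschitz.comp hK'⟩
    · have : Φ '' C.carrier \ ⋃ j, range (Φ ∘ F j) = Φ '' (C.carrier \ ⋃ j, range (F j)) := by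
        rw [image_sdiff Φ.injective, image_iUnion]
        simp_rw [range_comp]
      rw [this]
      have := euclideanHausdorffMeasure_image_le_of_lipschitzOnWith n
        (hΦ.lipschitz.lipschitzOnWith (s := C.carrier \ ⋃ j, range (F j)))
      rw [hFM, mul_zero] at this
      exact le_antisymm this zero_le
  mult_meas := by
    rw [C.isTangentFrame.restrict_image hΦ, Φ.measurableEmbedding.aemeasurable_map_iff]
    have : (fun Z => C.mult (Φ.symm Z)) ∘ Φ = C.mult := by
      ext X; simp
    rw [this]
    exact C.mult_meas.mono_ac (withDensity_absolutelyContinuous _ _)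
  mult_pos := by
    rintro _ ⟨X, hX, rfl⟩
    simpa using C.mult_pos X hX
  mult_locInt := by
    intro k hk
    rw [C.lintegral_image hΦ hk.measurableSet]
    have hk' : IsCompact (Φ ⁻¹' k) := Φ.isCompact_preimage.2 hk
    refine lt_of_le_of_lt (b := ∫⁻ X in C.carrier ∩ Φ ⁻¹' k, (K : ℝ≥0∞) ^ n * C.mult X ∂μHE[n]) ?_ ?_
    · refine lintegral_mono_ae ?_
      filter_upwards [ae_mono (Measure.restrict_mono inter_subset_left le_rfl)
        C.isTangentFrame.tangent] with X hX
      rw [Φ.symm_apply_apply]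
      gcongr
      refine normDet_le_of_norm_le ?_
      rw [← NNReal.coe_le_coe, coe_nnnorm]
      refine ContinuousLinearMap.opNorm_le_bound _ K.2 fun y => ?_
      have h1 : ‖fderiv ℝ Φ X‖ ≤ K := norm_fderiv_le_of_lipschitz ℝ hΦ.lipschitz
      have h2 : ‖frameMap (C.borelFrame X) y‖ = ‖y‖ := by
        have h3 := hX.1.inner_sum (fun i => y i) (fun i => y i) Finset.univ
        rw [← frameMap_apply, real_inner_self_eq_norm_sq] at h3
        rw [← sq_eq_sq₀ (norm_nonneg _) (norm_nonneg _), h3, EuclideanSpace.norm_sq_eq]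
        refine Finset.sum_congr rfl fun i _ => ?_
        simp [sq]
      calc ‖fderiv ℝ Φ X (frameMap (C.borelFrame X) y)‖
          ≤ ‖fderiv ℝ Φ X‖ * ‖frameMap (C.borelFrame X) y‖ := ContinuousLinearMap.le_opNorm _ _
        _ ≤ K * ‖y‖ := by rw [h2]; gcongr
    · have hm : AEMeasurable (fun X => (C.mult X : ℝ≥0∞))
          ((μHE[n] : Measure (Euc N)).restrict (C.carrier ∩ Φ ⁻¹' k)) :=
        (measurable_from_top.comp_aemeasurable C.mult_meas).mono_measure
          (Measure.restrict_mono inter_subset_left le_rfl)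
      rw [lintegral_const_mul'' _ hm]
      exact ENNReal.mul_lt_top (by simp) (C.mult_locInt _ hk')
  frame_meas := by
    refine Measurable.aemeasurable ?_
    refine measurable_gramSchmidtNormed.comp (measurable_pi_iff.2 fun i => ?_)
    have hc : Continuous fun p : (Euc N →L[ℝ] Euc N) × Euc N => p.1 p.2 := by fun_prop
    have hτ : Measurable fun X => C.borelFrame X i :=
      (measurable_pi_apply i).comp C.isTangentFrame.measurable
    have h := (hc.measurable.comp ((measurable_fderiv ℝ Φ).prodMk hτ)).comp Φ.symm.measurable
    exact h
  frame_tangent := by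
    refine C.ae_image_iff hΦ ?_
    filter_upwards [C.isTangentFrame.ae_isApproxTangentPlane_image hΦ] with X hX
    refine ⟨InnerProductSpace.gramSchmidtNormed_orthonormal ?_, ?_⟩
    · rw [Φ.symm_apply_apply]
      exact linearIndependent_image hΦ hX.1
    · rw [C.span_pushforwardFrame]
      exact hX.2

end RectifiableCurrent

end

/-! ### Pull-back of forms; functional, boundary and mass of a push-forward -/

section

variable {n N : ℕ} {K : ℝ≥0} {Φ : Euc N ≃ₜ Euc N}

/-- The values of an alternating form on tuples of basis vectors. -/
def basisValues (k : ℕ) : (Euc N [⋀^Fin k]→L[ℝ] ℝ) →ₗ[ℝ] ((Fin k → Fin N) → ℝ) where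
  toFun := fun β v => β fun i => EuclideanSpace.basisFun (Fin N) ℝ (v i)
  map_add' := fun _ _ => rfl
  map_smul' := fun _ _ => rfl

theorem basisValues_injective (k : ℕ) : Function.Injective (basisValues (N := N) k) := by
  intro β γ hβγ
  refine ContinuousAlternatingMap.toAlternatingMap_injective ?_
  refine (EuclideanSpace.basisFun (Fin N) ℝ).toBasis.ext_alternating fun v _ => ?_
  have := congrFun hβγ v
  simpa [basisValues] using this

instance finiteDimensional_continuousAlternatingMap (k : ℕ) :
    FiniteDimensional ℝ (Euc N [⋀^Fin k]→L[ℝ] ℝ) :=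
  FiniteDimensional.of_injective _ (basisValues_injective k)

/-- A form-valued map is smooth as soon as its values on all fixed tuples are. -/
theorem contDiff_alternatingMap_of_apply {k : ℕ} {r : WithTop ℕ∞}
    {α : Euc N → Euc N [⋀^Fin k]→L[ℝ] ℝ} (h : ∀ v, ContDiff ℝ r fun X => α X v) :
    ContDiff ℝ r α := by
  obtain ⟨g, hg⟩ := (basisValues k).exists_leftInverse_of_injective
    (LinearMap.ker_eq_bot.2 (basisValues_injective (N := N) k))
  have h1 : ContDiff ℝ r fun X => basisValues k (α X) := contDiff_pi.2 fun v => h _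
  have h2 := (LinearMap.toContinuousLinearMap g).contDiff.comp h1 (n := r)
  convert h2 using 1
  ext1 X
  exact (LinearMap.congr_fun hg (α X)).symm

/-- Expanded in the standard basis, the value is a polynomial in the coordinates of the arguments
whose coefficients are the components of the form. -/
theorem contDiff_alternatingMap_apply {k : ℕ} {r : WithTop ℕ∞}
    {α : Euc N → Euc N [⋀^Fin k]→L[ℝ] ℝ} (hα : ContDiff ℝ r α) {w : Euc N → Fin k → Euc N}
    (hw : ∀ i, ContDiff ℝ r fun X => w X i) : ContDiff ℝ r fun X => α X (w X) := by
  have heq : (fun X => α X (w X)) = fun X => ∑ f : Fin k → Fin N, (∏ i, w X i (f i)) *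
      α X fun i => EuclideanSpace.basisFun (Fin N) ℝ (f i) := by
    ext1 X
    have h1 : w X = fun i => ∑ j, w X i j • EuclideanSpace.basisFun (Fin N) ℝ j := by
      ext1 i
      exact ((EuclideanSpace.basisFun (Fin N) ℝ).sum_repr (w X i)).symm
    conv_lhs => rw [h1]
    rw [ContinuousAlternatingMap.map_sum]
    refine Finset.sum_congr rfl fun f _ => ?_
    exact (α X).toMultilinearMap.map_smul_univ (fun i => w X i (f i)) _
  rw [heq]
  refine ContDiff.sum fun f _ => ContDiff.mul (contDiff_prod fun i _ => ?_) ?_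
  · exact (contDiff_euclidean.1 (hw i)) (f i)
  · exact (ContinuousAlternatingMap.apply ℝ (Euc N) ℝ _).contDiff.comp hα

/-- The pull-back of a test form by a smooth homeomorphism. -/
def TestForm.pullback {k : ℕ} (α : TestForm N k) (Φ : Euc N ≃ₜ Euc N)
    (hΦ : ContDiff ℝ ((⊤ : ℕ∞) : WithTop ℕ∞) Φ) : TestForm N k where
  form := fun X => (α.form (Φ X)).compContinuousLinearMap (fderiv ℝ Φ X)
  smooth := by
    refine contDiff_alternatingMap_of_apply fun v => ?_
    refine contDiff_alternatingMap_apply (α.smooth.comp hΦ) fun i => ?_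
    exact (hΦ.fderiv_right (m := ((⊤ : ℕ∞) : WithTop ℕ∞)) (by simp)).clm_apply contDiff_const
  compact := by
    refine (α.compact.comp_homeomorph Φ).mono fun X hX => ?_
    contrapose! hX
    simp only [Function.mem_support, not_not, Function.comp_apply] at hX
    simp only [Function.mem_support, not_not, hX]
    rfl

theorem TestForm.ext' {k : ℕ} {α β : TestForm N k} (h : ∀ X, α.form X = β.form X) : α = β := by
  cases α; cases β
  congr 1
  exact funext h

theorem TestForm.pullback_d {k : ℕ} (α : TestForm N k) (Φ : Euc N ≃ₜ Euc N)
    (hΦ : ContDiff ℝ ((⊤ : ℕ∞) : WithTop ℕ∞) Φ) : (α.pullback Φ hΦ).d = α.d.pullback Φ hΦ := by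
  refine TestForm.ext' fun X => ?_
  refine extDeriv_pullback (α.smooth.differentiable (by simp)).differentiableAt
    (hΦ.contDiffAt (x := X)) ?_
  rw [minSmoothness_of_isRCLikeNormedField]
  exact WithTop.coe_le_coe.2 le_top

namespace RectifiableCurrent

variable (C : RectifiableCurrent N n)

theorem toFunctional_eq_borelFrame (α : TestForm N n) : C.toFunctional α =
    ∫ X in C.carrier, α.form X (C.borelFrame X) * (C.mult X : ℝ) ∂μHE[n] := by
  refine integral_congr_ae ?_
  filter_upwards [C.borelFrame_ae_eq] with X hX
  rw [hX]

/-- The Jacobian from the change of variables is exactly the factor relating a form on the image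
frame dΦ(τ) to the same form on its Gram-Schmidt normalization, sign included. -/
theorem pushforward_toFunctional (hΦ : IsBilipschitzDiffeo K Φ)
    (hs : ContDiff ℝ ((⊤ : ℕ∞) : WithTop ℕ∞) Φ) (α : TestForm N n) :
    (C.pushforward hΦ).toFunctional α = C.toFunctional (α.pullback Φ hs) := by
  rw [C.toFunctional_eq_borelFrame]
  refine (C.isTangentFrame.setIntegral_image hΦ _).trans ?_
  refine integral_congr_ae ?_
  filter_upwards [C.isTangentFrame.tangent] with X hX
  have h := alternatingMap_eq_normDet_mul_gramSchmidtNormed (α.form (Φ X))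
    (linearIndependent_image hΦ (X := X) hX.1)
  have h2 : frameMap (fun i => fderiv ℝ Φ X (C.borelFrame X i)) =
      fderiv ℝ Φ X ∘L frameMap (C.borelFrame X) := by
    ext1 y
    simp [frameMap_apply]
  rw [h2] at h
  simp only [pushforward, pushforwardFrame, Φ.symm_apply_apply, frameJacobian]
  rw [← mul_assoc, ← h]
  rfl

theorem boundary_pushforward {n : ℕ} (C : RectifiableCurrent N (n + 1))
    (hΦ : IsBilipschitzDiffeo K Φ)
    (hs : ContDiff ℝ ((⊤ : ℕ∞) : WithTop ℕ∞) Φ) (hC : C.toFunctional.boundary = 0) :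
    (C.pushforward hΦ).toFunctional.boundary = 0 := by
  ext α
  change (C.pushforward hΦ).toFunctional α.d = 0
  rw [C.pushforward_toFunctional hΦ hs, ← TestForm.pullback_d]
  exact congrFun hC (α.pullback Φ hs)

theorem mult_aemeasurable : AEMeasurable (fun X => (C.mult X : ℝ≥0∞))
    ((μHE[n] : Measure (Euc N)).restrict C.carrier) :=
  measurable_from_top.comp_aemeasurable C.mult_meas

theorem mass_apply {W : Set (Euc N)} (hW : MeasurableSet W) :
    C.mass W = ∫⁻ X in C.carrier ∩ W, (C.mult X : ℝ≥0∞) ∂μHE[n] := by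
  rw [mass, withDensity_apply _ hW, Measure.restrict_restrict hW, inter_comm]

instance : IsLocallyFiniteMeasure C.mass := by
  refine ⟨fun X => ⟨Metric.closedBall X 1, Metric.closedBall_mem_nhds X one_pos, ?_⟩⟩
  rw [C.mass_apply Metric.isClosed_closedBall.measurableSet]
  exact C.mult_locInt _ (isCompact_closedBall X 1)

theorem mass_absolutelyContinuous :
    C.mass ≪ (μHE[n] : Measure (Euc N)).restrict C.carrier :=
  withDensity_absolutelyContinuous _ _

theorem pushforward_mass (hΦ : IsBilipschitzDiffeo K Φ) {W : Set (Euc N)} (hW : MeasurableSet W) :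
    (C.pushforward hΦ).mass W =
      ∫⁻ X in Φ ⁻¹' W, ENNReal.ofReal (frameJacobian Φ C.borelFrame X) ∂C.mass := by
  have hW' := Φ.measurable hW
  rw [mass_apply _ hW]
  refine (C.lintegral_image hΦ hW _).trans ?_
  rw [mass, restrict_withDensity hW', Measure.restrict_restrict hW', inter_comm,
    lintegral_withDensity_eq_lintegral_mul_non_measurable₀ _ (C.mult_aemeasurable.mono_measure
      (Measure.restrict_mono inter_subset_right le_rfl))
      (Eventually.of_forall fun _ => ENNReal.natCast_lt_top _)]
  refine lintegral_congr fun X => ?_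
  simp [pushforward, mul_comm]

/-- Integration against the current in terms of the mass measure. -/
theorem toFunctional_eq_integral_mass (α : TestForm N n) : C.toFunctional α =
    ∫ X, α.form X (C.borelFrame X) ∂C.mass := by
  rw [toFunctional_eq_borelFrame, mass]
  have h : (fun X => (C.mult X : ℝ≥0∞)) = fun X => (((fun m : ℕ => (m : ℝ≥0)) ∘ C.mult) X : ℝ≥0∞) := by
    ext X; simp
  rw [h, integral_withDensity_eq_integral_smul₀
    ((measurable_from_top (f := fun m : ℕ => (m : ℝ≥0))).comp_aemeasurable C.mult_meas)]
  refine integral_congr_ae (Eventually.of_forall fun X => ?_)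
  simp [NNReal.smul_def, mul_comm]

end RectifiableCurrent

end

/-! ### The first variation inequality -/

section

variable {n N : ℕ} {K : ℝ≥0} {Φ : Euc N ≃ₜ Euc N}

/-- Each eigenvalue satisfies 0 ≤ λ ≤ exp(λ - 1). This bounds the Jacobian to first order without
expanding a determinant. -/
theorem det_le_exp_trace_sub_card {ι : Type*} [Fintype ι] [DecidableEq ι] {G : Matrix ι ι ℝ}
    (hG : G.PosSemidef) : G.det ≤ Real.exp (G.trace - Fintype.card ι) := by
  rw [hG.isHermitian.det_eq_prod_eigenvalues, hG.isHermitian.trace_eq_sum_eigenvalues]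
  have h : (∑ i, ((hG.isHermitian.eigenvalues i : ℝ) : ℝ)) - Fintype.card ι =
      ∑ i, (hG.isHermitian.eigenvalues i - 1) := by
    simp [Finset.sum_sub_distrib]
  simp only [RCLike.ofReal_real_eq_id, id]
  rw [h, Real.exp_sum]
  refine Finset.prod_le_prod (fun i _ => hG.eigenvalues_nonneg i) fun i _ => ?_
  have := Real.add_one_le_exp (hG.isHermitian.eigenvalues i - 1)
  linarith

/-- The perturbation s Y has Lipschitz constant at most 1/2, so the map is a global homeomorphism
that changes distances by factors between 1/2 and 3/2; hence the constant 2. -/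
theorem exists_homeomorph_add_smul {Y : Euc N → Euc N} {L : ℝ≥0} (hY : Differentiable ℝ Y)
    (hL : LipschitzWith L Y) {s : ℝ} (hs : 0 ≤ s) (hsL : s * L ≤ 1 / 2) :
    ∃ Φ : Euc N ≃ₜ Euc N, (∀ X, Φ X = X + s • Y X) ∧ IsBilipschitzDiffeo 2 Φ := by
  have hdiff : ∀ X Z, ‖s • Y X - s • Y Z‖ ≤ 1 / 2 * ‖X - Z‖ := fun X Z => by
    rw [← smul_sub, norm_smul, Real.norm_of_nonneg hs]
    have := hL.norm_sub_le X Z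
    calc s * ‖Y X - Y Z‖ ≤ s * (L * ‖X - Z‖) := by gcongr
      _ = s * L * ‖X - Z‖ := by ring
      _ ≤ _ := by gcongr
  have happ : ApproximatesLinearOn (fun X => X + s • Y X)
      ((ContinuousLinearEquiv.refl ℝ (Euc N) : Euc N ≃L[ℝ] Euc N) : Euc N →L[ℝ] Euc N) univ (1 / 2) := by
    intro X _ Z _
    simp only [ContinuousLinearEquiv.coe_refl, ContinuousLinearMap.coe_id', id]
    have := hdiff X Z
    have h2 : X + s • Y X - (Z + s • Y Z) - (X - Z) = s • Y X - s • Y Z := by abel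
    rw [h2]
    simpa using this
  have hc : Subsingleton (Euc N) ∨ (1 / 2 : ℝ≥0) <
      ‖((ContinuousLinearEquiv.refl ℝ (Euc N)).symm : Euc N →L[ℝ] Euc N)‖₊⁻¹ := by
    rcases subsingleton_or_nontrivial (Euc N) with h | h
    · exact Or.inl h
    · right
      have : ‖((ContinuousLinearEquiv.refl ℝ (Euc N)).symm : Euc N →L[ℝ] Euc N)‖₊ = 1 := by
        rw [← NNReal.coe_inj, coe_nnnorm]
        exact ContinuousLinearMap.norm_id
      rw [this, inv_one]
      exact NNReal.half_lt_self one_ne_zero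
  refine ⟨happ.toHomeomorph _ hc, fun X => rfl, ?_⟩
  have hΦ : ⇑(happ.toHomeomorph _ hc) = fun X => X + s • Y X := rfl
  have hder : ∀ X, HasFDerivAt (fun X => X + s • Y X)
      (ContinuousLinearMap.id ℝ (Euc N) + s • fderiv ℝ Y X) X := fun X =>
    (hasFDerivAt_id X).add ((hY X).hasFDerivAt.const_smul s)
  refine ⟨?_, ?_, ?_, ?_⟩
  · rw [hΦ]
    exact fun X => (hder X).differentiableAt
  · rw [hΦ]
    refine LipschitzWith.of_dist_le_mul fun X Z => ?_
    rw [dist_eq_norm, dist_eq_norm]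
    have h2 : X + s • Y X - (Z + s • Y Z) = (X - Z) + (s • Y X - s • Y Z) := by abel
    rw [h2]
    refine (norm_add_le _ _).trans ?_
    have := hdiff X Z
    have h3 := norm_nonneg (X - Z)
    simp only [NNReal.coe_ofNat]
    linarith
  · rw [hΦ]
    refine AntilipschitzWith.of_le_mul_dist fun X Z => ?_
    rw [dist_eq_norm, dist_eq_norm]
    have h2 : X - Z = (X + s • Y X - (Z + s • Y Z)) - (s • Y X - s • Y Z) := by abel
    have h4 : ‖X - Z‖ ≤ ‖X + s • Y X - (Z + s • Y Z)‖ + ‖s • Y X - s • Y Z‖ := by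
      conv_lhs => rw [h2]
      exact norm_sub_le _ _
    have := hdiff X Z
    simp only [NNReal.coe_ofNat]
    linarith
  · intro X v
    rw [hΦ, (hder X).fderiv]
    have h1 : ‖s • fderiv ℝ Y X v‖ ≤ 1 / 2 * ‖v‖ := by
      rw [norm_smul, Real.norm_of_nonneg hs]
      have h5 : ‖fderiv ℝ Y X v‖ ≤ L * ‖v‖ := (ContinuousLinearMap.le_opNorm _ _).trans
        (by gcongr; exact norm_fderiv_le_of_lipschitz ℝ hL)
      calc s * ‖fderiv ℝ Y X v‖ ≤ s * (L * ‖v‖) := by gcongr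
        _ = s * L * ‖v‖ := by ring
        _ ≤ _ := by gcongr
    have h2 : v = (v + s • fderiv ℝ Y X v) - s • fderiv ℝ Y X v := by abel
    have h4 : ‖v‖ ≤ ‖v + s • fderiv ℝ Y X v‖ + ‖s • fderiv ℝ Y X v‖ := by
      conv_lhs => rw [h2]
      exact norm_sub_le _ _
    simp only [add_apply, ContinuousLinearMap.id_apply,
      smul_apply, NNReal.coe_ofNat]
    linarith

/-- The Gram matrix of the vectors τᵢ + s DY τᵢ has trace n + 2s div Y + s² Σ|DY τᵢ|², and the
square root in the Jacobian halves the exponent. An upper bound suffices, because minimality bounds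
the mass of the competitor from below. -/
theorem frameJacobian_le_exp {Y : Euc N → Euc N} {L : ℝ≥0} (hY : Differentiable ℝ Y)
    (hL : LipschitzWith L Y) {s : ℝ} {Φ : Euc N → Euc N} (hΦ : ∀ X, Φ X = X + s • Y X)
    {τ : Euc N → Fin n → Euc N} {X : Euc N} (hτ : Orthonormal ℝ (τ X)) :
    frameJacobian Φ τ X ≤
      Real.exp (s * ∑ i, inner ℝ (τ X i) (fderiv ℝ Y X (τ X i)) + s ^ 2 * (n * L ^ 2 / 2)) := by
  have hder : fderiv ℝ Φ X = ContinuousLinearMap.id ℝ (Euc N) + s • fderiv ℝ Y X := by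
    rw [funext hΦ]
    exact ((hasFDerivAt_id X).add ((hY X).hasFDerivAt.const_smul s)).fderiv
  rw [frameJacobian, normDet_comp_frameMap, hder]
  simp only [add_apply, ContinuousLinearMap.id_apply,
      smul_apply]
  set w : Fin n → Euc N := fun i => τ X i + s • fderiv ℝ Y X (τ X i)
  have h1 := det_le_exp_trace_sub_card (Matrix.posSemidef_gram ℝ w)
  have h2 : (Matrix.gram ℝ w).trace - Fintype.card (Fin n) ≤
      2 * (s * ∑ i, inner ℝ (τ X i) (fderiv ℝ Y X (τ X i)) + s ^ 2 * (n * L ^ 2 / 2)) := by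
    have h3 : ∀ i, ‖w i‖ ^ 2 ≤
        1 + 2 * s * inner ℝ (τ X i) (fderiv ℝ Y X (τ X i)) + s ^ 2 * L ^ 2 := by
      intro i
      have h5 : ‖fderiv ℝ Y X (τ X i)‖ ≤ L := by
        refine (ContinuousLinearMap.le_opNorm _ _).trans ?_
        rw [hτ.1 i, mul_one]
        exact norm_fderiv_le_of_lipschitz ℝ hL
      simp only [w]
      rw [norm_add_sq_real, hτ.1 i, inner_smul_right, norm_smul, mul_pow, Real.norm_eq_abs, sq_abs]
      have : ‖fderiv ℝ Y X (τ X i)‖ ^ 2 ≤ L ^ 2 := by gcongr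
      nlinarith [mul_le_mul_of_nonneg_left this (sq_nonneg s)]
    have h4 : (Matrix.gram ℝ w).trace = ∑ i, ‖w i‖ ^ 2 := by
      simp [Matrix.trace, Matrix.gram_apply]
    rw [h4]
    have := Finset.sum_le_sum fun i (_ : i ∈ Finset.univ) => h3 i
    simp only [Finset.sum_add_distrib, ← Finset.mul_sum, Finset.sum_const, Finset.card_univ,
      Fintype.card_fin, nsmul_eq_mul] at this ⊢
    linarith
  refine Real.sqrt_le_iff.2 ⟨(Real.exp_pos _).le, h1.trans ?_⟩
  rw [sq, ← Real.exp_add]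
  exact Real.exp_le_exp.2 (h2.trans (le_of_eq (by ring)))

theorem preimage_eq_of_tsupport_subset {Y : Euc N → Euc N} {s : ℝ} {Φ : Euc N ≃ₜ Euc N}
    (hΦ : ∀ X, Φ X = X + s • Y X) {W : Set (Euc N)} (hW : tsupport Y ⊆ W) : Φ ⁻¹' W = W := by
  have hfix : ∀ X, X ∉ W → Φ X = X := fun X hX => by
    rw [hΦ, image_eq_zero_of_notMem_tsupport (fun h => hX (hW h)), smul_zero, add_zero]
  ext X
  constructor
  · intro h
    by_contra hX
    exact hX (by rwa [mem_preimage, hfix X hX] at h)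
  · intro h
    by_contra hX
    have := Φ.injective (hfix _ hX)
    exact hX (by rwa [mem_preimage, this])

namespace RectifiableCurrent

theorem spt_pushforward_sub_subset (C : RectifiableCurrent N n) {Y : Euc N → Euc N} {s : ℝ}
    (hs : ContDiff ℝ ((⊤ : ℕ∞) : WithTop ℕ∞) Φ) (hΦ : ∀ X, Φ X = X + s • Y X)
    (hb : IsBilipschitzDiffeo K Φ) :
    ((C.pushforward hb).toFunctional - C.toFunctional).spt ⊆ tsupport Y := by
  intro X hX
  by_contra hXY
  obtain ⟨α, hα, hne⟩ := hX (tsupport Y)ᶜ (isClosed_tsupport Y).isOpen_compl hXY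
  refine hne ?_
  rw [Pi.sub_apply, C.pushforward_toFunctional hb hs, sub_eq_zero]
  congr 1
  refine TestForm.ext' fun Z => ?_
  change (α.form (Φ Z)).compContinuousLinearMap (fderiv ℝ Φ Z) = α.form Z
  by_cases hZ : Z ∈ tsupport Y
  · have h1 : Φ Z ∈ tsupport Y := by
      have := preimage_eq_of_tsupport_subset hΦ (Subset.refl _)
      rw [← this] at hZ
      exact hZ
    rw [image_eq_zero_of_notMem_tsupport (fun h => hα h h1),
      image_eq_zero_of_notMem_tsupport (fun h => hα h hZ)]
    rfl
  · have h1 : ⇑Φ =ᶠ[𝓝 Z] id := by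
      filter_upwards [(isClosed_tsupport Y).isOpen_compl.mem_nhds hZ] with U hU
      rw [hΦ, image_eq_zero_of_notMem_tsupport hU, smul_zero, add_zero, id]
    rw [h1.fderiv_eq, h1.eq_of_nhds, fderiv_id]
    rfl

/-- The divergence of a field along the tangent planes of a current. -/
def tangentDiv (C : RectifiableCurrent N n) (Y : Euc N → Euc N) (X : Euc N) : ℝ :=
  ∑ i, inner ℝ (C.borelFrame X i) (fderiv ℝ Y X (C.borelFrame X i))

theorem measurable_borelFrame (C : RectifiableCurrent N n) (i : Fin n) :
    Measurable fun X => C.borelFrame X i :=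
  (measurable_pi_apply i).comp C.isTangentFrame.measurable

theorem measurable_tangentDiv (C : RectifiableCurrent N n) (Y : Euc N → Euc N) :
    Measurable (C.tangentDiv Y) := by
  refine Finset.measurable_sum _ fun i _ => ?_
  have hc : Continuous fun p : (Euc N →L[ℝ] Euc N) × Euc N => p.1 p.2 := by fun_prop
  exact (C.measurable_borelFrame i).inner
    (hc.measurable.comp ((measurable_fderiv ℝ Y).prodMk (C.measurable_borelFrame i)))

theorem ae_mass_orthonormal (C : RectifiableCurrent N n) :
    ∀ᵐ X ∂C.mass, Orthonormal ℝ (C.borelFrame X) :=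
  C.mass_absolutelyContinuous.ae_le (C.isTangentFrame.tangent.mono fun _ h => h.1)

theorem abs_tangentDiv_le (C : RectifiableCurrent N n) {Y : Euc N → Euc N} {L : ℝ≥0}
    (hL : LipschitzWith L Y) {X : Euc N} (hX : Orthonormal ℝ (C.borelFrame X)) :
    |C.tangentDiv Y X| ≤ n * L := by
  refine (Finset.abs_sum_le_sum_abs _ _).trans ?_
  refine (Finset.sum_le_card_nsmul _ _ (L : ℝ) fun i _ => ?_).trans (by simp)
  refine (abs_real_inner_le_norm _ _).trans ?_
  rw [hX.1 i, one_mul]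
  refine (ContinuousLinearMap.le_opNorm _ _).trans ?_
  rw [hX.1 i, mul_one]
  exact norm_fderiv_le_of_lipschitz ℝ hL

theorem tangentDiv_eq_zero (C : RectifiableCurrent N n) {Y : Euc N → Euc N} {X : Euc N}
    (hX : X ∉ tsupport Y) : C.tangentDiv Y X = 0 := by
  refine Finset.sum_eq_zero fun i _ => ?_
  rw [fderiv_of_notMem_tsupport ℝ hX]
  simp

/-- The first variation of a locally area-minimizing current without boundary is nonnegative
in every direction. -/
theorem integral_tangentDiv_nonneg {n : ℕ} (C : RectifiableCurrent N (n + 1))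
    (hC : C.LocallyAreaMinimizing) (hC0 : C.toFunctional.boundary = 0) {Y : Euc N → Euc N}
    (hY : ContDiff ℝ ((⊤ : ℕ∞) : WithTop ℕ∞) Y) (hYc : HasCompactSupport Y) :
    0 ≤ ∫ X, C.tangentDiv Y X ∂C.mass := by
  have hYd : Differentiable ℝ Y := hY.differentiable (by simp)
  obtain ⟨L, hL⟩ := hY.lipschitzWith_of_hasCompactSupport hYc (by simp)
  obtain ⟨R, hR⟩ := hYc.isCompact.isBounded.subset_ball 0
  set W : Set (Euc N) := Metric.ball 0 R with hW
  have hWm : MeasurableSet W := Metric.isOpen_ball.measurableSet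
  have hWc : IsCompact (closure W) := Metric.isBounded_ball.isCompact_closure
  have hWf : C.mass W < ⊤ := (measure_mono subset_closure).trans_lt hWc.measure_lt_top
  have : IsFiniteMeasure (C.mass.restrict W) := ⟨by simpa using hWf⟩
  have hdi : Integrable (C.tangentDiv Y) (C.mass.restrict W) := by
    refine Integrable.of_bound (C.measurable_tangentDiv Y).aestronglyMeasurable (((n + 1 : ℕ) : ℝ) * L) ?_
    filter_upwards [ae_restrict_of_ae C.ae_mass_orthonormal] with X hX
    exact C.abs_tangentDiv_le hL hX
  have hrestr : ∫ X, C.tangentDiv Y X ∂C.mass = ∫ X in W, C.tangentDiv Y X ∂C.mass := by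
    refine (setIntegral_eq_integral_of_forall_compl_eq_zero fun X hX => ?_).symm
    exact C.tangentDiv_eq_zero fun h => hX (hR h)
  rw [hrestr]
  set I := ∫ X in W, C.tangentDiv Y X ∂C.mass with hI
  set m := C.mass.real W with hm
  set D : ℝ := ((n + 1 : ℕ) : ℝ) * L with hD
  have hD0 : 0 ≤ D := by positivity
  set B : ℝ := ((n + 1 : ℕ) : ℝ) * L ^ 2 / 2 with hB
  have hB0 : 0 ≤ B := by positivity
  -- Minimality against the push-forward by id + s Y, divided by s. The Jacobian is at most exp u
  -- with u = s div Y + s² B and |u| ≤ s(D + s B) ≤ 1; then exp u ≤ 1 + u + u² leaves an error of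
  -- order s².
  have key : ∀ s : ℝ, 0 < s → s * L ≤ 1 / 2 → s * (D + s * B) ≤ 1 →
      0 ≤ I + s * (B + (D + s * B) ^ 2) * m := by
    intro s hs hsL hs1
    obtain ⟨Φ, hΦ, hb⟩ := exists_homeomorph_add_smul hYd hL hs.le hsL
    have hΦs : ContDiff ℝ ((⊤ : ℕ∞) : WithTop ℕ∞) Φ := by
      rw [funext hΦ]
      exact contDiff_id.add (hY.const_smul s)
    have h1 := hC W Metric.isOpen_ball hWc (C.pushforward hb)
      ((C.boundary_pushforward hb hΦs hC0).trans hC0.symm)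
      ((C.spt_pushforward_sub_subset hΦs hΦ hb).trans hR)
    rw [C.pushforward_mass hb hWm, preimage_eq_of_tsupport_subset hΦ hR] at h1
    have h2 : ∫⁻ X in W, ENNReal.ofReal (frameJacobian Φ C.borelFrame X) ∂C.mass ≤
        ∫⁻ X in W, ENNReal.ofReal
          (1 + (s * C.tangentDiv Y X + s ^ 2 * (B + (D + s * B) ^ 2))) ∂C.mass := by
      refine lintegral_mono_ae ?_
      filter_upwards [ae_restrict_of_ae C.ae_mass_orthonormal] with X hX
      refine ENNReal.ofReal_le_ofReal ?_
      refine (frameJacobian_le_exp hYd hL hΦ hX).trans ?_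
      have hd := C.abs_tangentDiv_le hL hX
      change Real.exp (s * C.tangentDiv Y X + s ^ 2 * B) ≤ _
      set u := s * C.tangentDiv Y X + s ^ 2 * B with hu
      have hu1 : |u| ≤ s * (D + s * B) := by
        have : |u| ≤ |s * C.tangentDiv Y X| + |s ^ 2 * B| := abs_add_le _ _
        rw [abs_mul, abs_of_pos hs, abs_of_nonneg (by positivity : 0 ≤ s ^ 2 * B)] at this
        nlinarith [mul_le_mul_of_nonneg_left hd hs.le]
      have h3 := Real.abs_exp_sub_one_sub_id_le (hu1.trans hs1)
      have h4 : u ^ 2 ≤ (s * (D + s * B)) ^ 2 := sq_le_sq' (by linarith [abs_le.1 hu1]) (abs_le.1 hu1).2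
      have h5 := (abs_le.1 h3).2
      nlinarith
    have hint : Integrable (fun X => s * C.tangentDiv Y X + s ^ 2 * (B + (D + s * B) ^ 2))
        (C.mass.restrict W) := (hdi.const_mul s).add (integrable_const _)
    have hint2 : Integrable (fun X => 1 + (s * C.tangentDiv Y X + s ^ 2 * (B + (D + s * B) ^ 2)))
        (C.mass.restrict W) := (integrable_const _).add hint
    have hpos : 0 ≤ᵐ[C.mass.restrict W]
        fun X => 1 + (s * C.tangentDiv Y X + s ^ 2 * (B + (D + s * B) ^ 2)) := by
      filter_upwards [ae_restrict_of_ae C.ae_mass_orthonormal] with X hX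
      have hd := (abs_le.1 (C.abs_tangentDiv_le hL hX)).1
      have : s * (-D) ≤ s * C.tangentDiv Y X := mul_le_mul_of_nonneg_left hd hs.le
      have h6 : 0 ≤ s * (s * B) := by positivity
      have h7 : 0 ≤ s ^ 2 * (B + (D + s * B) ^ 2) := by positivity
      simp only [Pi.zero_apply]
      nlinarith
    have h3 := h1.trans h2
    rw [← ofReal_integral_eq_lintegral_ofReal hint2 hpos, ← ENNReal.ofReal_toReal hWf.ne,
      ENNReal.ofReal_le_ofReal_iff (integral_nonneg_of_ae hpos), integral_add (integrable_const _) hint,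
      integral_add (hdi.const_mul s) (integrable_const _), integral_const_mul] at h3
    simp only [integral_const, smul_eq_mul, mul_one, measureReal_restrict_apply_univ] at h3
    change m ≤ m + (s * I + m * _) at h3
    have h8 : 0 ≤ s * (I + s * (B + (D + s * B) ^ 2) * m) := by nlinarith
    exact nonneg_of_mul_nonneg_right h8 hs
  have hlim : Tendsto (fun s : ℝ => I + s * (B + (D + s * B) ^ 2) * m) (𝓝[>] 0) (𝓝 I) := by
    have hcont : Continuous fun s : ℝ => I + s * (B + (D + s * B) ^ 2) * m := by fun_prop
    have := hcont.tendsto 0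
    simp only [zero_mul, add_zero] at this
    exact this.mono_left nhdsWithin_le_nhds
  refine ge_of_tendsto hlim ?_
  have e1 : ∀ᶠ s : ℝ in 𝓝[>] 0, s * L < 1 / 2 := by
    have hcont : Continuous fun s : ℝ => s * (L : ℝ) := by fun_prop
    exact nhdsWithin_le_nhds (hcont.continuousAt.eventually_lt_const (by norm_num))
  have e2 : ∀ᶠ s : ℝ in 𝓝[>] 0, s * (D + s * B) < 1 := by
    have hcont : Continuous fun s : ℝ => s * (D + s * B) := by fun_prop
    exact nhdsWithin_le_nhds (hcont.continuousAt.eventually_lt_const (by norm_num))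
  filter_upwards [self_mem_nhdsWithin, e1, e2] with s h1 h2 h3
  exact key s h1 h2.le h3.le

end RectifiableCurrent

end

/-! ### A current as a functional: support, mass and carrier -/

section

variable {n N : ℕ} {K : ℝ≥0} {Φ : Euc N ≃ₜ Euc N}

/-- The volume form of a frame: `v ↦ det ⟪τ i, v j⟫`. -/
def frameForm {k : ℕ} (τ : Fin k → Euc N) : Euc N [⋀^Fin k]→L[ℝ] ℝ :=
  { toMultilinearMap := ((Matrix.detRowAlternating (R := ℝ) (n := Fin k)).compLinearMap
      (LinearMap.pi fun i => (innerSL ℝ (τ i)).toLinearMap)).toMultilinearMap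
    cont := by
      change Continuous fun v : Fin k → Euc N => Matrix.det (Matrix.of fun j i => inner ℝ (τ i) (v j))
      refine Continuous.matrix_det (continuous_matrix fun i j => ?_)
      simp only [Matrix.of_apply]
      fun_prop
    map_eq_zero_of_eq' := fun v i j h hij => AlternatingMap.map_eq_zero_of_eq _ v h hij }

theorem frameForm_apply {k : ℕ} (τ v : Fin k → Euc N) :
    frameForm τ v = Matrix.det (Matrix.of fun j i => inner ℝ (τ i) (v j)) := rfl

theorem frameForm_self {k : ℕ} {τ : Fin k → Euc N} (hτ : Orthonormal ℝ τ) :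
    frameForm τ τ = 1 := by
  rw [frameForm_apply]
  have : (Matrix.of fun j i => inner ℝ (τ i) (τ j)) = (1 : Matrix (Fin k) (Fin k) ℝ) := by
    ext j i
    rw [Matrix.of_apply, orthonormal_iff_ite.1 hτ, Matrix.one_apply]
    simp [eq_comm]
  rw [this, Matrix.det_one]

/-- The volume form of τ takes the value 1 on τ, so the basis forms cannot all vanish there.
Finitely many constant forms thus detect every orientation, and only finitely many null sets arise.
-/
theorem Orthonormal.exists_finBasis_ne_zero {k : ℕ} {τ : Fin k → Euc N} (hτ : Orthonormal ℝ τ) :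
    ∃ j, finBasis ℝ (Euc N [⋀^Fin k]→L[ℝ] ℝ) j τ ≠ 0 := by
  by_contra! h
  have h1 := (finBasis ℝ (Euc N [⋀^Fin k]→L[ℝ] ℝ)).sum_repr (frameForm τ)
  have h2 := congrArg (ContinuousAlternatingMap.apply ℝ (Euc N) ℝ τ) h1
  rw [map_sum] at h2
  simp only [map_smul, ContinuousAlternatingMap.apply_apply, h, smul_zero, Finset.sum_const_zero,
    frameForm_self hτ] at h2
  exact one_ne_zero h2.symm

/-- The test form `g ω` for a test function `g` and a constant form `ω`. -/
def TestForm.smulConst {k : ℕ} (g : Euc N → ℝ) (hg : ContDiff ℝ ((⊤ : ℕ∞) : WithTop ℕ∞) g)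
    (hc : HasCompactSupport g) (ω : Euc N [⋀^Fin k]→L[ℝ] ℝ) : TestForm N k where
  form := fun X => g X • ω
  smooth := hg.smul contDiff_const
  compact := hc.smul_right

theorem TestForm.tsupport_smulConst_subset {k : ℕ} (g : Euc N → ℝ)
    (hg : ContDiff ℝ ((⊤ : ℕ∞) : WithTop ℕ∞) g)
    (hc : HasCompactSupport g) (ω : Euc N [⋀^Fin k]→L[ℝ] ℝ) :
    tsupport (TestForm.smulConst g hg hc ω).form ⊆ tsupport g :=
  closure_mono fun X hX => by
    contrapose! hX
    simp only [Function.mem_support, not_not] at hX ⊢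
    simp [TestForm.smulConst, hX]

theorem FormFunctional.isClosed_spt {k : ℕ} (T : FormFunctional N k) : IsClosed T.spt := by
  refine isOpen_compl_iff.1 (isOpen_iff_forall_mem_open.2 fun X hX => ?_)
  simp only [spt, mem_compl_iff, mem_ofPred_eq, not_forall] at hX
  obtain ⟨V, hV, hXV, h⟩ := hX
  exact ⟨V, fun Y hY hY' => h (hY' V hV hY), hV, hXV⟩

theorem continuous_frame_apply (ω : Euc N [⋀^Fin n]→L[ℝ] ℝ) :
    Continuous fun v : Fin n → Euc N => ω v := ω.cont

theorem abs_apply_le_of_orthonormal (ω : Euc N [⋀^Fin n]→L[ℝ] ℝ) {v : Fin n → Euc N}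
    (hv : Orthonormal ℝ v) : ‖ω v‖ ≤ ‖ω‖ := by
  refine (ω.le_opNorm v).trans ?_
  simp [hv.1]

namespace RectifiableCurrent

variable (C : RectifiableCurrent N n)

theorem measurable_apply_borelFrame (ω : Euc N [⋀^Fin n]→L[ℝ] ℝ) :
    Measurable fun X => ω (C.borelFrame X) :=
  (continuous_frame_apply ω).measurable.comp C.isTangentFrame.measurable

theorem locallyIntegrable_apply_borelFrame (ω : Euc N [⋀^Fin n]→L[ℝ] ℝ) :
    LocallyIntegrable (fun X => ω (C.borelFrame X)) C.mass := by
  refine (locallyIntegrable_const ‖ω‖).mono (C.measurable_apply_borelFrame ω).aestronglyMeasurable ?_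
  filter_upwards [C.ae_mass_orthonormal] with X hX
  rw [norm_norm]
  exact abs_apply_le_of_orthonormal ω hX

/-- The mass is concentrated on the support. -/
theorem mass_compl_spt : C.mass C.sptᶜ = 0 := by
  refine measure_null_of_locally_null _ fun X hX => ?_
  have hX' := hX
  simp only [spt, FormFunctional.spt, mem_compl_iff, mem_ofPred_eq, not_forall] at hX'
  obtain ⟨V, hV, hXV, h⟩ := hX'
  refine ⟨V, mem_nhdsWithin_of_mem_nhds (hV.mem_nhds hXV), ?_⟩
  -- Testing with g times a basis form, g supported in V, makes each component of the orientation
  -- vanish almost everywhere on V. An orthonormal frame has some nonzero component, so V is null.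
  have h1 : ∀ j, ∀ᵐ Y ∂C.mass, Y ∈ V →
      finBasis ℝ (Euc N [⋀^Fin n]→L[ℝ] ℝ) j (C.borelFrame Y) = 0 := by
    intro j
    refine hV.ae_eq_zero_of_integral_contDiff_smul_eq_zero
      ((C.locallyIntegrable_apply_borelFrame _).locallyIntegrableOn V) fun g hg hgc hgV => ?_
    by_contra hne
    refine h ⟨TestForm.smulConst g hg hgc (finBasis ℝ (Euc N [⋀^Fin n]→L[ℝ] ℝ) j),
      (TestForm.tsupport_smulConst_subset _ _ _ _).trans hgV, ?_⟩
    rw [C.toFunctional_eq_integral_mass]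
    exact hne
  have h2 : ∀ᵐ Y ∂C.mass, Y ∉ V := by
    filter_upwards [ae_all_iff.2 h1, C.ae_mass_orthonormal] with Y hY hY' hYV
    obtain ⟨j, hj⟩ := Orthonormal.exists_finBasis_ne_zero hY'
    exact hj (hY j hYV)
  simpa [ae_iff] using h2

theorem ae_mem_spt : ∀ᵐ X ∂C.mass, X ∈ C.spt := C.mass_compl_spt

theorem locallyIntegrable_apply_borelFrame_mul_mult (ω : Euc N [⋀^Fin n]→L[ℝ] ℝ) :
    LocallyIntegrable (fun X => ω (C.borelFrame X) * (C.mult X : ℝ))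
      ((μHE[n] : Measure (Euc N)).restrict C.carrier) := by
  intro X
  refine ⟨Metric.closedBall X 1, Metric.closedBall_mem_nhds X one_pos, ?_⟩
  have hm : AEStronglyMeasurable (fun X => ω (C.borelFrame X) * (C.mult X : ℝ))
      ((μHE[n] : Measure (Euc N)).restrict C.carrier) :=
    ((C.measurable_apply_borelFrame ω).aemeasurable.mul
      ((measurable_from_top (f := fun m : ℕ => (m : ℝ))).comp_aemeasurable
        C.mult_meas)).aestronglyMeasurable
  refine ⟨hm.mono_measure Measure.restrict_le_self, ?_⟩
  have hfin := C.mult_locInt _ (isCompact_closedBall X 1)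
  rw [HasFiniteIntegral, Measure.restrict_restrict Metric.isClosed_closedBall.measurableSet, inter_comm]
  refine lt_of_le_of_lt (b := ∫⁻ X in C.carrier ∩ Metric.closedBall X 1,
    ENNReal.ofReal ‖ω‖ * C.mult X ∂μHE[n]) (lintegral_mono_ae ?_) ?_
  · filter_upwards [ae_mono (Measure.restrict_mono inter_subset_left le_rfl)
        C.isTangentFrame.tangent] with Y hY
    rw [enorm_mul]
    gcongr
    · rw [← ofReal_norm]
      exact ENNReal.ofReal_le_ofReal (abs_apply_le_of_orthonormal ω hY.1)
    · rw [← ofReal_norm]; simp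
  · rw [lintegral_const_mul' _ _ ENNReal.ofReal_ne_top]
    exact ENNReal.mul_lt_top ENNReal.ofReal_lt_top hfin

/-- The carrier of a current is determined, up to null sets, by the functional. -/
theorem measure_carrier_diff_of_toFunctional_eq {C C' : RectifiableCurrent N n}
    (h : C.toFunctional = C'.toFunctional) :
    (μHE[n] : Measure (Euc N)) (C.carrier \ C'.carrier) = 0 := by
  set μ : Measure (Euc N) := μHE[n]
  set A := toMeasurable μ C.carrier with hA
  set A' := toMeasurable μ C'.carrier with hA'
  have hAm : MeasurableSet A := measurableSet_toMeasurable _ _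
  have hA'm : MeasurableSet A' := measurableSet_toMeasurable _ _
  have hAe : A =ᵐ[μ] C.carrier := C.carrier_meas.toMeasurable_ae_eq
  have hA'e : A' =ᵐ[μ] C'.carrier := C'.carrier_meas.toMeasurable_ae_eq
  have hr : μ.restrict A = μ.restrict C.carrier := Measure.restrict_congr_set hAe
  have hr' : μ.restrict A' = μ.restrict C'.carrier := Measure.restrict_congr_set hA'e
  set b := finBasis ℝ (Euc N [⋀^Fin n]→L[ℝ] ℝ)
  set ν := μ.restrict (A ∪ A')
  have hνA : ν.restrict A = μ.restrict C.carrier := by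
    rw [Measure.restrict_restrict hAm, inter_eq_self_of_subset_left subset_union_left, hr]
  have hνA' : ν.restrict A' = μ.restrict C'.carrier := by
    rw [Measure.restrict_restrict hA'm, inter_eq_self_of_subset_left subset_union_right, hr']
  have hloc : ∀ j, LocallyIntegrable (A.indicator fun X => b j (C.borelFrame X) * (C.mult X : ℝ)) ν := by
    intro j X
    obtain ⟨U, hU, hi⟩ := C.locallyIntegrable_apply_borelFrame_mul_mult (b j) X
    refine ⟨U, hU, ?_⟩
    rw [← hνA, IntegrableOn, Measure.restrict_restrict₀' hAm.nullMeasurableSet] at hi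
    rw [IntegrableOn, integrable_indicator_iff hAm, IntegrableOn, Measure.restrict_restrict hAm,
      inter_comm]
    exact hi
  have hloc' : ∀ j, LocallyIntegrable
      (A'.indicator fun X => b j (C'.borelFrame X) * (C'.mult X : ℝ)) ν := by
    intro j X
    obtain ⟨U, hU, hi⟩ := C'.locallyIntegrable_apply_borelFrame_mul_mult (b j) X
    refine ⟨U, hU, ?_⟩
    rw [← hνA', IntegrableOn, Measure.restrict_restrict₀' hA'm.nullMeasurableSet] at hi
    rw [IntegrableOn, integrable_indicator_iff hA'm, IntegrableOn, Measure.restrict_restrict hA'm,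
      inter_comm]
    exact hi
  -- Equal functionals have equal component densities, extended by zero off Borel hulls of the
  -- carriers. At almost every point of the first carrier some component is nonzero, so the point
  -- lies in the second hull.
  have key : ∀ j, ∀ᵐ X ∂ν, A.indicator (fun X => b j (C.borelFrame X) * (C.mult X : ℝ)) X =
      A'.indicator (fun X => b j (C'.borelFrame X) * (C'.mult X : ℝ)) X := by
    intro j
    refine ae_eq_of_integral_contDiff_smul_eq (hloc j) (hloc' j) fun g hg hgc => ?_
    have h1 := congrFun h (TestForm.smulConst g hg hgc (b j))
    rw [C.toFunctional_eq_borelFrame, C'.toFunctional_eq_borelFrame] at h1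
    simp only [smul_eq_mul, ← indicator_mul_right]
    rw [integral_indicator hAm, integral_indicator hA'm, hνA, hνA']
    simpa [TestForm.smulConst, mul_assoc] using h1
  have h2 : ∀ᵐ X ∂μ.restrict C.carrier, X ∈ A' := by
    have h3 : ∀ᵐ X ∂μ.restrict C.carrier, ∀ j,
        A.indicator (fun X => b j (C.borelFrame X) * (C.mult X : ℝ)) X =
        A'.indicator (fun X => b j (C'.borelFrame X) * (C'.mult X : ℝ)) X := by
      rw [← hνA]
      exact ae_restrict_of_ae (ae_all_iff.2 key)
    filter_upwards [h3, C.isTangentFrame.tangent, ae_restrict_mem₀ C.carrier_meas] with X h4 h5 h6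
    by_contra hX
    obtain ⟨j, hj⟩ := Orthonormal.exists_finBasis_ne_zero h5.1
    have h7 := h4 j
    rw [indicator_of_mem (subset_toMeasurable _ _ h6), indicator_of_notMem hX] at h7
    have := C.mult_pos X h6
    exact mul_ne_zero hj (by positivity) h7
  have h8 : μ (A'ᶜ ∩ C.carrier) = 0 := by
    rw [← Measure.restrict_apply hA'm.compl]
    exact h2
  refine measure_mono_null ?_ (measure_union_null h8 (ae_le_set.1 hA'e.le))
  intro X hX
  by_cases hXA : X ∈ A'
  · exact Or.inr ⟨hXA, hX.2⟩
  · exact Or.inl ⟨hXA, hX.1⟩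

end RectifiableCurrent

end

/-! ### Cones: dilation invariance, radial tangency, position of the support -/

section

variable {n N : ℕ}

theorem hasFDerivAt_etaHomeomorph (X : Euc N) {t : ℝ} (ht : t ≠ 0) (Y : Euc N) :
    HasFDerivAt (etaHomeomorph X ht) (t⁻¹ • ContinuousLinearMap.id ℝ (Euc N)) Y :=
  ((hasFDerivAt_id Y).sub_const X).const_smul t⁻¹

theorem isBilipschitzDiffeo_etaHomeomorph (X : Euc N) {t : ℝ} (ht : 0 < t) :
    IsBilipschitzDiffeo (max t.toNNReal t.toNNReal⁻¹) (etaHomeomorph X ht.ne') := by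
  have hK1 : t ≤ (max t.toNNReal t.toNNReal⁻¹ : ℝ≥0) := by
    rw [NNReal.coe_max, Real.coe_toNNReal _ ht.le]
    exact le_max_left _ _
  have hK2 : t⁻¹ ≤ (max t.toNNReal t.toNNReal⁻¹ : ℝ≥0) := by
    rw [NNReal.coe_max, NNReal.coe_inv, Real.coe_toNNReal _ ht.le]
    exact le_max_right _ _
  have hd : ∀ Y Z, dist (etaHomeomorph X ht.ne' Y) (etaHomeomorph X ht.ne' Z) = t⁻¹ * dist Y Z := by
    intro Y Z
    rw [etaHomeomorph_apply, etaHomeomorph_apply, dist_smul₀, Real.norm_of_nonneg (by positivity),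
      dist_sub_right]
  refine ⟨fun Y => (hasFDerivAt_etaHomeomorph X ht.ne' Y).differentiableAt, ?_, ?_, ?_⟩
  · refine LipschitzWith.of_dist_le_mul fun Y Z => ?_
    rw [hd]
    gcongr
  · refine AntilipschitzWith.of_le_mul_dist fun Y Z => ?_
    rw [hd]
    calc dist Y Z = t * (t⁻¹ * dist Y Z) := by field_simp
      _ ≤ _ := by gcongr
  · intro Y v
    rw [(hasFDerivAt_etaHomeomorph X ht.ne' Y).fderiv, smul_apply, ContinuousLinearMap.id_apply,
      norm_smul, Real.norm_of_nonneg (by positivity)]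
    calc ‖v‖ = t * (t⁻¹ * ‖v‖) := by field_simp
      _ ≤ _ := by gcongr

theorem contDiff_etaHomeomorph (X : Euc N) {t : ℝ} (ht : t ≠ 0) :
    ContDiff ℝ ((⊤ : ℕ∞) : WithTop ℕ∞) (etaHomeomorph X ht) :=
  (contDiff_id.sub contDiff_const).const_smul t⁻¹

theorem TestForm.pullbackDilation_eq_pullback {k : ℕ} (α : TestForm N k) {t : ℝ} (ht : t ≠ 0) :
    α.pullbackDilation t ht = α.pullback (etaHomeomorph 0 ht) (contDiff_etaHomeomorph 0 ht) := by
  refine TestForm.ext' fun X => ?_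
  simp only [pullbackDilation, pullback, (hasFDerivAt_etaHomeomorph 0 ht X).fderiv,
    etaHomeomorph_apply, sub_zero]

namespace RectifiableCurrent

variable {C : RectifiableCurrent N n}

theorem IsCone.pushforward_toFunctional_eq (hC : C.IsCone) {t : ℝ} (ht : 0 < t) :
    (C.pushforward (isBilipschitzDiffeo_etaHomeomorph 0 ht)).toFunctional = C.toFunctional := by
  ext α
  rw [C.pushforward_toFunctional _ (contDiff_etaHomeomorph 0 ht.ne'),
    ← TestForm.pullbackDilation_eq_pullback]
  exact congrFun (hC t ht) α

/-- Invariance is assumed only for the functional. The dilated current is a rectifiable current with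
the same functional, and the functional determines the carrier up to null sets. -/
theorem IsCone.carrier_ae_eq (hC : C.IsCone) {t : ℝ} (ht : 0 < t) :
    (eta 0 t '' C.carrier : Set (Euc N)) =ᵐ[(μHE[n] : Measure (Euc N))] C.carrier := by
  have h := hC.pushforward_toFunctional_eq ht
  exact (ae_le_set.2 (measure_carrier_diff_of_toFunctional_eq h)).antisymm
    (ae_le_set.2 (measure_carrier_diff_of_toFunctional_eq h.symm))

theorem IsCone.setIntegral_carrier (hC : C.IsCone) {t : ℝ} (ht : 0 < t) (f : Euc N → ℝ) :
    ∫ Y in C.carrier, f Y ∂(μHE[n] : Measure (Euc N)) =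
      (t ^ n)⁻¹ * ∫ Y in C.carrier, f (t⁻¹ • Y) ∂μHE[n] := by
  have h := setIntegral_eta_image (n := n) C.carrier 0 ht f
  rw [setIntegral_congr_set (hC.carrier_ae_eq ht)] at h
  simpa using h

theorem IsCone.smul_mem_spt (hC : C.IsCone) {t : ℝ} (ht : 0 < t) {X : Euc N} (hX : X ∈ C.spt) :
    t • X ∈ C.spt := by
  intro V hV hXV
  have hc : Continuous fun Y : Euc N => t • Y := continuous_const_smul t
  obtain ⟨α, hα, hne⟩ := hX _ (hV.preimage hc) hXV
  refine ⟨α.pullbackDilation t ht.ne', ?_, ?_⟩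
  · have h1 : tsupport (α.pullbackDilation t ht.ne').form ⊆
        (fun Y : Euc N => t⁻¹ • Y) ⁻¹' tsupport α.form := by
      refine closure_minimal (fun Y hY => ?_)
        ((isClosed_tsupport _).preimage (continuous_const_smul t⁻¹))
      refine subset_tsupport _ ?_
      contrapose! hY
      simp only [Function.mem_support, not_not] at hY ⊢
      simp only [TestForm.pullbackDilation, hY]
      rfl
    intro Y hY
    have := hα (h1 hY)
    simpa [smul_inv_smul₀ ht.ne'] using this
  · have := congrFun (hC t ht) α
    change C.toFunctional (α.pullbackDilation t ht.ne') = _ at this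
    rwa [this]

/-- The approximate tangent planes of a cone contain the position vector. -/
theorem IsCone.mem_of_isApproxTangentPlane (hC : C.IsCone) {X : Euc N} {S : Submodule ℝ (Euc N)}
    (hS : IsApproxTangentPlane n C.carrier X S) : X ∈ S := by
  have := C.isLocallyFiniteMeasure_restrict_carrier
  set μ : Measure (Euc N) := (μHE[n] : Measure (Euc N)).restrict C.carrier with hμ
  -- Integrals over S are invariant under translation by X. In the blow-up variable u = (Y - X)/t
  -- the dilation Y ↦ (1 - t) Y reads u ↦ u - X - t u, a translation by -X up to O(t) on bounded
  -- sets. It changes integrals over the cone only by the factor (1 - t)ⁿ, which tends to 1.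
  have key : ∀ f : Euc N → ℝ, Continuous f → HasCompactSupport f →
      ∫ Y in (S : Set (Euc N)), f (Y - X) ∂(μHE[n] : Measure (Euc N)) =
        ∫ Y in (S : Set (Euc N)), f Y ∂μHE[n] := by
    intro f hf hfc
    have hl1 := (isApproxTangentPlane_iff.1 hS).2 f hf hfc
    have hl2 := (isApproxTangentPlane_iff.1 hS).2 (fun Y => f (Y - X))
      (hf.comp (continuous_id.sub continuous_const))
      (hfc.comp_homeomorph (Homeomorph.subRight X))
    obtain ⟨R, hR0, hR⟩ : ∃ R > 0, tsupport f ⊆ Metric.closedBall 0 R := by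
      obtain ⟨R, hR⟩ := hfc.isCompact.isBounded.subset_closedBall 0
      exact ⟨max R 1, by positivity, hR.trans (Metric.closedBall_subset_closedBall (le_max_left _ _))⟩
    have hf0 : ∀ Z, R < ‖Z‖ → f Z = 0 := fun Z hZ => image_eq_zero_of_notMem_tsupport fun h => by
      have := hR h
      rw [mem_closedBall_zero_iff] at this
      linarith
    -- For t < 1/2 and |u| > R', both |u - X - t u| ≥ |u|/2 - |X| and |u - X| exceed R, so both
    -- integrands vanish.
    set R' : ℝ := 2 * (R + ‖X‖) with hR'
    have hR'0 : 0 < R' := by positivity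
    obtain ⟨B, hB0, hB⟩ := hS.exists_measureReal_le R'
    have hlim : Tendsto (fun t : ℝ => (t ^ n)⁻¹ * ∫ Y, f (t⁻¹ • (Y - X)) ∂μ -
        (1 - t) ^ n * ((t ^ n)⁻¹ * ∫ Y, f (t⁻¹ • (Y - X) - X) ∂μ)) (𝓝[>] 0) (𝓝 0) := by
      rw [Metric.tendsto_nhds]
      intro ε hε
      have huc := hfc.uniformContinuous_of_continuous hf
      obtain ⟨δ, hδ0, hδ⟩ := Metric.uniformContinuous_iff.1 huc (ε / (B + 1)) (by positivity)
      have e1 : ∀ᶠ t : ℝ in 𝓝[>] 0, t < min (1 / 2) (δ / (R' + 1)) :=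
        nhdsWithin_le_nhds (eventually_lt_nhds (by positivity))
      filter_upwards [self_mem_nhdsWithin, e1, hB] with t ht ht1 htB
      have ht0 : 0 < t := ht
      have ht2 : t < 1 / 2 := ht1.trans_le (min_le_left _ _)
      have ht3 : t * (R' + 1) < δ := by
        have := ht1.trans_le (min_le_right _ _)
        rwa [lt_div_iff₀ (by positivity)] at this
      have hs : ∫ Y, f (t⁻¹ • (Y - X)) ∂μ =
          (1 - t) ^ n * ∫ Y, f (t⁻¹ • ((1 - t) • Y - X)) ∂μ := by
        have := hC.setIntegral_carrier (t := (1 - t)⁻¹) (by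
          have : 0 < 1 - t := by linarith
          positivity) (fun Y => f (t⁻¹ • (Y - X)))
        simpa only [inv_inv, inv_pow] using this
      have hne : (1 - t) ≠ 0 := by linarith
      have harg : ∀ Y, t⁻¹ • ((1 - t) • Y - X) = t⁻¹ • (Y - X) - X - (Y - X) := by
        intro Y
        have h1 : t⁻¹ • ((1 - t) • Y - X) = t⁻¹ • (Y - X) - (t⁻¹ * t) • Y := by
          rw [sub_smul, one_smul, mul_smul, ← smul_sub]
          congr 1
          abel
        rw [h1, inv_mul_cancel₀ ht0.ne', one_smul]
        abel
      have hsmall : ∀ Y, R' * t < ‖Y - X‖ → R < ‖t⁻¹ • (Y - X) - X - (Y - X)‖ ∧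
          R < ‖t⁻¹ • (Y - X) - X‖ := by
        intro Y hY
        set u := t⁻¹ • (Y - X) with hu
        have hYX : Y - X = t • u := by rw [hu, smul_inv_smul₀ ht0.ne']
        have hun : R' < ‖u‖ := by
          rw [hYX, norm_smul, Real.norm_of_nonneg ht0.le] at hY
          nlinarith
        have h1 : ‖u‖ ≤ ‖u - X - (Y - X)‖ + ‖X‖ + t * ‖u‖ := by
          have : u = (u - X - (Y - X)) + X + t • u := by rw [hYX]; abel
          calc ‖u‖ = ‖(u - X - (Y - X)) + X + t • u‖ := by rw [← this]
            _ ≤ ‖u - X - (Y - X)‖ + ‖X‖ + ‖t • u‖ := norm_add₃_le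
            _ = _ := by rw [norm_smul, Real.norm_of_nonneg ht0.le]
        have h2 : ‖u‖ ≤ ‖u - X‖ + ‖X‖ := by
          calc ‖u‖ = ‖(u - X) + X‖ := by rw [sub_add_cancel]
            _ ≤ _ := norm_add_le _ _
        have h3 := norm_nonneg X
        constructor
        · nlinarith
        · nlinarith
      have hi1 : Integrable (fun Y => f (t⁻¹ • ((1 - t) • Y - X))) μ := by
        refine Continuous.integrable_of_hasCompactSupport (by fun_prop) ?_
        exact hfc.comp_homeomorph (((Homeomorph.smulOfNeZero (1 - t) hne).trans
          (Homeomorph.subRight X)).trans (Homeomorph.smulOfNeZero t⁻¹ (inv_ne_zero ht0.ne')))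
      have hi2 : Integrable (fun Y => f (t⁻¹ • (Y - X) - X)) μ := by
        refine Continuous.integrable_of_hasCompactSupport (by fun_prop) ?_
        exact hfc.comp_homeomorph (((Homeomorph.subRight X).trans
          (Homeomorph.smulOfNeZero t⁻¹ (inv_ne_zero ht0.ne'))).trans (Homeomorph.subRight X))
      have hbd : ‖∫ Y, (f (t⁻¹ • ((1 - t) • Y - X)) - f (t⁻¹ • (Y - X) - X)) ∂μ‖ ≤
          ε / (B + 1) * (B * t ^ n) := by
        rw [← setIntegral_eq_integral_of_forall_compl_eq_zero
          (s := Metric.closedBall X (R' * t)) (fun Y hY => ?_)]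
        · refine (norm_setIntegral_le_of_norm_le_const (C := ε / (B + 1))
            measure_closedBall_lt_top fun Y hY => ?_).trans (by gcongr)
          rw [harg, ← dist_eq_norm]
          refine (hδ ?_).le
          rw [dist_eq_norm, sub_sub_cancel_left, norm_neg]
          rw [Metric.mem_closedBall, dist_eq_norm] at hY
          nlinarith
        · rw [Metric.mem_closedBall, dist_eq_norm, not_le] at hY
          obtain ⟨h1, h2⟩ := hsmall Y hY
          rw [harg, hf0 _ h1, hf0 _ h2, sub_zero]
      rw [Real.dist_eq, sub_zero, hs]
      have h1 : (t ^ n)⁻¹ * ((1 - t) ^ n * ∫ Y, f (t⁻¹ • ((1 - t) • Y - X)) ∂μ) -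
          (1 - t) ^ n * ((t ^ n)⁻¹ * ∫ Y, f (t⁻¹ • (Y - X) - X) ∂μ) =
          (1 - t) ^ n * ((t ^ n)⁻¹ *
            ∫ Y, (f (t⁻¹ • ((1 - t) • Y - X)) - f (t⁻¹ • (Y - X) - X)) ∂μ) := by
        rw [integral_sub hi1 hi2]
        ring
      have h2 : (1 - t) ^ n ≤ 1 := pow_le_one₀ (by linarith) (by linarith)
      rw [h1, abs_mul, abs_mul, abs_of_nonneg (pow_nonneg (by linarith : 0 ≤ 1 - t) n),
        abs_of_pos (by positivity : 0 < (t ^ n)⁻¹)]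
      calc (1 - t) ^ n * ((t ^ n)⁻¹ *
            |∫ Y, (f (t⁻¹ • ((1 - t) • Y - X)) - f (t⁻¹ • (Y - X) - X)) ∂μ|)
          ≤ 1 * ((t ^ n)⁻¹ * (ε / (B + 1) * (B * t ^ n))) := by
            gcongr
            exact hbd
        _ = ε * (B / (B + 1)) := by field_simp
        _ < ε * 1 := by
            gcongr
            rw [div_lt_one (by positivity)]
            linarith
        _ = ε := mul_one ε
    have hpow : Tendsto (fun t : ℝ => (1 - t) ^ n) (𝓝[>] 0) (𝓝 1) := by
      have hc : Continuous fun t : ℝ => (1 - t) ^ n := by fun_prop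
      have := hc.tendsto 0
      simp only [sub_zero, one_pow] at this
      exact this.mono_left nhdsWithin_le_nhds
    have h3 := hl1.sub (hpow.mul hl2)
    have h4 := tendsto_nhds_unique h3 hlim
    linarith
  rw [← SetLike.mem_coe, ← (Submodule.closed_of_finiteDimensional S).closure_eq,
    Metric.mem_closure_iff]
  intro ε hε
  -- A bump about 0 ∈ S has positive integral over S. By translation invariance so has the same bump
  -- about X; hence S meets every ball about X, and S is closed.
  let f : ContDiffBump (0 : Euc N) := ⟨ε / 2, ε, by positivity, by linarith⟩
  have hf0 : f 0 ≠ 0 := by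
    rw [f.one_of_mem_closedBall (Metric.mem_closedBall_self (by positivity))]
    exact one_ne_zero
  have h1 := setIntegral_subspace_pos hS.1 f.continuous f.hasCompactSupport (fun _ => f.nonneg)
    (zero_mem S) hf0
  rw [← key f f.continuous f.hasCompactSupport] at h1
  by_contra! h
  refine h1.ne' (setIntegral_eq_zero_of_forall_eq_zero fun Y hY => f.zero_of_le_dist ?_)
  rw [dist_zero_right, ← dist_eq_norm, dist_comm]
  exact h Y hY

theorem IsCone.ae_mem_tangent (hC : C.IsCone) :
    ∀ᵐ X ∂C.mass, X ∈ Submodule.span ℝ (range (C.borelFrame X)) :=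
  C.mass_absolutelyContinuous.ae_le
    (C.isTangentFrame.tangent.mono fun _ h => hC.mem_of_isApproxTangentPlane h.2)

/-- The support of a cone that meets `Pᗮ` only at the origin lies in a cone around `P`. -/
theorem IsCone.exists_norm_le (hC : C.IsCone) {P : Submodule ℝ (Euc N)}
    (hP : C.spt ∩ (Pᗮ : Set (Euc N)) ⊆ {0}) :
    ∃ c : ℝ, 0 < c ∧ ∀ X ∈ C.spt, ‖X‖ ≤ c * ‖P.starProjection X‖ := by
  -- On the compact link of the cone |π_P| is positive, since the link misses Pᗮ; its minimum gives
  -- c⁻¹, and homogeneity does the rest.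
  have hk : IsCompact (C.spt ∩ Metric.sphere 0 1) :=
    (isCompact_sphere 0 1).inter_left (FormFunctional.isClosed_spt _)
  have hcont : Continuous fun X : Euc N => ‖P.starProjection X‖ := by fun_prop
  rcases (C.spt ∩ Metric.sphere (0 : Euc N) 1).eq_empty_or_nonempty with he | hne
  · refine ⟨1, one_pos, fun X hX => ?_⟩
    by_cases hX0 : X = 0
    · simp [hX0]
    · have h1 := hC.smul_mem_spt (inv_pos.2 (norm_pos_iff.2 hX0)) hX
      have h2 : ‖X‖⁻¹ • X ∈ C.spt ∩ Metric.sphere (0 : Euc N) 1 :=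
        ⟨h1, by simp [norm_smul, hX0]⟩
      rw [he] at h2
      exact h2.elim
  · obtain ⟨Z, hZ, hmin⟩ := hk.exists_isMinOn hne hcont.continuousOn
    have hZ1 : ‖Z‖ = 1 := by simpa using hZ.2
    have hpos : 0 < ‖P.starProjection Z‖ := by
      rw [norm_pos_iff]
      intro h0
      have : Z ∈ Pᗮ := P.starProjection_apply_eq_zero_iff.1 h0
      have h3 : Z = 0 := hP ⟨hZ.1, this⟩
      rw [h3, norm_zero] at hZ1
      exact zero_ne_one hZ1
    refine ⟨‖P.starProjection Z‖⁻¹, by positivity, fun X hX => ?_⟩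
    by_cases hX0 : X = 0
    · simp [hX0]
    · have hXn := norm_pos_iff.2 hX0
      have h1 := hC.smul_mem_spt (inv_pos.2 hXn) hX
      have h2 : ‖X‖⁻¹ • X ∈ C.spt ∩ Metric.sphere (0 : Euc N) 1 :=
        ⟨h1, by simp [norm_smul, hX0]⟩
      have h4 : ‖P.starProjection Z‖ ≤ ‖P.starProjection (‖X‖⁻¹ • X)‖ := hmin h2
      rw [map_smul, norm_smul, norm_inv, norm_norm] at h4
      rw [inv_mul_eq_div, le_div_iff₀ hpos]
      rwa [inv_mul_eq_div, le_div_iff₀ hXn, mul_comm] at h4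

end RectifiableCurrent

end

/-! ### Linear algebra of a pair of planes -/

section

variable {n N : ℕ}

theorem Orthonormal.starProjection_span {k : ℕ} {τ : Fin k → Euc N} (hτ : Orthonormal ℝ τ)
    (v : Euc N) : (Submodule.span ℝ (range τ)).starProjection v = ∑ i, inner ℝ (τ i) v • τ i := by
  refine Submodule.eq_starProjection_of_mem_of_inner_eq_zero ?_ fun w hw => ?_
  · exact Submodule.sum_mem _ fun i _ => Submodule.smul_mem _ _ (Submodule.subset_span ⟨i, rfl⟩)
  · refine Submodule.span_induction (p := fun w _ => inner ℝ (v - ∑ i, inner ℝ (τ i) v • τ i) w = 0)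
      ?_ (inner_zero_right _) (fun _ _ _ _ h1 h2 => by rw [inner_add_right, h1, h2, add_zero])
      (fun a _ _ h => by rw [inner_smul_right, h, mul_zero]) hw
    rintro _ ⟨i, rfl⟩
    rw [inner_sub_left, hτ.inner_left_fintype, conj_trivial, real_inner_comm, sub_self]

theorem exists_orthonormal_span_eq {P : Submodule ℝ (Euc N)} (hP : finrank ℝ P = n) :
    ∃ σ : Fin n → Euc N, Orthonormal ℝ σ ∧ Submodule.span ℝ (range σ) = P := by
  let b := (stdOrthonormalBasis ℝ P).reindex (finCongr hP)
  refine ⟨fun i => (b i : Euc N), b.orthonormal.comp_linearIsometry P.subtypeₗᵢ, ?_⟩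
  have h := b.toBasis.span_eq
  have h2 : range (fun i => (b i : Euc N)) = P.subtype '' range b := by
    rw [← range_comp]; rfl
  rw [h2, Submodule.span_image, ← b.coe_toBasis, h, Submodule.map_top, Submodule.range_subtype]

theorem sum_inner_mul_inner_single (v w : Euc N) :
    ∑ j, inner ℝ v (EuclideanSpace.single j (1 : ℝ)) * inner ℝ w (EuclideanSpace.single j (1 : ℝ)) =
      inner ℝ v w := by
  have := (EuclideanSpace.basisFun (Fin N) ℝ).sum_inner_mul_inner v w
  rw [← this]
  refine Finset.sum_congr rfl fun j _ => ?_
  rw [EuclideanSpace.basisFun_apply, real_inner_comm w]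

theorem Orthonormal.sum_norm_sq_starProjection {k : ℕ} {τ : Fin k → Euc N} (hτ : Orthonormal ℝ τ) :
    ∑ j, ‖(Submodule.span ℝ (range τ)).starProjection (EuclideanSpace.single j (1 : ℝ))‖ ^ 2 = k := by
  have h : ∀ j, ‖(Submodule.span ℝ (range τ)).starProjection (EuclideanSpace.single j (1 : ℝ))‖ ^ 2 =
      ∑ i, inner ℝ (τ i) (EuclideanSpace.single j (1 : ℝ)) *
        inner ℝ (τ i) (EuclideanSpace.single j (1 : ℝ)) := by
    intro j
    rw [Orthonormal.starProjection_span hτ, ← real_inner_self_eq_norm_sq, hτ.inner_sum]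
    simp
  simp_rw [h]
  rw [Finset.sum_comm]
  simp_rw [sum_inner_mul_inner_single, real_inner_self_eq_norm_sq, hτ.1]
  simp

theorem Orthonormal.sum_inner_starProjection {k : ℕ} {τ : Fin k → Euc N} (hτ : Orthonormal ℝ τ)
    (P : Submodule ℝ (Euc N)) :
    ∑ j, inner ℝ ((Submodule.span ℝ (range τ)).starProjection (EuclideanSpace.single j (1 : ℝ)))
      (P.starProjection (EuclideanSpace.single j (1 : ℝ))) =
    ∑ i, inner ℝ (τ i) (P.starProjection (τ i)) := by
  have h : ∀ j, inner ℝ ((Submodule.span ℝ (range τ)).starProjection (EuclideanSpace.single j (1 : ℝ)))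
      (P.starProjection (EuclideanSpace.single j (1 : ℝ))) =
      ∑ i, inner ℝ (τ i) (EuclideanSpace.single j (1 : ℝ)) *
        inner ℝ (P.starProjection (τ i)) (EuclideanSpace.single j (1 : ℝ)) := by
    intro j
    rw [Orthonormal.starProjection_span hτ, sum_inner]
    refine Finset.sum_congr rfl fun i _ => ?_
    rw [inner_smul_left, conj_trivial, Submodule.inner_starProjection_left_eq_right]
  simp_rw [h]
  rw [Finset.sum_comm]
  simp_rw [sum_inner_mul_inner_single]

theorem inner_starProjection_eq_norm_sq (P : Submodule ℝ (Euc N)) (v : Euc N) :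
    inner ℝ v (P.starProjection v) = ‖P.starProjection v‖ ^ 2 := by
  rw [← real_inner_self_eq_norm_sq, Submodule.inner_starProjection_left_eq_right,
    P.starProjection_eq_self_iff.2 (P.starProjection_apply_mem v)]

theorem inner_starProjection_orthogonal (P : Submodule ℝ (Euc N)) (v : Euc N) :
    inner ℝ v (P.starProjection v) = ‖v‖ ^ 2 - ‖Pᗮ.starProjection v‖ ^ 2 := by
  rw [Submodule.norm_sq_eq_add_norm_sq_starProjection v P, add_sub_cancel_right,
    inner_starProjection_eq_norm_sq]

/-- The tilt excess `∑ |π_{P^⊥} τᵢ|²` of the plane spanned by an orthonormal frame. -/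
def tiltExcess (P : Submodule ℝ (Euc N)) (τ : Fin n → Euc N) : ℝ :=
  ∑ i, ‖Pᗮ.starProjection (τ i)‖ ^ 2

theorem tiltExcess_nonneg (P : Submodule ℝ (Euc N)) (τ : Fin n → Euc N) : 0 ≤ tiltExcess P τ :=
  Finset.sum_nonneg fun _ _ => sq_nonneg _

theorem tiltExcess_le {P : Submodule ℝ (Euc N)} {τ : Fin n → Euc N} (hτ : Orthonormal ℝ τ) :
    tiltExcess P τ ≤ n := by
  refine (Finset.sum_le_card_nsmul _ _ (1 : ℝ) fun i _ => ?_).trans (by simp)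
  have := Pᗮ.norm_starProjection_apply_le (τ i)
  rw [hτ.1 i] at this
  exact pow_le_one₀ (norm_nonneg _) this

/-- Both projections have squared norm n, because the planes have equal dimension, and the inner
product of the projections is Σ⟨τᵢ, π_P τᵢ⟩ = n - `tiltExcess`. -/
theorem frobeniusNorm_sub_sq {P : Submodule ℝ (Euc N)} (hP : finrank ℝ P = n) {τ : Fin n → Euc N}
    (hτ : Orthonormal ℝ τ) :
    frobeniusNorm ((Submodule.span ℝ (range τ)).starProjection - P.starProjection) ^ 2 =
      2 * tiltExcess P τ := by
  obtain ⟨σ, hσ, rfl⟩ := exists_orthonormal_span_eq hP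
  rw [frobeniusNorm, Real.sq_sqrt (Finset.sum_nonneg fun _ _ => sq_nonneg _)]
  simp_rw [sub_apply, norm_sub_sq_real]
  rw [Finset.sum_add_distrib, Finset.sum_sub_distrib, ← Finset.mul_sum,
    Orthonormal.sum_norm_sq_starProjection hτ, Orthonormal.sum_norm_sq_starProjection hσ,
    Orthonormal.sum_inner_starProjection hτ, tiltExcess]
  simp_rw [inner_starProjection_orthogonal, hτ.1]
  simp only [one_pow, Finset.sum_sub_distrib, Finset.sum_const, Finset.card_univ, Fintype.card_fin,
    nsmul_eq_mul, mul_one]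
  ring

theorem sum_inner_starProjection_orthogonal (P : Submodule ℝ (Euc N)) (τ : Fin n → Euc N) :
    ∑ i, inner ℝ (τ i) (Pᗮ.starProjection (τ i)) = tiltExcess P τ := by
  refine Finset.sum_congr rfl fun i _ => ?_
  rw [inner_starProjection_eq_norm_sq]

/-- For `X` in the plane `S`, the quantity `⟪π_S π_P X, π_{P^⊥} X⟫` is controlled by the height
of `X`. -/
theorem inner_starProjection_orthogonal_bounds (P S : Submodule ℝ (Euc N)) {X : Euc N} (hX : X ∈ S) :
    0 ≤ inner ℝ (S.starProjection (P.starProjection X)) (Pᗮ.starProjection X) ∧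
    ‖P.starProjection X‖ ^ 2 *
      inner ℝ (S.starProjection (P.starProjection X)) (Pᗮ.starProjection X) ≤
      ‖Pᗮ.starProjection X‖ ^ 2 * ‖S.starProjection (P.starProjection X)‖ ^ 2 := by
  set p := P.starProjection X with hp
  set w := S.starProjection p with hw
  have hq : Pᗮ.starProjection X = X - p := by
    have := Submodule.starProjection_add_starProjection_orthogonal (K := P) X
    rw [← this, hp]; simp
  have h1 : inner ℝ w X = ‖p‖ ^ 2 := by
    rw [hw, Submodule.inner_starProjection_left_eq_right, S.starProjection_eq_self_iff.2 hX,
      real_inner_comm, hp, inner_starProjection_eq_norm_sq]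
  have h2 : inner ℝ w p = ‖w‖ ^ 2 := by
    rw [hw, real_inner_comm, inner_starProjection_eq_norm_sq]
  have h3 : inner ℝ w (Pᗮ.starProjection X) = ‖p‖ ^ 2 - ‖w‖ ^ 2 := by
    rw [hq, inner_sub_right, h1, h2]
  have h4 : ‖w‖ ≤ ‖p‖ := S.norm_starProjection_apply_le p
  have h5 : ‖X‖ ^ 2 = ‖p‖ ^ 2 + ‖Pᗮ.starProjection X‖ ^ 2 :=
    Submodule.norm_sq_eq_add_norm_sq_starProjection X P
  -- Cauchy-Schwarz for ⟨w, X⟩ = |p|², the identity that needs X ∈ S. Inserting |X|² = |p|² + |q|²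
  -- gives |p|²(|p|² - |w|²) ≤ |w|²|q|², where q is the component in Pᗮ.
  have h6 : (‖p‖ ^ 2) ^ 2 ≤ ‖w‖ ^ 2 * ‖X‖ ^ 2 := by
    rw [← h1, ← mul_pow]
    exact sq_le_sq' (by linarith [neg_le_of_abs_le (abs_real_inner_le_norm w X)])
      (real_inner_le_norm w X)
  rw [h3]
  constructor
  · have := pow_le_pow_left₀ (norm_nonneg _) h4 2
    linarith
  · nlinarith

theorem radius_zero (P : Submodule ℝ (Euc N)) (X : Euc N) : radius P 0 X = ‖P.starProjection X‖ := by
  rw [radius, sub_zero]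

theorem infDist_affinePlane_zero (P : Submodule ℝ (Euc N)) (X : Euc N) :
    Metric.infDist X (affinePlane 0 P) = ‖Pᗮ.starProjection X‖ := by
  have h : affinePlane 0 P = (P : Set (Euc N)) := by simp [affinePlane]
  have hq : Pᗮ.starProjection X = X - P.starProjection X := by
    have := Submodule.starProjection_add_starProjection_orthogonal (K := P) X
    conv_rhs => rw [← this]
    simp
  rw [h, hq, Submodule.starProjection_minimal, Metric.infDist_eq_iInf]
  simp_rw [dist_eq_norm]
  rfl

theorem hasFDerivAt_norm_starProjection (P : Submodule ℝ (Euc N)) {X : Euc N}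
    (hX : P.starProjection X ≠ 0) :
    HasFDerivAt (fun X => ‖P.starProjection X‖)
      (‖P.starProjection X‖⁻¹ • innerSL ℝ (P.starProjection X)) X := by
  have h1 : HasFDerivAt (fun X => ‖P.starProjection X‖ ^ 2)
      (2 • (innerSL ℝ (P.starProjection X)).comp P.starProjection) X :=
    P.starProjection.hasFDerivAt.norm_sq
  have h2 := h1.sqrt (by positivity)
  have h3 : (fun X => √(‖P.starProjection X‖ ^ 2)) = fun X => ‖P.starProjection X‖ := by
    ext1 X; exact Real.sqrt_sq (norm_nonneg _)
  rw [h3] at h2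
  refine h2.congr_fderiv (ContinuousLinearMap.ext fun v => ?_)
  have h4 : inner ℝ (P.starProjection X) (P.starProjection v) = inner ℝ (P.starProjection X) v := by
    rw [← Submodule.inner_starProjection_left_eq_right,
      P.starProjection_eq_self_iff.2 (P.starProjection_apply_mem X)]
  simp only [smul_apply, innerSL_apply_apply, ContinuousLinearMap.comp_apply, smul_eq_mul,
    Real.sqrt_sq (norm_nonneg (P.starProjection X)), h4, nsmul_eq_mul]
  field_simp
  norm_num

theorem gradient_radius (P : Submodule ℝ (Euc N)) {X : Euc N} (hX : P.starProjection X ≠ 0) :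
    gradient (radius P 0) X = ‖P.starProjection X‖⁻¹ • P.starProjection X := by
  have h : radius P 0 = fun X => ‖P.starProjection X‖ := funext (radius_zero P)
  refine HasGradientAt.gradient ?_
  rw [hasGradientAt_iff_hasFDerivAt, h]
  refine (hasFDerivAt_norm_starProjection P hX).congr_fderiv (ContinuousLinearMap.ext fun v => ?_)
  simp

end

/-! ### The test field normal to P and its tangential divergence -/

section

variable {n N : ℕ}

/-- A smooth function close from below to the cut-off at scale `ρ`, with derivative bounded by
`2 / ρ` and supported in `(ρ / 2, ρ)`. -/
theorem exists_smooth_cutoff {ρ ε : ℝ} (hρ : 0 < ρ) (hε : 0 < ε) : ∃ Θ ψ : ℝ → ℝ,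
    ContDiff ℝ ((⊤ : ℕ∞) : WithTop ℕ∞) Θ ∧ (∀ r, HasDerivAt Θ (-(2 / ρ * ψ r)) r) ∧
    (∀ r, 0 ≤ ψ r) ∧ (∀ r, ψ r ≤ 1) ∧ (∀ r, r ∉ Ioo (ρ / 2) ρ → ψ r = 0) ∧ (∀ r, 0 ≤ Θ r) ∧
    (∀ r, ρ ≤ r → Θ r = 0) ∧ (∀ r, r ≤ ρ / 2 → Θ r = Θ 0) ∧ ∀ r, cutoff (r / ρ) - ε ≤ Θ r := by
  -- Smoothing costs an interval of length δ at each end of (ρ/2, ρ); with slope 2/ρ the total loss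
  -- is 4δ/ρ = ε.
  set δ : ℝ := ε * ρ / 4 with hδ
  have hδ0 : 0 < δ := by positivity
  set ψ : ℝ → ℝ := fun r => Real.smoothTransition ((r - ρ / 2) / δ) *
    Real.smoothTransition ((ρ - r) / δ) with hψ
  have hψs : ContDiff ℝ ((⊤ : ℕ∞) : WithTop ℕ∞) ψ :=
    (Real.smoothTransition.contDiff.comp ((contDiff_id.sub contDiff_const).div_const δ)).mul
      (Real.smoothTransition.contDiff.comp ((contDiff_const.sub contDiff_id).div_const δ))
  have hψ0 : ∀ r, 0 ≤ ψ r := fun r =>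
    mul_nonneg (Real.smoothTransition.nonneg _) (Real.smoothTransition.nonneg _)
  have hψ1 : ∀ r, ψ r ≤ 1 := fun r => mul_le_one₀ (Real.smoothTransition.le_one _)
    (Real.smoothTransition.nonneg _) (Real.smoothTransition.le_one _)
  have hψl : ∀ r, r ≤ ρ / 2 → ψ r = 0 := fun r hr => by
    simp only [hψ]
    rw [Real.smoothTransition.zero_of_nonpos (div_nonpos_of_nonpos_of_nonneg (by linarith) hδ0.le),
      zero_mul]
  have hψr : ∀ r, ρ ≤ r → ψ r = 0 := fun r hr => by
    simp only [hψ]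
    rw [Real.smoothTransition.zero_of_nonpos (x := (ρ - r) / δ)
      (div_nonpos_of_nonpos_of_nonneg (by linarith) hδ0.le), mul_zero]
  have hψe : ∀ r, ρ / 2 + δ ≤ r → r ≤ ρ - δ → ψ r = 1 := fun r h1 h2 => by
    simp only [hψ]
    rw [Real.smoothTransition.one_of_one_le (by rw [le_div_iff₀ hδ0]; linarith),
      Real.smoothTransition.one_of_one_le (by rw [le_div_iff₀ hδ0]; linarith), mul_one]
  have hψc : Continuous ψ := hψs.continuous
  have hii : ∀ a b, IntervalIntegrable ψ volume a b := fun a b => hψc.intervalIntegrable a b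
  set Θ : ℝ → ℝ := fun r => 2 / ρ * ∫ s in r..ρ, ψ s with hΘ
  have hder : ∀ r, HasDerivAt Θ (-(2 / ρ * ψ r)) r := fun r => by
    have := (intervalIntegral.integral_hasDerivAt_left (hii r ρ)
      (hψc.stronglyMeasurableAtFilter _ _) hψc.continuousAt).const_mul (2 / ρ)
    rwa [mul_neg] at this
  have hzero : ∀ r, ρ ≤ r → Θ r = 0 := fun r hr => by
    simp only [hΘ]
    rw [intervalIntegral.integral_symm, intervalIntegral.integral_congr (g := fun _ => 0),
      intervalIntegral.integral_zero, neg_zero, mul_zero]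
    intro s hs
    rw [uIcc_of_le hr] at hs
    exact hψr s hs.1
  have hnn : ∀ r, 0 ≤ Θ r := fun r => by
    rcases le_total ρ r with h | h
    · exact (hzero r h).ge
    · exact mul_nonneg (by positivity) (intervalIntegral.integral_nonneg h fun s _ => hψ0 s)
  have hconst : ∀ r, r ≤ ρ / 2 → Θ r = Θ (ρ / 2) := fun r hr => by
    simp only [hΘ]
    rw [← intervalIntegral.integral_add_adjacent_intervals (hii r (ρ / 2)) (hii (ρ / 2) ρ),
      intervalIntegral.integral_congr (a := r) (g := fun _ => 0),
      intervalIntegral.integral_zero, zero_add]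
    intro s hs
    rw [uIcc_of_le hr] at hs
    exact hψl s hs.2
  have hlow : ∀ a, ρ / 2 ≤ a → 2 - 2 * (a / ρ) - ε ≤ Θ a := fun a ha => by
    by_cases h : a + δ ≤ ρ - δ
    · have h1 : ρ - a - 2 * δ ≤ ∫ s in a..ρ, ψ s := by
        calc ρ - a - 2 * δ = ∫ s in (a + δ)..(ρ - δ), (1 : ℝ) := by
              rw [integral_one]; ring
          _ = ∫ s in (a + δ)..(ρ - δ), ψ s := by
              refine intervalIntegral.integral_congr fun s hs => ?_
              rw [uIcc_of_le h] at hs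
              exact (hψe s (by linarith [hs.1]) hs.2).symm
          _ ≤ ∫ s in a..ρ, ψ s :=
              intervalIntegral.integral_mono_interval (by linarith) h (by linarith)
                (Eventually.of_forall hψ0) (hii a ρ)
      calc 2 - 2 * (a / ρ) - ε = 2 / ρ * (ρ - a - 2 * δ) := by rw [hδ]; field_simp; ring
        _ ≤ _ := by simp only [hΘ]; gcongr
    · refine le_trans ?_ (hnn a)
      push Not at h
      have : 2 - 2 * (a / ρ) - ε = 2 / ρ * (ρ - a - 2 * δ) := by rw [hδ]; field_simp; ring
      rw [this]
      exact mul_nonpos_of_nonneg_of_nonpos (by positivity) (by linarith)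
  refine ⟨Θ, ψ, ?_, hder, hψ0, hψ1, ?_, hnn, hzero, ?_, ?_⟩
  · rw [contDiff_infty_iff_deriv]
    refine ⟨fun r => (hder r).differentiableAt, ?_⟩
    rw [funext fun r => (hder r).deriv]
    exact (contDiff_const.mul hψs).neg
  · intro r hr
    by_cases h : ρ / 2 < r
    · exact hψr r (not_lt.1 fun h2 => hr ⟨h, h2⟩)
    · exact hψl r (not_lt.1 h)
  · intro r hr
    rw [hconst r hr, hconst 0 (by positivity)]
  · intro r
    unfold cutoff
    split_ifs with h1 h2
    · rw [div_lt_iff₀ hρ] at h1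
      rw [hconst r (by linarith)]
      have := hlow (ρ / 2) le_rfl
      have h3 : ρ / 2 / ρ = 1 / 2 := by field_simp
      rw [h3] at this
      linarith
    · refine hlow r ?_
      rw [not_lt, le_div_iff₀ hρ] at h1
      linarith
    · linarith [hnn r]

/-- The normal field `-Θ(r) π_{P^⊥} X`. -/
def normalField (P : Submodule ℝ (Euc N)) (Θ : ℝ → ℝ) (X : Euc N) : Euc N :=
  -(Θ ‖P.starProjection X‖ • Pᗮ.starProjection X)

/-- The radius is not differentiable on Pᗮ, but Θ is constant for r ≤ ρ/2, so the composition is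
locally constant there. -/
theorem contDiff_comp_norm_starProjection (P : Submodule ℝ (Euc N)) {Θ : ℝ → ℝ} {ρ : ℝ} (hρ : 0 < ρ)
    (hΘ : ContDiff ℝ ((⊤ : ℕ∞) : WithTop ℕ∞) Θ) (hc : ∀ r, r ≤ ρ / 2 → Θ r = Θ 0) :
    ContDiff ℝ ((⊤ : ℕ∞) : WithTop ℕ∞) fun X => Θ ‖P.starProjection X‖ := by
  rw [contDiff_iff_contDiffAt]
  intro X
  by_cases hX : P.starProjection X = 0
  · have h1 : (fun X => Θ ‖P.starProjection X‖) =ᶠ[𝓝 X] fun _ => Θ 0 := by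
      have hcont : Continuous fun X => ‖P.starProjection X‖ := by fun_prop
      have := hcont.continuousAt.eventually_lt_const (show ‖P.starProjection X‖ < ρ / 2 by
        rw [hX, norm_zero]; positivity)
      filter_upwards [this] with Y hY
      exact hc _ hY.le
    exact contDiffAt_const.congr_of_eventuallyEq h1
  · have h2 : ContDiffAt ℝ ((⊤ : ℕ∞) : WithTop ℕ∞) (fun X => ‖P.starProjection X‖) X :=
      (contDiffAt_norm ℝ hX).comp X P.starProjection.contDiff.contDiffAt
    exact hΘ.contDiffAt.comp X h2

theorem hasFDerivAt_comp_norm_starProjection (P : Submodule ℝ (Euc N)) {Θ ψ : ℝ → ℝ} {ρ : ℝ}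
    (hρ : 0 < ρ) (hder : ∀ r, HasDerivAt Θ (-(2 / ρ * ψ r)) r) (hc : ∀ r, r ≤ ρ / 2 → Θ r = Θ 0) (X : Euc N) :
    HasFDerivAt (fun X => Θ ‖P.starProjection X‖)
      (-(2 / ρ * ψ ‖P.starProjection X‖ * ‖P.starProjection X‖⁻¹) •
        innerSL ℝ (P.starProjection X)) X := by
  by_cases hX : P.starProjection X = 0
  · have h1 : (fun X => Θ ‖P.starProjection X‖) =ᶠ[𝓝 X] fun _ => Θ 0 := by
      have hcont : Continuous fun X => ‖P.starProjection X‖ := by fun_prop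
      have := hcont.continuousAt.eventually_lt_const (show ‖P.starProjection X‖ < ρ / 2 by
        rw [hX, norm_zero]; positivity)
      filter_upwards [this] with Y hY
      exact hc _ hY.le
    rw [hX]
    simp only [norm_zero, inv_zero, mul_zero, neg_zero, zero_smul]
    exact (hasFDerivAt_const (Θ 0) X).congr_of_eventuallyEq h1
  · have h2 := (hder ‖P.starProjection X‖).comp_hasFDerivAt X (hasFDerivAt_norm_starProjection P hX)
    refine h2.congr_fderiv ?_
    rw [smul_smul, neg_mul]

theorem hasFDerivAt_normalField (P : Submodule ℝ (Euc N)) {Θ ψ : ℝ → ℝ} {ρ : ℝ}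
    (hρ : 0 < ρ) (hder : ∀ r, HasDerivAt Θ (-(2 / ρ * ψ r)) r) (hc : ∀ r, r ≤ ρ / 2 → Θ r = Θ 0) (X : Euc N) :
    HasFDerivAt (normalField P Θ) (-(Θ ‖P.starProjection X‖ • Pᗮ.starProjection +
      (-(2 / ρ * ψ ‖P.starProjection X‖ * ‖P.starProjection X‖⁻¹) •
        innerSL ℝ (P.starProjection X)).smulRight (Pᗮ.starProjection X))) X :=
  ((hasFDerivAt_comp_norm_starProjection P hρ hder hc X).smul
    Pᗮ.starProjection.hasFDerivAt).neg

namespace RectifiableCurrent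

variable {C : RectifiableCurrent N n}

theorem tangentDiv_congr {Y Y' : Euc N → Euc N} {X : Euc N} (h : Y =ᶠ[𝓝 X] Y') :
    C.tangentDiv Y X = C.tangentDiv Y' X := by
  simp only [tangentDiv, h.fderiv_eq]

/-- Differentiating Θ(r) gives a rank-one term, whose trace over the tangent plane is the inner
product; differentiating the projection to Pᗮ gives the tilt. The sign of the field makes
nonnegative first variation an upper bound for the tilt. -/
theorem tangentDiv_normalField (P : Submodule ℝ (Euc N)) {Θ ψ : ℝ → ℝ} {ρ : ℝ}
    (hρ : 0 < ρ) (hder : ∀ r, HasDerivAt Θ (-(2 / ρ * ψ r)) r) (hc : ∀ r, r ≤ ρ / 2 → Θ r = Θ 0) {X : Euc N}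
    (hX : Orthonormal ℝ (C.borelFrame X)) :
    C.tangentDiv (normalField P Θ) X =
      2 / ρ * ψ ‖P.starProjection X‖ * ‖P.starProjection X‖⁻¹ *
        inner ℝ ((Submodule.span ℝ (range (C.borelFrame X))).starProjection (P.starProjection X))
          (Pᗮ.starProjection X) - Θ ‖P.starProjection X‖ * tiltExcess P (C.borelFrame X) := by
  rw [tangentDiv, (hasFDerivAt_normalField P hρ hder hc X).fderiv,
    Orthonormal.starProjection_span hX, sum_inner, Finset.mul_sum,
    ← sum_inner_starProjection_orthogonal, Finset.mul_sum, ← Finset.sum_sub_distrib]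
  refine Finset.sum_congr rfl fun i _ => ?_
  simp only [neg_apply, add_apply, smul_apply, ContinuousLinearMap.smulRight_apply,
    innerSL_apply_apply, inner_neg_right, inner_add_right, inner_smul_right, smul_eq_mul,
    inner_smul_left, conj_trivial]
  rw [real_inner_comm (C.borelFrame X i) (P.starProjection X)]
  ring

end RectifiableCurrent

end

/-! ### The tilt is controlled by the height -/

section

variable {n N : ℕ}

theorem cutoff_nonneg (s : ℝ) : 0 ≤ cutoff s := by
  unfold cutoff; split_ifs <;> linarith

theorem cutoff_le_one (s : ℝ) : cutoff s ≤ 1 := by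
  unfold cutoff; split_ifs <;> linarith

theorem cutoff_eq_zero {s : ℝ} (hs : 1 ≤ s) : cutoff s = 0 := by
  unfold cutoff; split_ifs <;> linarith

theorem measurable_cutoff : Measurable cutoff :=
  Measurable.ite measurableSet_Iio measurable_const
    (Measurable.ite measurableSet_Iio (by fun_prop) measurable_const)

theorem cylinder_zero (ρ : ℝ) (P : Submodule ℝ (Euc N)) :
    cylinder ρ 0 P = {X | ‖P.starProjection X‖ < ρ} := by
  simp only [cylinder, radius_zero]

theorem isOpen_cylinder_zero (ρ : ℝ) (P : Submodule ℝ (Euc N)) : IsOpen (cylinder ρ 0 P) := by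
  rw [cylinder_zero]
  exact isOpen_lt (by fun_prop) continuous_const

theorem measurableSet_annulus (ρ : ℝ) (P : Submodule ℝ (Euc N)) :
    MeasurableSet (cylinder ρ 0 P \ closure (cylinder (ρ / 2) 0 P)) :=
  (isOpen_cylinder_zero ρ P).measurableSet.diff isClosed_closure.measurableSet

theorem lt_radius_of_mem_annulus {ρ : ℝ} {P : Submodule ℝ (Euc N)} {X : Euc N}
    (hX : X ∈ cylinder ρ 0 P \ closure (cylinder (ρ / 2) 0 P)) :
    ρ / 2 ≤ ‖P.starProjection X‖ ∧ ‖P.starProjection X‖ < ρ := by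
  refine ⟨?_, by simpa [cylinder_zero] using hX.1⟩
  by_contra! h
  exact hX.2 (subset_closure (by simpa [cylinder_zero] using h))

theorem mem_annulus {ρ : ℝ} {P : Submodule ℝ (Euc N)} {X : Euc N} (h1 : ρ / 2 < ‖P.starProjection X‖)
    (h2 : ‖P.starProjection X‖ < ρ) : X ∈ cylinder ρ 0 P \ closure (cylinder (ρ / 2) 0 P) := by
  refine ⟨by simpa [cylinder_zero] using h2, fun h => ?_⟩
  have h3 : closure (cylinder (ρ / 2) 0 P) ⊆ {X | ‖P.starProjection X‖ ≤ ρ / 2} := by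
    refine closure_minimal (fun Y hY => ?_) (isClosed_le (by fun_prop) continuous_const)
    rw [cylinder_zero] at hY
    exact (show ‖P.starProjection Y‖ < ρ / 2 from hY).le
  exact absurd (h3 h) (not_le.2 h1)

theorem heightIntegrand_of_mem {ρ : ℝ} (hρ : 0 < ρ) {P S : Submodule ℝ (Euc N)} {X : Euc N}
    (hX : X ∈ cylinder ρ 0 P \ closure (cylinder (ρ / 2) 0 P)) : heightIntegrand P 0 ρ X S =
      ‖Pᗮ.starProjection X‖ ^ 2 * (‖P.starProjection X‖⁻¹ * ‖S.starProjection (P.starProjection X)‖) ^ 2 *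
        ‖P.starProjection X‖⁻¹ := by
  have h0 : P.starProjection X ≠ 0 := norm_pos_iff.1
    (lt_of_lt_of_le (by positivity) (lt_radius_of_mem_annulus hX).1)
  rw [heightIntegrand, indicator_of_mem hX, infDist_affinePlane_zero, planeGradient,
    gradient_radius P h0, radius_zero, map_smul, norm_smul, norm_inv, norm_norm, one_div]

theorem heightIntegrand_nonneg {ρ : ℝ} (hρ : 0 < ρ) (P S : Submodule ℝ (Euc N)) (X : Euc N) :
    0 ≤ heightIntegrand P 0 ρ X S := by
  by_cases hX : X ∈ cylinder ρ 0 P \ closure (cylinder (ρ / 2) 0 P)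
  · rw [heightIntegrand_of_mem hρ hX]; positivity
  · rw [heightIntegrand, indicator_of_notMem hX]

theorem tiltIntegrand_eq {ρ : ℝ} {P : Submodule ℝ (Euc N)} (hP : finrank ℝ P = n)
    {τ : Fin n → Euc N} (hτ : Orthonormal ℝ τ) (X : Euc N) :
    tiltIntegrand P 0 ρ X (Submodule.span ℝ (range τ)) =
      2 * (tiltExcess P τ * cutoff (‖P.starProjection X‖ / ρ)) := by
  rw [tiltIntegrand, frobeniusNorm_sub_sq hP hτ, radius_zero, mul_assoc]

/-- Since |∇^S r| = |w|/r, the height integrand on the annulus is |q|²|w|² r⁻³. The inequality r²⟨w,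
q⟩ ≤ |q|²|w|², valid because X ∈ S, is multiplied by r⁻³; nonnegativity of ⟨w, q⟩ allows ψ ≤ 1 to be
used. -/
theorem le_heightIntegrand {ρ : ℝ} (hρ : 0 < ρ) {P S : Submodule ℝ (Euc N)} {X : Euc N} (hX : X ∈ S)
    {ψ : ℝ → ℝ} (h1 : ∀ r, ψ r ≤ 1) (hψ : ∀ r, r ∉ Ioo (ρ / 2) ρ → ψ r = 0) :
    ψ ‖P.starProjection X‖ * ‖P.starProjection X‖⁻¹ *
      inner ℝ (S.starProjection (P.starProjection X)) (Pᗮ.starProjection X) ≤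
      heightIntegrand P 0 ρ X S := by
  by_cases hr : ‖P.starProjection X‖ ∈ Ioo (ρ / 2) ρ
  · have hr0 : 0 < ‖P.starProjection X‖ := lt_trans (by positivity) hr.1
    rw [heightIntegrand_of_mem hρ (mem_annulus hr.1 hr.2)]
    obtain ⟨hb0, hb1⟩ := inner_starProjection_orthogonal_bounds P S hX
    set r := ‖P.starProjection X‖
    set I := inner ℝ (S.starProjection (P.starProjection X)) (Pᗮ.starProjection X)
    calc ψ r * r⁻¹ * I ≤ 1 * r⁻¹ * I := by gcongr; exact h1 r
      _ = (r ^ 2 * I) * (r⁻¹ ^ 2 * r⁻¹) := by field_simp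
      _ ≤ _ := mul_le_mul_of_nonneg_right hb1 (by positivity)
      _ = _ := by ring
  · rw [hψ _ hr, zero_mul, zero_mul]
    exact heightIntegrand_nonneg hρ P S X

namespace RectifiableCurrent

variable {C : RectifiableCurrent N n} {P : Submodule ℝ (Euc N)} {c ρ : ℝ}

theorem ae_tangent_eq (C : RectifiableCurrent N n) :
    ∀ᵐ X ∂C.mass, C.tangent X = Submodule.span ℝ (range (C.borelFrame X)) := by
  filter_upwards [C.mass_absolutelyContinuous.ae_le C.borelFrame_ae_eq] with X hX
  rw [tangent, hX]

theorem measurable_tiltExcess (C : RectifiableCurrent N n) (P : Submodule ℝ (Euc N)) :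
    Measurable fun X => tiltExcess P (C.borelFrame X) :=
  Finset.measurable_sum _ fun i _ =>
    (Pᗮ.starProjection.continuous.measurable.comp (C.measurable_borelFrame i)).norm.pow_const 2

theorem integrable_indicator_closedBall (C : RectifiableCurrent N n) (R a : ℝ) :
    Integrable ((Metric.closedBall (0 : Euc N) R).indicator fun _ => a) C.mass := by
  rw [integrable_indicator_iff Metric.isClosed_closedBall.measurableSet]
  exact integrableOn_const (isCompact_closedBall _ _).measure_lt_top.ne

/-- The cylinder is unbounded, but it meets the support inside the ball of radius cρ, where the mass
is finite and the integrand bounded. -/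
theorem varifoldIntegrable_tiltIntegrand (hP : finrank ℝ P = n) (hρ : 0 < ρ) (hc : 0 < c)
    (hspt : ∀ X ∈ C.spt, ‖X‖ ≤ c * ‖P.starProjection X‖) :
    C.VarifoldIntegrable (tiltIntegrand P 0 ρ) := by
  have hae : (fun X => tiltIntegrand P 0 ρ X (C.tangent X)) =ᵐ[C.mass] fun X =>
      2 * (tiltExcess P (C.borelFrame X) * cutoff (‖P.starProjection X‖ / ρ)) := by
    filter_upwards [C.ae_tangent_eq, C.ae_mass_orthonormal] with X h1 h2
    rw [h1, tiltIntegrand_eq hP h2]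
  refine Integrable.congr ?_ hae.symm
  have hm : Measurable fun X : Euc N => cutoff (‖P.starProjection X‖ / ρ) :=
    measurable_cutoff.comp (P.starProjection.continuous.measurable.norm.div_const ρ)
  refine (C.integrable_indicator_closedBall (c * ρ) (2 * n)).mono'
    (((C.measurable_tiltExcess P).mul hm).const_mul 2).aestronglyMeasurable ?_
  filter_upwards [C.ae_mass_orthonormal, C.ae_mem_spt] with X h2 h3
  have h4 := tiltExcess_nonneg P (C.borelFrame X)
  have h5 := cutoff_nonneg (‖P.starProjection X‖ / ρ)
  rw [Real.norm_of_nonneg (by positivity)]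
  by_cases hr : ‖P.starProjection X‖ < ρ
  · rw [indicator_of_mem]
    · have := mul_le_mul (tiltExcess_le (P := P) h2) (cutoff_le_one (‖P.starProjection X‖ / ρ)) h5
        (by positivity)
      linarith
    · rw [mem_closedBall_zero_iff]
      exact (hspt X h3).trans (by gcongr)
  · rw [cutoff_eq_zero (by rw [le_div_iff₀ hρ]; linarith), mul_zero, mul_zero]
    exact indicator_nonneg (fun _ _ => by positivity) X

theorem varifoldIntegrable_heightIntegrand (hρ : 0 < ρ) (hc : 0 < c)
    (hspt : ∀ X ∈ C.spt, ‖X‖ ≤ c * ‖P.starProjection X‖) :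
    C.VarifoldIntegrable (heightIntegrand P 0 ρ) := by
  set A := cylinder ρ 0 P \ closure (cylinder (ρ / 2) 0 P) with hA
  have hae : (fun X => heightIntegrand P 0 ρ X (C.tangent X)) =ᵐ[C.mass] A.indicator fun X =>
      ‖Pᗮ.starProjection X‖ ^ 2 * (‖P.starProjection X‖⁻¹ *
        ‖∑ i, inner ℝ (C.borelFrame X i) (P.starProjection X) • C.borelFrame X i‖) ^ 2 *
        ‖P.starProjection X‖⁻¹ := by
    filter_upwards [C.ae_tangent_eq, C.ae_mass_orthonormal] with X h1 h2
    by_cases hX : X ∈ A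
    · rw [h1, heightIntegrand_of_mem hρ hX, indicator_of_mem hX, Orthonormal.starProjection_span h2]
    · rw [heightIntegrand, indicator_of_notMem hX, indicator_of_notMem hX]
  have hp : Measurable fun X : Euc N => P.starProjection X := P.starProjection.continuous.measurable
  have hq : Measurable fun X : Euc N => Pᗮ.starProjection X := Pᗮ.starProjection.continuous.measurable
  have hm : Measurable fun X => ∑ i, inner ℝ (C.borelFrame X i) (P.starProjection X) • C.borelFrame X i :=
    Finset.measurable_sum _ fun i _ =>
      (Measurable.inner (𝕜 := ℝ) (C.measurable_borelFrame i) hp).smul (C.measurable_borelFrame i)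
  have hmeas : Measurable (A.indicator fun X =>
      ‖Pᗮ.starProjection X‖ ^ 2 * (‖P.starProjection X‖⁻¹ *
        ‖∑ i, inner ℝ (C.borelFrame X i) (P.starProjection X) • C.borelFrame X i‖) ^ 2 *
        ‖P.starProjection X‖⁻¹) :=
    (((hq.norm.pow_const 2).mul ((hp.norm.inv.mul hm.norm).pow_const 2)).mul hp.norm.inv).indicator
      (measurableSet_annulus ρ P)
  refine (C.integrable_indicator_closedBall (c * ρ) ((c * ρ) ^ 2 * 1 ^ 2 * (ρ / 2)⁻¹)).mono'
    (hmeas.aestronglyMeasurable.congr hae.symm) ?_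
  filter_upwards [C.ae_mem_spt] with X h3
  rw [Real.norm_of_nonneg (heightIntegrand_nonneg hρ P _ X)]
  by_cases hX : X ∈ A
  · obtain ⟨hr1, hr2⟩ := lt_radius_of_mem_annulus hX
    have hr0 : 0 < ‖P.starProjection X‖ := lt_of_lt_of_le (by positivity) hr1
    have hXn : ‖X‖ ≤ c * ρ := (hspt X h3).trans (by gcongr)
    rw [heightIntegrand_of_mem hρ hX, indicator_of_mem (mem_closedBall_zero_iff.2 hXn)]
    have h1 : ‖Pᗮ.starProjection X‖ ≤ c * ρ := (Pᗮ.norm_starProjection_apply_le X).trans hXn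
    have h2 : ‖P.starProjection X‖⁻¹ * ‖(C.tangent X).starProjection (P.starProjection X)‖ ≤ 1 := by
      rw [inv_mul_eq_div, div_le_one hr0]
      exact (C.tangent X).norm_starProjection_apply_le _
    gcongr
  · rw [heightIntegrand, indicator_of_notMem hX]
    exact indicator_nonneg (fun _ _ => by positivity) X

theorem integrable_tangentDiv {Y : Euc N → Euc N}
    (hY : ContDiff ℝ ((⊤ : ℕ∞) : WithTop ℕ∞) Y) (hYc : HasCompactSupport Y) :
    Integrable (C.tangentDiv Y) C.mass := by
  obtain ⟨L, hL⟩ := hY.lipschitzWith_of_hasCompactSupport hYc (by simp)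
  obtain ⟨R, hR⟩ := hYc.isCompact.isBounded.subset_closedBall 0
  refine (C.integrable_indicator_closedBall R (n * L)).mono'
    (C.measurable_tangentDiv Y).aestronglyMeasurable ?_
  filter_upwards [C.ae_mass_orthonormal] with X hX
  by_cases h : X ∈ Metric.closedBall (0 : Euc N) R
  · rw [indicator_of_mem h]
    exact C.abs_tangentDiv_le hL hX
  · rw [indicator_of_notMem h, C.tangentDiv_eq_zero fun h2 => h (hR h2), norm_zero]

/-- The tilt of a stable cone is controlled by its height. -/
theorem integral_tiltIntegrand_le (hP : finrank ℝ P = n) (hρ : 0 < ρ) (hc : 0 < c)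
    (hspt : ∀ X ∈ C.spt, ‖X‖ ≤ c * ‖P.starProjection X‖)
    (hmem : ∀ᵐ X ∂C.mass, X ∈ Submodule.span ℝ (range (C.borelFrame X)))
    (hstable : ∀ Y : Euc N → Euc N, ContDiff ℝ ((⊤ : ℕ∞) : WithTop ℕ∞) Y → HasCompactSupport Y →
      0 ≤ ∫ X, C.tangentDiv Y X ∂C.mass) :
    1 / 2 * C.varifoldIntegral (tiltIntegrand P 0 ρ) ≤
      2 / ρ * C.varifoldIntegral (heightIntegrand P 0 ρ) := by
  have htilt := varifoldIntegrable_tiltIntegrand hP hρ hc hspt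
  have hheight := varifoldIntegrable_heightIntegrand hρ hc hspt
  -- An integrable majorant of the tilt excess on the support inside the cylinder; it absorbs the
  -- loss ε between Θ and the cut-off.
  set k : Euc N → ℝ := (Metric.closedBall (0 : Euc N) (c * ρ)).indicator fun _ => (n : ℝ) with hk
  have hki : Integrable k C.mass := C.integrable_indicator_closedBall (c * ρ) n
  have key : ∀ ε : ℝ, 0 < ε → 1 / 2 * C.varifoldIntegral (tiltIntegrand P 0 ρ) ≤
      ε * ∫ X, k X ∂C.mass + 2 / ρ * C.varifoldIntegral (heightIntegrand P 0 ρ) := by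
    intro ε hε
    obtain ⟨Θ, ψ, hΘ, hder, hψ0, hψ1, hψ, hΘ0, hΘr, hΘc, hlow⟩ := exists_smooth_cutoff hρ hε
    -- The normal field is not compactly supported along Pᗮ. Near each point of the support the
    -- truncation has no effect: either |X| < cρ + 1 and χ = 1, or r > ρ and the field is already
    -- zero.
    let χ : ContDiffBump (0 : Euc N) := ⟨c * ρ + 1, c * ρ + 2, by positivity, by linarith⟩
    set Y : Euc N → Euc N := fun X => χ X • normalField P Θ X with hY
    have hYs : ContDiff ℝ ((⊤ : ℕ∞) : WithTop ℕ∞) Y :=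
      χ.contDiff.smul ((contDiff_comp_norm_starProjection P hρ hΘ hΘc).smul
        Pᗮ.starProjection.contDiff).neg
    have hYc : HasCompactSupport Y := χ.hasCompactSupport.smul_right
    have hpt : ∀ᵐ X ∂C.mass, 1 / 2 * tiltIntegrand P 0 ρ X (C.tangent X) ≤
        ε * k X + (2 / ρ * heightIntegrand P 0 ρ X (C.tangent X) - C.tangentDiv Y X) := by
      filter_upwards [C.ae_tangent_eq, C.ae_mass_orthonormal, hmem, C.ae_mem_spt] with X h1 h2 h3 h4
      have hYX : Y =ᶠ[𝓝 X] normalField P Θ := by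
        by_cases hXn : ‖X‖ < c * ρ + 1
        · have : ∀ᶠ Z in 𝓝 X, ‖Z‖ < c * ρ + 1 :=
            continuous_norm.continuousAt.eventually_lt_const hXn
          filter_upwards [this] with Z hZ
          simp only [hY]
          rw [χ.one_of_mem_closedBall (mem_closedBall_zero_iff.2 hZ.le), one_smul]
        · have hr : ρ < ‖P.starProjection X‖ := by
            have h5 := hspt X h4
            have h6 : c * ρ < c * ‖P.starProjection X‖ := by linarith
            exact lt_of_mul_lt_mul_left h6 hc.le
          have hcont : Continuous fun X => ‖P.starProjection X‖ := by fun_prop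
          filter_upwards [hcont.continuousAt.eventually_const_lt hr] with Z hZ
          simp only [hY, normalField]
          rw [hΘr _ hZ.le, zero_smul, neg_zero, smul_zero]
      rw [tangentDiv_congr hYX, tangentDiv_normalField P hρ hder hΘc h2, h1, tiltIntegrand_eq hP h2]
      have h5 := le_heightIntegrand hρ h3 (P := P) hψ1 hψ
      have h6 := mul_le_mul_of_nonneg_left h5 (by positivity : 0 ≤ 2 / ρ)
      have he0 := tiltExcess_nonneg P (C.borelFrame X)
      have h7 : tiltExcess P (C.borelFrame X) * cutoff (‖P.starProjection X‖ / ρ) ≤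
          ε * k X + Θ ‖P.starProjection X‖ * tiltExcess P (C.borelFrame X) := by
        by_cases hr : ‖P.starProjection X‖ < ρ
        · have hXk : k X = n := indicator_of_mem
            (mem_closedBall_zero_iff.2 ((hspt X h4).trans (by gcongr))) _
          rw [hXk]
          have h8 := mul_le_mul_of_nonneg_left (hlow ‖P.starProjection X‖) he0
          have h9 := mul_le_mul_of_nonneg_left (tiltExcess_le (P := P) h2) hε.le
          linarith
        · rw [cutoff_eq_zero (by rw [le_div_iff₀ hρ]; linarith), mul_zero]
          have h8 : 0 ≤ k X := indicator_nonneg (fun _ _ => by positivity) X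
          have := hΘ0 ‖P.starProjection X‖
          positivity
      linarith
    have hdi := integrable_tangentDiv (C := C) hYs hYc
    have h8 := integral_mono_ae (htilt.const_mul (1 / 2))
      ((hki.const_mul ε).add ((hheight.const_mul (2 / ρ)).sub hdi)) hpt
    rw [integral_const_mul] at h8
    refine h8.trans ?_
    have h9 := hstable Y hYs hYc
    rw [integral_add' (hki.const_mul ε) ((hheight.const_mul (2 / ρ)).sub hdi),
      integral_sub' (hheight.const_mul (2 / ρ)) hdi, integral_const_mul, integral_const_mul]
    change _ + (2 / ρ * C.varifoldIntegral (heightIntegrand P 0 ρ) - _) ≤ _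
    linarith
  have hk0 : 0 ≤ ∫ X, k X ∂C.mass :=
    integral_nonneg fun X => indicator_nonneg (fun _ _ => by positivity) X
  refine le_of_forall_pos_le_add fun ε hε => ?_
  have h := key (ε / (∫ X, k X ∂C.mass + 1)) (by positivity)
  have h2 : ε / (∫ X, k X ∂C.mass + 1) * ∫ X, k X ∂C.mass ≤ ε := by
    rw [div_mul_eq_mul_div, div_le_iff₀ (by positivity)]
    nlinarith
  linarith

end RectifiableCurrent

end

/-! ### Rigidity: positivity of the height -/

section

variable {n N : ℕ}

theorem span_le_of_tiltExcess_eq_zero {P : Submodule ℝ (Euc N)} {τ : Fin n → Euc N}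
    (h : tiltExcess P τ = 0) : Submodule.span ℝ (range τ) ≤ P := by
  rw [Submodule.span_le]
  rintro _ ⟨i, rfl⟩
  have h1 := (Finset.sum_eq_zero_iff_of_nonneg fun i _ => sq_nonneg _).1 h i (Finset.mem_univ i)
  have h2 : Pᗮ.starProjection (τ i) = 0 := norm_eq_zero.1 (pow_eq_zero_iff two_ne_zero |>.1 h1)
  have h3 := Pᗮ.starProjection_apply_eq_zero_iff.1 h2
  rwa [Submodule.orthogonal_orthogonal] at h3

/-- On the plane of an orthonormal frame `σ`, every alternating form is a multiple of the volume
form of `σ`. -/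
theorem apply_eq_frameForm_mul (α : Euc N [⋀^Fin n]→L[ℝ] ℝ) {σ τ : Fin n → Euc N}
    (hσ : Orthonormal ℝ σ) (hτ : ∀ i, τ i ∈ Submodule.span ℝ (range σ)) :
    α τ = frameForm σ τ * α σ := by
  have hb := AlternatingMap.eq_smul_basis_det (EuclideanSpace.basisFun (Fin n) ℝ).toBasis
    (α.toAlternatingMap.compLinearMap (frameMap σ).toLinearMap)
  have hb2 := congrArg (fun g : AlternatingMap ℝ (Euc n) ℝ (Fin n) =>
    g fun i => WithLp.toLp 2 fun j => inner ℝ (σ j) (τ i)) hb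
  simp only [AlternatingMap.compLinearMap_apply, AlternatingMap.smul_apply] at hb2
  have h1 : (fun i => (frameMap σ).toLinearMap (WithLp.toLp 2 fun j => inner ℝ (σ j) (τ i))) = τ := by
    ext1 i
    simp only [ContinuousLinearMap.coe_coe]
    rw [frameMap_apply]
    exact (Orthonormal.starProjection_span hσ (τ i)).symm.trans
      ((Submodule.span ℝ (range σ)).starProjection_eq_self_iff.2 (hτ i))
  have h2 : (fun i => (frameMap σ).toLinearMap ((EuclideanSpace.basisFun (Fin n) ℝ).toBasis i)) = σ := by
    ext1 i
    simp [frameMap_single]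
  have h3 : ((EuclideanSpace.basisFun (Fin n) ℝ).toBasis.det
      fun i => WithLp.toLp 2 fun j => inner ℝ (σ j) (τ i)) = frameForm σ τ := by
    rw [Basis.det_apply, frameForm_apply, ← Matrix.det_transpose]
    congr 1
  rw [h1, h2, h3, smul_eq_mul, mul_comm] at hb2
  exact hb2

theorem frameForm_removeNth {k : ℕ} {σ : Fin (k + 1) → Euc N} (hσ : Orthonormal ℝ σ)
    (i j : Fin (k + 1)) :
    frameForm (i.removeNth σ) (j.removeNth σ) = if j = i then 1 else 0 := by
  split_ifs with h
  · rw [h]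
    exact frameForm_self (hσ.comp _ Fin.succAbove_right_injective)
  · obtain ⟨a, ha⟩ := Fin.exists_succAbove_eq (Ne.symm h)
    rw [frameForm_apply]
    refine Matrix.det_eq_zero_of_row_eq_zero a fun b => ?_
    rw [Matrix.of_apply]
    simp only [Fin.removeNth, ha]
    exact hσ.2 (Fin.succAbove_ne i b)

/-- The volume form of σ without σᵢ vanishes on every other face of σ, so only the derivative along
σᵢ survives. Testing ∂C = 0 with these forms therefore controls each direction of P separately. -/
theorem TestForm.d_smulConst_removeNth {k : ℕ} {σ : Fin (k + 1) → Euc N} (hσ : Orthonormal ℝ σ)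
    {g : Euc N → ℝ} (hg : ContDiff ℝ ((⊤ : ℕ∞) : WithTop ℕ∞) g) (hc : HasCompactSupport g)
    (i : Fin (k + 1)) (X : Euc N) :
    (TestForm.smulConst g hg hc (frameForm (i.removeNth σ))).d.form X σ =
      (-1) ^ (i : ℕ) * fderiv ℝ g X (σ i) := by
  have hgd : Differentiable ℝ g := hg.differentiable (by simp)
  change extDeriv (fun X => g X • frameForm (i.removeNth σ)) X σ = _
  rw [extDeriv_apply ((hgd X).smul_const _), Finset.sum_eq_single i]
  · have h1 : (fun X => (g X • frameForm (i.removeNth σ)) (i.removeNth σ)) = g := by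
      ext1 X
      rw [ContinuousAlternatingMap.smul_apply, frameForm_removeNth hσ, if_pos rfl, smul_eq_mul, mul_one]
    rw [h1, zsmul_eq_mul]
    push_cast
    rfl
  · intro j _ hji
    have h1 : (fun X => (g X • frameForm (i.removeNth σ)) (j.removeNth σ)) = fun _ => (0 : ℝ) := by
      ext1 X
      rw [ContinuousAlternatingMap.smul_apply, frameForm_removeNth hσ, if_neg hji, smul_zero]
    rw [h1]
    simp
  · intro h
    exact absurd (Finset.mem_univ i) h

/-- The translate of a test form. -/
def TestForm.translate {k : ℕ} (α : TestForm N k) (v : Euc N) : TestForm N k where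
  form := fun X => α.form (X - v)
  smooth := α.smooth.comp (contDiff_id.sub contDiff_const)
  compact := α.compact.comp_homeomorph (Homeomorph.subRight v)

/-- A measurable bounded density that annihilates the derivatives along `v` is invariant under
translation along `v`. -/
theorem integral_mul_comp_add_eq {μ : Measure (Euc N)} [IsLocallyFiniteMeasure μ] {w : Euc N → ℝ}
    (hw : AEStronglyMeasurable w μ) {b : ℝ} (hb : ∀ᵐ X ∂μ, ‖w X‖ ≤ b) {v : Euc N}
    (h : ∀ g : Euc N → ℝ, ContDiff ℝ ((⊤ : ℕ∞) : WithTop ℕ∞) g → HasCompactSupport g →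
      ∫ X, w X * fderiv ℝ g X v ∂μ = 0)
    {g : Euc N → ℝ} (hg : ContDiff ℝ ((⊤ : ℕ∞) : WithTop ℕ∞) g) (hc : HasCompactSupport g) :
    ∫ X, w X * g (X + v) ∂μ = ∫ X, w X * g X ∂μ := by
  have hgd : Differentiable ℝ g := hg.differentiable (by simp)
  obtain ⟨L, hL⟩ := hg.lipschitzWith_of_hasCompactSupport hc (by simp)
  obtain ⟨R, hR⟩ := hc.isCompact.isBounded.subset_closedBall 0
  have hint : ∀ f : Euc N → ℝ, Continuous f → HasCompactSupport f →
      Integrable (fun X => w X * f X) μ := fun f hf hfc =>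
    (hf.integrable_of_hasCompactSupport hfc).bdd_mul hw hb
  have hgt : ∀ t : ℝ, ContDiff ℝ ((⊤ : ℕ∞) : WithTop ℕ∞) fun X => g (X + t • v) := fun t =>
    hg.comp (contDiff_id.add contDiff_const)
  have hct : ∀ t : ℝ, HasCompactSupport fun X => g (X + t • v) := fun t =>
    hc.comp_homeomorph (Homeomorph.addRight (t • v))
  have hft : ∀ (t : ℝ) X, fderiv ℝ (fun X => g (X + t • v)) X = fderiv ℝ g (X + t • v) := fun t X =>
    fderiv_comp_add_right (t • v)
  -- The derivative under the integral is the hypothesis applied to the translate of g, so the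
  -- integral is constant in t.
  have hder : ∀ t : ℝ, HasDerivAt (fun t : ℝ => ∫ X, w X * g (X + t • v) ∂μ) 0 t := by
    intro t₀
    have hval : ∫ X, w X * fderiv ℝ g (X + t₀ • v) v ∂μ = 0 := by
      have := h _ (hgt t₀) (hct t₀)
      simpa only [hft] using this
    rw [← hval]
    set R' : ℝ := R + (|t₀| + 1) * ‖v‖ with hR'
    have hfc : Continuous fun X => fderiv ℝ g X v :=
      (hg.continuous_fderiv (by simp)).clm_apply continuous_const
    have hbi : Integrable ((Metric.closedBall (0 : Euc N) R').indicator fun _ => b * (L * ‖v‖)) μ := by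
      rw [integrable_indicator_iff Metric.isClosed_closedBall.measurableSet]
      exact integrableOn_const (isCompact_closedBall _ _).measure_lt_top.ne
    refine (hasDerivAt_integral_of_dominated_loc_of_deriv_le (μ := μ)
      (F := fun t X => w X * g (X + t • v)) (F' := fun t X => w X * fderiv ℝ g (X + t • v) v)
      (Metric.ball_mem_nhds t₀ one_pos) ?_ ?_ ?_ ?_ hbi ?_).2
    · exact Eventually.of_forall fun t => (hint _ (hgt t).continuous (hct t)).aestronglyMeasurable
    · exact hint _ (hgt t₀).continuous (hct t₀)
    · exact hw.mul (hfc.comp (continuous_id.add continuous_const)).aestronglyMeasurable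
    · filter_upwards [hb] with X hX t ht
      have hb0 : 0 ≤ b := (norm_nonneg _).trans hX
      by_cases hXR : X ∈ Metric.closedBall (0 : Euc N) R'
      · rw [indicator_of_mem hXR, norm_mul]
        gcongr
        exact (ContinuousLinearMap.le_opNorm _ _).trans
          (by gcongr; exact norm_fderiv_le_of_lipschitz ℝ hL)
      · have hnot : X + t • v ∉ tsupport g := by
          intro hmem
          have h1 := hR hmem
          rw [mem_closedBall_zero_iff] at h1 hXR
          apply hXR
          have h2 : |t| ≤ |t₀| + 1 := by
            rw [Metric.mem_ball, Real.dist_eq] at ht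
            have := abs_sub_abs_le_abs_sub t t₀
            linarith
          calc ‖X‖ = ‖(X + t • v) - t • v‖ := by rw [add_sub_cancel_right]
            _ ≤ ‖X + t • v‖ + ‖t • v‖ := norm_sub_le _ _
            _ ≤ R + (|t₀| + 1) * ‖v‖ := by
              rw [norm_smul, Real.norm_eq_abs]
              gcongr
        rw [fderiv_of_notMem_tsupport ℝ hnot, indicator_of_notMem hXR]
        simp
    · refine Eventually.of_forall fun X t _ => ?_
      have h1 : HasDerivAt (fun t : ℝ => X + t • v) v t := by
        simpa using ((hasDerivAt_id t).smul_const v).const_add X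
      exact ((hgd _).hasFDerivAt.comp_hasDerivAt t h1).const_mul (w X)
  have hconst := is_const_of_deriv_eq_zero (fun t => (hder t).differentiableAt)
    (fun t => (hder t).deriv) 1 0
  simpa using hconst

namespace RectifiableCurrent

variable {P : Submodule ℝ (Euc N)} {c ρ : ℝ}

theorem ae_tiltExcess_eq_zero_of_integral {C : RectifiableCurrent N n} (hP : finrank ℝ P = n)
    (hρ : 0 < ρ) (hc : 0 < c)
    (hspt : ∀ X ∈ C.spt, ‖X‖ ≤ c * ‖P.starProjection X‖)
    (h : C.varifoldIntegral (tiltIntegrand P 0 ρ) ≤ 0) :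
    ∀ᵐ X ∂C.mass, ‖P.starProjection X‖ < ρ → tiltExcess P (C.borelFrame X) = 0 := by
  have hnn : ∀ X, 0 ≤ tiltIntegrand P 0 ρ X (C.tangent X) := fun X =>
    mul_nonneg (sq_nonneg _) (cutoff_nonneg _)
  have h0 : ∫ X, tiltIntegrand P 0 ρ X (C.tangent X) ∂C.mass = 0 :=
    le_antisymm h (integral_nonneg hnn)
  have h1 := (integral_eq_zero_iff_of_nonneg hnn
    (varifoldIntegrable_tiltIntegrand hP hρ hc hspt)).1 h0
  filter_upwards [h1, C.ae_tangent_eq, C.ae_mass_orthonormal] with X h2 h3 h4 hr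
  rw [h3, tiltIntegrand_eq hP h4, Pi.zero_apply] at h2
  have h5 : 0 < cutoff (‖P.starProjection X‖ / ρ) := by
    rw [← div_lt_one hρ] at hr
    unfold cutoff
    split_ifs <;> linarith
  have h6 := (mul_eq_zero.1 h2).resolve_left two_ne_zero
  exact (mul_eq_zero.1 h6).resolve_right h5.ne'

/-- A cone that is tangent to `P` in a cylinder is supported in `P`. -/
theorem IsCone.spt_subset_of_ae {C : RectifiableCurrent N n} (hC : C.IsCone) (hρ : 0 < ρ)
    (h : ∀ᵐ X ∂C.mass, ‖P.starProjection X‖ < ρ → X ∈ P) : C.spt ⊆ P := by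
  have hcyl : ∀ X ∈ C.spt, ‖P.starProjection X‖ < ρ → X ∈ P := by
    intro X hX hr
    by_contra hXP
    have hV : IsOpen (cylinder ρ 0 P ∩ (P : Set (Euc N))ᶜ) :=
      (isOpen_cylinder_zero ρ P).inter (Submodule.closed_of_finiteDimensional P).isOpen_compl
    obtain ⟨α, hα, hne⟩ := hX _ hV ⟨by rwa [cylinder_zero], hXP⟩
    refine hne ?_
    rw [C.toFunctional_eq_integral_mass]
    refine integral_eq_zero_of_ae ?_
    filter_upwards [h] with Y hY
    have : Y ∉ tsupport α.form := fun hmem => by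
      have h1 := hα hmem
      rw [cylinder_zero] at h1
      exact h1.2 (hY h1.1)
    rw [image_eq_zero_of_notMem_tsupport this]
    rfl
  intro X hX
  -- This dilation brings X into the cylinder, where membership in P is already known.
  set t : ℝ := ρ / (‖P.starProjection X‖ + 1) with ht
  have ht0 : 0 < t := by positivity
  have h1 := hcyl (t • X) (hC.smul_mem_spt ht0 hX) (by
    rw [map_smul, norm_smul, Real.norm_of_nonneg ht0.le, ht, div_mul_eq_mul_div,
      div_lt_iff₀ (by positivity)]
    nlinarith)
  exact (P.smul_mem_iff ht0.ne').1 h1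

/-- A current without boundary whose tangent planes lie in `P` has a support that is invariant
under the translations of `P`. -/
theorem add_mem_spt {k : ℕ} {C : RectifiableCurrent N (k + 1)} (hP : finrank ℝ P = k + 1)
    (hC : C.toFunctional.boundary = 0)
    (h : ∀ᵐ X ∂C.mass, tiltExcess P (C.borelFrame X) = 0) {X v : Euc N} (hX : X ∈ C.spt)
    (hv : v ∈ P) : X + v ∈ C.spt := by
  obtain ⟨σ, hσ, rfl⟩ := exists_orthonormal_span_eq hP
  set w : Euc N → ℝ := fun X => frameForm σ (C.borelFrame X) with hw
  have hwm : AEStronglyMeasurable w C.mass :=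
    (C.measurable_apply_borelFrame (frameForm σ)).aestronglyMeasurable
  have hwb : ∀ᵐ X ∂C.mass, ‖w X‖ ≤ ‖frameForm σ‖ := by
    filter_upwards [C.ae_mass_orthonormal] with X hX
    exact abs_apply_le_of_orthonormal _ hX
  -- All tangent planes lie in the span of σ, so every form enters only through its value on the
  -- fixed frame σ. The current becomes a scalar measure with bounded density w, and ∂C = 0 says
  -- that its derivatives along P vanish.
  have hT : ∀ α : TestForm N (k + 1), C.toFunctional α = ∫ X, w X * α.form X σ ∂C.mass := by
    intro α
    rw [C.toFunctional_eq_integral_mass]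
    refine integral_congr_ae ?_
    filter_upwards [h] with X hX
    exact apply_eq_frameForm_mul _ hσ fun i =>
      span_le_of_tiltExcess_eq_zero hX (Submodule.subset_span ⟨i, rfl⟩)
  have hdir : ∀ g : Euc N → ℝ, ContDiff ℝ ((⊤ : ℕ∞) : WithTop ℕ∞) g → HasCompactSupport g →
      ∀ i, ∫ X, w X * fderiv ℝ g X (σ i) ∂C.mass = 0 := by
    intro g hg hgc i
    have h1 := congrFun hC (TestForm.smulConst g hg hgc (frameForm (i.removeNth σ)))
    change C.toFunctional (TestForm.smulConst g hg hgc (frameForm (i.removeNth σ))).d = 0 at h1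
    rw [hT] at h1
    simp only [TestForm.d_smulConst_removeNth hσ, mul_left_comm (w _)] at h1
    rw [integral_const_mul] at h1
    exact (mul_eq_zero.1 h1).resolve_left (pow_ne_zero _ (by norm_num))
  have hv' : v = ∑ i, inner ℝ (σ i) v • σ i :=
    ((Submodule.starProjection_eq_self_iff).2 hv).symm.trans (Orthonormal.starProjection_span hσ v)
  -- The sign is that of the translated form α(X - v), which serves as the witness near X + v.
  have hdirv : ∀ g : Euc N → ℝ, ContDiff ℝ ((⊤ : ℕ∞) : WithTop ℕ∞) g → HasCompactSupport g →
      ∫ X, w X * fderiv ℝ g X (-v) ∂C.mass = 0 := by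
    intro g hg hgc
    have h1 : ∀ X, w X * fderiv ℝ g X (-v) =
        ∑ i, -inner ℝ (σ i) v * (w X * fderiv ℝ g X (σ i)) := by
      intro X
      conv_lhs => rw [hv', map_neg, map_sum]
      rw [mul_neg, Finset.mul_sum, ← Finset.sum_neg_distrib]
      refine Finset.sum_congr rfl fun i _ => ?_
      rw [map_smul, smul_eq_mul]
      ring
    simp_rw [h1]
    rw [integral_finsetSum]
    · refine Finset.sum_eq_zero fun i _ => ?_
      rw [integral_const_mul, hdir g hg hgc i, mul_zero]
    · intro i _
      refine Integrable.const_mul ?_ _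
      have hfc : Continuous fun X => fderiv ℝ g X (σ i) :=
        (hg.continuous_fderiv (by simp)).clm_apply continuous_const
      exact (hfc.integrable_of_hasCompactSupport (hgc.fderiv_apply (𝕜 := ℝ) _)).bdd_mul hwm hwb
  intro V hV hXV
  obtain ⟨α, hα, hne⟩ := hX _ (hV.preimage (continuous_add_const v)) hXV
  refine ⟨α.translate v, ?_, ?_⟩
  · have h1 : tsupport (α.translate v).form ⊆ (fun Y => Y - v) ⁻¹' tsupport α.form :=
      closure_minimal (fun Y hY => subset_tsupport _ hY)
        ((isClosed_tsupport _).preimage (by fun_prop))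
    intro Y hY
    have := hα (h1 hY)
    simpa using this
  · have hg : ContDiff ℝ ((⊤ : ℕ∞) : WithTop ℕ∞) fun X => α.form X σ :=
      contDiff_alternatingMap_apply α.smooth fun _ => contDiff_const
    have hgc : HasCompactSupport fun X => α.form X σ :=
      α.compact.comp_left (g := fun β : Euc N [⋀^Fin (k + 1)]→L[ℝ] ℝ => β σ) rfl
    have h1 := integral_mul_comp_add_eq hwm hwb hdirv hg hgc
    change C.toFunctional (α.translate v) ≠ 0
    rw [hT]
    simp only [TestForm.translate, sub_eq_add_neg]
    rw [h1, ← hT]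
    exact hne

/-- The height of a cone over a plane different from its support does not vanish. -/
theorem IsCone.varifoldIntegral_heightIntegrand_pos {k : ℕ} {C : RectifiableCurrent N (k + 1)}
    (hC : C.IsCone) (hP : finrank ℝ P = k + 1) (hbdry : C.toFunctional.boundary = 0)
    (h0 : (0 : Euc N) ∈ C.spt) (hne : C.spt ≠ P) (hc : 0 < c)
    (hspt : ∀ X ∈ C.spt, ‖X‖ ≤ c * ‖P.starProjection X‖)
    (hle : ∀ ρ : ℝ, 0 < ρ → 1 / 2 * C.varifoldIntegral (tiltIntegrand P 0 ρ) ≤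
      2 / ρ * C.varifoldIntegral (heightIntegrand P 0 ρ)) (hρ : 0 < ρ) :
    0 < C.varifoldIntegral (heightIntegrand P 0 ρ) := by
  by_contra! hneg
  have htilt : ∀ r : ℝ, 0 < r → C.varifoldIntegral (heightIntegrand P 0 r) ≤ 0 →
      C.varifoldIntegral (tiltIntegrand P 0 r) ≤ 0 := fun r hr h => by
    have h1 := hle r hr
    have h2 := mul_nonpos_of_nonneg_of_nonpos (by positivity : 0 ≤ 2 / r) h
    linarith
  have h1 := ae_tiltExcess_eq_zero_of_integral hP hρ hc hspt (htilt ρ hρ hneg)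
  have hsub : C.spt ⊆ P := by
    refine hC.spt_subset_of_ae hρ ?_
    filter_upwards [h1, hC.ae_mem_tangent] with X h2 h3 hr
    exact span_le_of_tiltExcess_eq_zero (h2 hr) h3
  -- Inside P the height vanishes at every scale, and hence so does the tilt. The constancy argument
  -- needs tangency to P almost everywhere, not only in one cylinder.
  have hheight : ∀ r : ℝ, 0 < r → C.varifoldIntegral (heightIntegrand P 0 r) ≤ 0 := by
    intro r hr
    refine (integral_eq_zero_of_ae ?_).le
    filter_upwards [C.ae_mem_spt] with X hX
    by_cases hXA : X ∈ cylinder r 0 P \ closure (cylinder (r / 2) 0 P)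
    · have h2 : Pᗮ.starProjection X = 0 := by
        rw [Submodule.starProjection_apply_eq_zero_iff, Submodule.orthogonal_orthogonal]
        exact hsub hX
      rw [heightIntegrand_of_mem hr hXA, h2]
      simp
    · rw [heightIntegrand, indicator_of_notMem hXA]
      rfl
  have h2 : ∀ᵐ X ∂C.mass, tiltExcess P (C.borelFrame X) = 0 := by
    have h3 : ∀ᵐ X ∂C.mass, ∀ j : ℕ, ‖P.starProjection X‖ < (j + 1 : ℝ) →
        tiltExcess P (C.borelFrame X) = 0 := ae_all_iff.2 fun j =>
      ae_tiltExcess_eq_zero_of_integral hP (by positivity) hc hspt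
        (htilt _ (by positivity) (hheight _ (by positivity)))
    filter_upwards [h3] with X hX
    obtain ⟨j, hj⟩ := exists_nat_gt ‖P.starProjection X‖
    exact hX j (by linarith)
  refine hne (hsub.antisymm fun v hv => ?_)
  have := add_mem_spt hP hbdry h2 h0 hv
  rwa [zero_add] at this

end RectifiableCurrent

end

end PlanarFrequency

end

/-! ### The planar frequency bound -/

open PlanarFrequency in
theorem lemma6p4 (n m : ℕ) (hn : 2 ≤ n) (hm : 1 ≤ m)
    (C : RectifiableCurrent (n + m) n)
    (P : Submodule ℝ (Euc (n + m)))
    (hP : Module.finrank ℝ P = n)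
    (hC_min : C.LocallyAreaMinimizing)
    (hC_bdry : C.toFunctional.boundary = 0)
    (hC_cone : C.IsCone)
    (hC_ne : C.toFunctional ≠ 0)
    (hC_perp : C.spt ∩ (Pᗮ : Set (Euc (n + m))) = {0})
    (hC_P : C.spt ≠ (P : Set (Euc (n + m)))) :
    -- the height of the cone over `P` is bounded in each cylinder
    (∀ ρ₀ : ℝ, 0 < ρ₀ →
      BddAbove ((fun X => Metric.infDist X (affinePlane 0 P)) '' (C.spt ∩ cylinder ρ₀ 0 P))) ∧
    -- the frequency is well defined and at most one at all scales
    ∀ ρ : ℝ, 0 < ρ →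
      C.VarifoldIntegrable (heightIntegrand P 0 ρ) ∧
      C.VarifoldIntegrable (tiltIntegrand P 0 ρ) ∧
      0 < heightH C P 0 ρ ∧
      planarFrequency C P 0 ρ ≤ 1 := by
  -- The boundary of a current is the dual of d only in positive dimension; in dimension zero it is
  -- zero by definition.
  obtain ⟨k, rfl⟩ : ∃ k, n = k + 1 := ⟨n - 1, by omega⟩
  have h0 : (0 : Euc (k + 1 + m)) ∈ C.spt := by
    have : (0 : Euc (k + 1 + m)) ∈ C.spt ∩ (Pᗮ : Set (Euc (k + 1 + m))) := by
      rw [hC_perp]; rfl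
    exact this.1
  obtain ⟨c, hc, hspt⟩ := hC_cone.exists_norm_le hC_perp.le
  have hle : ∀ ρ : ℝ, 0 < ρ → 1 / 2 * C.varifoldIntegral (tiltIntegrand P 0 ρ) ≤
      2 / ρ * C.varifoldIntegral (heightIntegrand P 0 ρ) := fun ρ hρ =>
    RectifiableCurrent.integral_tiltIntegrand_le hP hρ hc hspt hC_cone.ae_mem_tangent
      fun Y hY hYc => C.integral_tangentDiv_nonneg hC_min hC_bdry hY hYc
  refine ⟨fun ρ₀ hρ₀ => ⟨c * ρ₀, ?_⟩, fun ρ hρ =>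
    ⟨RectifiableCurrent.varifoldIntegrable_heightIntegrand hρ hc hspt,
      RectifiableCurrent.varifoldIntegrable_tiltIntegrand hP hρ hc hspt, ?_⟩⟩
  · rintro _ ⟨X, ⟨hX, hr⟩, rfl⟩
    rw [cylinder_zero] at hr
    have hr' : ‖P.starProjection X‖ ≤ ρ₀ := le_of_lt hr
    simp only [infDist_affinePlane_zero]
    exact (Pᗮ.norm_starProjection_apply_le X).trans ((hspt X hX).trans (by gcongr))
  · have hpos := hC_cone.varifoldIntegral_heightIntegrand_pos hP hC_bdry h0 hC_P hc hspt hle hρ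
    have hH : 0 < heightH C P 0 ρ := by
      rw [heightH]; positivity
    refine ⟨hH, ?_⟩
    rw [planarFrequency, div_le_one hH, tiltD, heightH]
    have hz : ρ ^ (2 - ((k + 1 : ℕ) : ℤ)) = ρ ^ (1 - ((k + 1 : ℕ) : ℤ)) * ρ := by
      rw [← zpow_add_one₀ hρ.ne']
      congr 1
      ring
    calc 1 / 2 * ρ ^ (2 - ((k + 1 : ℕ) : ℤ)) * C.varifoldIntegral (tiltIntegrand P 0 ρ)
        = ρ ^ (1 - ((k + 1 : ℕ) : ℤ)) * ρ * (1 / 2 * C.varifoldIntegral (tiltIntegrand P 0 ρ)) := by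
          rw [hz]; ring
      _ ≤ ρ ^ (1 - ((k + 1 : ℕ) : ℤ)) * ρ *
          (2 / ρ * C.varifoldIntegral (heightIntegrand P 0 ρ)) :=
          mul_le_mul_of_nonneg_left (hle ρ hρ) (by positivity)
      _ = _ := by field_simp
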